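/- Let $\mathbb{F}$ be a field of prime characteristic $p$ and let $L$ be a finite-dimensional restricted Lie algebra over $\mathbb{F}$, with $[p]$-map $x\mapsto x^{[p]}$. Let $u(L)$ denote its restricted universal enveloping algebra, i.e. the quotient of the universal enveloping algebra of $L$ by the two-sided ideal generated by all $x^p-x^{[p]}$ $(x\in L)$. Let $P_L(\mathbb{F})$ denote the projective cover of the one-dimensional trivial $u(L)$-module $\mathbb{F}$. A torus of $L$ is an abelian $p$-subalgebra $T$ (a subalgebra closed under $x\mapsto x^{[p]}$) each of whose elements $x$ lies in the $\mathbb{F}$-span of $\{x^{[p]^n}\mid n\ge 1\}$. Let $\mathrm{MT}(L)$ denote the largest dimension of a torus of $L$. One says that $L$ has maximal $0$-PIM if $$\dim_{\mathbb{F}} P_L(\mathbb{F})=p^{\dim_{\mathbb{F}} L-\mathrm{MT}(L)}.$$ **Theorem.** If $L$ is solvable, then $L$ has maximal $0$-PIM. Consequently, for every torus $T$ of $L$ with $\dim_{\mathbb{F}}T=\mathrm{MT}(L)$ there is an isomorphism of $u(L)$-modules $$P_L(\mathbb{F})\cong u(L)\otimes_{u(T)}\mathbb{F},$$ where $\mathbb{F}$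 on the right is the one-dimensional trivial $u(T)$-module. -/

import Mathlib

open scoped TensorProduct

attribute [local instance 100] LieRing.ofAssociativeRing

universe u v w

/-! ### Restricted Lie algebras -/

/-- `jacobsonCoeff x y n k` is the coefficient at `X ^ k` of `(ad (X x + y)) ^ n (x)`, computed in
the Lie algebra of polynomials in `X` with coefficients in `L`
(see `ad_pow_eq_sum_jacobsonCoeff`). -/
def jacobsonCoeff {L : Type v} [LieRing L] (x y : L) : ℕ → ℕ → L
  | 0, 0 => x
  | 0, _ + 1 => 0
  | n + 1, 0 => ⁅y, jacobsonCoeff x y n 0⁆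
  | n + 1, k + 1 => ⁅x, jacobsonCoeff x y n k⁆ + ⁅y, jacobsonCoeff x y n (k + 1)⁆

theorem jacobsonCoeff_eq_zero {L : Type v} [LieRing L] (x y : L) (n k : ℕ) (h : n < k) :
    jacobsonCoeff x y n k = 0 := by
  induction n generalizing k with
  | zero => cases k with
    | zero => omega
    | succ k => rfl
  | succ n ih => cases k with
    | zero => omega
    | succ k => simp [jacobsonCoeff, ih k (by omega), ih (k + 1) (by omega)]

theorem ad_pow_eq_sum_jacobsonCoeff (F : Type u) [Field F] {L : Type v} [LieRing L]
    [LieAlgebra F L] (x y : L) (n : ℕ) :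
    ((LieAlgebra.ad (Polynomial F) (Polynomial F ⊗[F] L)
        ((Polynomial.X : Polynomial F) ⊗ₜ[F] x + 1 ⊗ₜ[F] y)) ^ n) (1 ⊗ₜ[F] x) =
      ∑ k ∈ Finset.range (n + 1),
        (Polynomial.X ^ k : Polynomial F) ⊗ₜ[F] jacobsonCoeff x y n k := by
  induction n with
  | zero => simp [jacobsonCoeff]
  | succ n ih =>
    rw [pow_succ', Module.End.mul_apply, ih, Finset.sum_range_succ' _ (n + 1)]
    simp only [map_sum, LieAlgebra.ad_apply, add_lie, LieAlgebra.ExtendScalars.bracket_tmul,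
      jacobsonCoeff, TensorProduct.tmul_add, Finset.sum_add_distrib, one_mul, ← pow_succ']
    rw [add_assoc, Finset.sum_range_succ' (fun k => (Polynomial.X ^ k : Polynomial F) ⊗ₜ[F]
      ⁅y, jacobsonCoeff x y n k⁆) n, Finset.sum_range_succ (fun k =>
      (Polynomial.X ^ (k + 1) : Polynomial F) ⊗ₜ[F] ⁅y, jacobsonCoeff x y n (k + 1)⁆) n,
      jacobsonCoeff_eq_zero x y n (n + 1) (by omega)]
    simp

/-- The Lie polynomials `s_i(x, y)` of Jacobson's formula, characterised by
`(ad (X x + y)) ^ (p - 1) (x) = ∑ i ∈ {1, …, p - 1}, i s_i(x, y) X ^ (i - 1)`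
(used for `1 ≤ i ≤ p - 1`, where `i` is invertible in a field of characteristic `p`). -/
def jacobsonS (F : Type u) (p : ℕ) {L : Type v} [Field F] [LieRing L] [LieAlgebra F L]
    (i : ℕ) (x y : L) : L :=
  (i : F)⁻¹ • jacobsonCoeff x y (p - 1) (i - 1)

/-- A restricted Lie algebra over a field `F` (of prime characteristic `p`): a Lie algebra with a
`[p]`-map in the sense of Jacobson. -/
class RestrictedLieAlgebra (F : Type u) (p : ℕ) (L : Type v) [Field F] [LieRing L]
    [LieAlgebra F L] where
  /-- The `[p]`-map `x ↦ x^[p]`. -/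
  pMap : L → L
  ad_pMap : ∀ x : L, LieAlgebra.ad F L (pMap x) = LieAlgebra.ad F L x ^ p
  pMap_smul : ∀ (a : F) (x : L), pMap (a • x) = a ^ p • pMap x
  pMap_add : ∀ x y : L,
    pMap (x + y) = pMap x + pMap y + ∑ i ∈ Finset.Icc 1 (p - 1), jacobsonS F p i x y

open RestrictedLieAlgebra

/-- A `p`-subalgebra: a Lie subalgebra closed under the `[p]`-map. -/
structure PSubalgebra (F : Type u) (p : ℕ) (L : Type v) [Field F] [LieRing L] [LieAlgebra F L]
    [RestrictedLieAlgebra F p L] extends LieSubalgebra F L where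
  pMap_mem : ∀ x ∈ toLieSubalgebra, pMap F p x ∈ toLieSubalgebra

theorem coe_jacobsonCoeff {F : Type u} {L : Type v} [Field F] [LieRing L] [LieAlgebra F L]
    (H : LieSubalgebra F L) (x y : H) (n k : ℕ) :
    ((jacobsonCoeff x y n k : H) : L) = jacobsonCoeff (x : L) (y : L) n k := by
  induction n generalizing k with
  | zero => cases k <;> rfl
  | succ n ih => cases k <;> simp [jacobsonCoeff, ih]

/-- A `p`-subalgebra is a restricted Lie algebra under the restriction of the `[p]`-map. -/
instance PSubalgebra.restrictedLieAlgebra {F : Type u} {p : ℕ} {L : Type v} [Field F] [LieRing L]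
    [LieAlgebra F L] [RestrictedLieAlgebra F p L] (H : PSubalgebra F p L) :
    RestrictedLieAlgebra F p H.toLieSubalgebra where
  pMap x := ⟨pMap F p (x : L), H.pMap_mem x x.2⟩
  ad_pMap x := by
    ext y
    rw [LieSubalgebra.coe_ad_pow, LieAlgebra.ad_apply, LieSubalgebra.coe_bracket,
      ← LieAlgebra.ad_apply F, ad_pMap]
  pMap_smul a x := by
    apply Subtype.ext
    simp [pMap_smul]
  pMap_add x y := by
    apply Subtype.ext
    simp [pMap_add, jacobsonS, coe_jacobsonCoeff]

/-! ### Tori -/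

/-- `x` is semisimple if it lies in the `p`-subalgebra generated by `x^[p]`, that is, in the linear
span of the elements `x^([p]^n)` with `n ≥ 1`. -/
def IsPSemisimple (F : Type u) (p : ℕ) {L : Type v} [Field F] [LieRing L] [LieAlgebra F L]
    [RestrictedLieAlgebra F p L] (x : L) : Prop :=
  x ∈ Submodule.span F {y : L | ∃ n : ℕ, 1 ≤ n ∧ y = (pMap F p)^[n] x}

/-- A torus: an abelian `p`-subalgebra all of whose elements are semisimple. -/
def PSubalgebra.IsTorus {F : Type u} {p : ℕ} {L : Type v} [Field F] [LieRing L]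
    [LieAlgebra F L] [RestrictedLieAlgebra F p L] (T : PSubalgebra F p L) : Prop :=
  (∀ x ∈ T.toLieSubalgebra, ∀ y ∈ T.toLieSubalgebra, ⁅x, y⁆ = 0) ∧
    ∀ x ∈ T.toLieSubalgebra, IsPSemisimple F p x

/-- `MT(L)`, the largest dimension of a torus in `L`. -/
noncomputable def maxTorusDim (F : Type u) (p : ℕ) (L : Type v) [Field F] [LieRing L]
    [LieAlgebra F L] [RestrictedLieAlgebra F p L] : ℕ :=
  sSup {d : ℕ | ∃ T : PSubalgebra F p L, T.IsTorus ∧ Module.finrank F T.toLieSubalgebra = d}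

theorem pMap_zero (F : Type u) (p : ℕ) (L : Type v) [Field F] [LieRing L] [LieAlgebra F L]
    [RestrictedLieAlgebra F p L] [Fact p.Prime] : pMap F p (0 : L) = 0 := by
  have h := pMap_smul (p := p) (0 : F) (0 : L)
  rwa [zero_pow (Fact.out : p.Prime).ne_zero, zero_smul, zero_smul] at h

/-- The supremum defining `MT(L)` is a maximum. -/
theorem isGreatest_maxTorusDim (F : Type u) (p : ℕ) (L : Type v) [Field F] [LieRing L]
    [LieAlgebra F L] [RestrictedLieAlgebra F p L] [Fact p.Prime] [FiniteDimensional F L] :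
    IsGreatest {d : ℕ | ∃ T : PSubalgebra F p L, T.IsTorus ∧
      Module.finrank F T.toLieSubalgebra = d} (maxTorusDim F p L) := by
  have hb : BddAbove {d : ℕ | ∃ T : PSubalgebra F p L, T.IsTorus ∧
      Module.finrank F T.toLieSubalgebra = d} := by
    refine ⟨Module.finrank F L, ?_⟩
    rintro d ⟨T, -, rfl⟩
    exact Submodule.finrank_le T.toLieSubalgebra.toSubmodule
  refine ⟨Nat.sSup_mem ⟨_, ⟨⟨⊥, ?_⟩, ⟨?_, ?_⟩, rfl⟩⟩ hb, fun d hd => le_csSup hb hd⟩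
  · intro x hx
    rw [LieSubalgebra.mem_bot] at hx ⊢
    rw [hx, pMap_zero]
  · intro x hx y _
    rw [(LieSubalgebra.mem_bot x).1 hx, zero_lie]
  · intro x hx
    rw [(LieSubalgebra.mem_bot x).1 hx]
    exact Submodule.zero_mem _

/-! ### The restricted universal enveloping algebra -/

/-- The relations `x ^ p = x^[p]`, for `x ∈ L`, on the universal enveloping algebra of `L`. -/
inductive RestrictedEnvelopingAlgebra.Rel (F : Type u) (p : ℕ) (L : Type v) [Field F] [LieRing L]
    [LieAlgebra F L] [RestrictedLieAlgebra F p L] :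
    UniversalEnvelopingAlgebra F L → UniversalEnvelopingAlgebra F L → Prop
  | pow_eq (x : L) : Rel F p L (UniversalEnvelopingAlgebra.ι F x ^ p)
      (UniversalEnvelopingAlgebra.ι F (pMap F p x))

/-- The restricted universal enveloping algebra `u(L) = u(L, 0)`: the quotient of the universal
enveloping algebra by the two-sided ideal generated by all `x ^ p - x^[p]`, `x ∈ L`. -/
abbrev RestrictedEnvelopingAlgebra (F : Type u) (p : ℕ) (L : Type v) [Field F] [LieRing L]
    [LieAlgebra F L] [RestrictedLieAlgebra F p L] : Type (max u v) :=
  RingQuot (RestrictedEnvelopingAlgebra.Rel F p L)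

namespace RestrictedEnvelopingAlgebra

/-- The canonical map `L → u(L)`. -/
noncomputable def ι (F : Type u) (p : ℕ) (L : Type v) [Field F] [LieRing L] [LieAlgebra F L]
    [RestrictedLieAlgebra F p L] : L →ₗ⁅F⁆ RestrictedEnvelopingAlgebra F p L :=
  ((RingQuot.mkAlgHom F (Rel F p L)) : _ →ₗ⁅F⁆ _).comp (UniversalEnvelopingAlgebra.ι F)

theorem ι_pow (F : Type u) (p : ℕ) (L : Type v) [Field F] [LieRing L] [LieAlgebra F L]
    [RestrictedLieAlgebra F p L] (x : L) : ι F p L x ^ p = ι F p L (pMap F p x) := by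
  have h := RingQuot.mkAlgHom_rel F (Rel.pow_eq (F := F) (p := p) x)
  rw [map_pow] at h
  exact h

/-- The universal property of `u(L)`. -/
noncomputable def lift {F : Type u} {p : ℕ} {L : Type v} [Field F] [LieRing L] [LieAlgebra F L]
    [RestrictedLieAlgebra F p L] {A : Type w} [Ring A] [Algebra F A] (f : L →ₗ⁅F⁆ A)
    (hf : ∀ x, f x ^ p = f (pMap F p x)) : RestrictedEnvelopingAlgebra F p L →ₐ[F] A :=
  RingQuot.liftAlgHom F ⟨UniversalEnvelopingAlgebra.lift F f, by
    rintro _ _ ⟨x⟩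
    rw [map_pow, UniversalEnvelopingAlgebra.lift_ι_apply, hf,
      UniversalEnvelopingAlgebra.lift_ι_apply]⟩

theorem lift_ι {F : Type u} {p : ℕ} {L : Type v} [Field F] [LieRing L] [LieAlgebra F L]
    [RestrictedLieAlgebra F p L] {A : Type w} [Ring A] [Algebra F A] (f : L →ₗ⁅F⁆ A)
    (hf : ∀ x, f x ^ p = f (pMap F p x)) (x : L) : lift f hf (ι F p L x) = f x := by
  simp only [lift, ι, LieHom.comp_apply, AlgHom.coe_toLieHom]
  rw [RingQuot.liftAlgHom_mkAlgHom_apply, UniversalEnvelopingAlgebra.lift_ι_apply]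

/-- The augmentation `u(L) → F`, which vanishes on `L`. -/
noncomputable def augmentation (F : Type u) (p : ℕ) (L : Type v) [Field F] [LieRing L]
    [LieAlgebra F L] [RestrictedLieAlgebra F p L] [Fact p.Prime] :
    RestrictedEnvelopingAlgebra F p L →ₐ[F] F :=
  lift 0 fun x => by
    simp [zero_pow (Fact.out : p.Prime).ne_zero]

/-- The algebra homomorphism `u(H) → u(L)` induced by the inclusion of a `p`-subalgebra. -/
noncomputable def inclusion {F : Type u} {p : ℕ} {L : Type v} [Field F] [LieRing L]
    [LieAlgebra F L] [RestrictedLieAlgebra F p L] (H : PSubalgebra F p L) :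
    RestrictedEnvelopingAlgebra F p H.toLieSubalgebra →ₐ[F] RestrictedEnvelopingAlgebra F p L :=
  lift ((ι F p L).comp H.toLieSubalgebra.incl) fun x => ι_pow F p L x

end RestrictedEnvelopingAlgebra

/-- The one-dimensional trivial module of `L`: the field `F` on which `u(L)` acts through the
augmentation. -/
def TrivialLModule (F : Type u) (p : ℕ) (L : Type v) : Type u := F

namespace TrivialLModule

variable (F : Type u) (p : ℕ) (L : Type v) [Field F] [LieRing L] [LieAlgebra F L]
  [RestrictedLieAlgebra F p L] [Fact p.Prime]

instance : AddCommGroup (TrivialLModule F p L) := inferInstanceAs (AddCommGroup F)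

instance : Module F (TrivialLModule F p L) := inferInstanceAs (Module F F)

noncomputable instance : Module (RestrictedEnvelopingAlgebra F p L) (TrivialLModule F p L) :=
  Module.compHom F (RestrictedEnvelopingAlgebra.augmentation F p L).toRingHom

theorem smul_def (a : RestrictedEnvelopingAlgebra F p L) (m : TrivialLModule F p L) :
    a • m = RestrictedEnvelopingAlgebra.augmentation F p L a • m := rfl

instance : IsScalarTower F (RestrictedEnvelopingAlgebra F p L) (TrivialLModule F p L) where
  smul_assoc c a m := by
    rw [smul_def, smul_def, map_smul, smul_assoc]

end TrivialLModule

/-! ### Induced modules and projective covers -/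

/-- The tensor product `A ⊗_B V` along a homomorphism `f : B → A` of `F`-algebras, as a left
`A`-module: the quotient of `A ⊗_F V` by the relations `a f(b) ⊗ v = a ⊗ b v`. -/
abbrev AlgInducedModule {F : Type u} [Field F] {A B : Type*} [Ring A] [Ring B] [Algebra F A]
    [Algebra F B] (f : B →ₐ[F] A) (V : Type*) [AddCommGroup V] [Module F V] [Module B V]
    [IsScalarTower F B V] :=
  (A ⊗[F] V) ⧸ Submodule.span A
    {z : A ⊗[F] V | ∃ (a : A) (b : B) (v : V), z = (a * f b) ⊗ₜ[F] v - a ⊗ₜ[F] (b • v)}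

/-- The induced module `Ind_H^L(V, 0) = u(L) ⊗_{u(H)} V`. -/
abbrev Ind {F : Type u} {p : ℕ} {L : Type v} [Field F] [LieRing L] [LieAlgebra F L]
    [RestrictedLieAlgebra F p L] (H : PSubalgebra F p L) (V : Type w) [AddCommGroup V]
    [Module F V] [Module (RestrictedEnvelopingAlgebra F p H.toLieSubalgebra) V]
    [IsScalarTower F (RestrictedEnvelopingAlgebra F p H.toLieSubalgebra) V] :=
  AlgInducedModule (RestrictedEnvelopingAlgebra.inclusion H) V

/-- `π : P → M` is a projective cover of the `A`-module `M`: `P` is projective, `π` is surjective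
and the kernel of `π` is contained in the radical of `P` (the intersection of the maximal
submodules). -/
structure IsProjectiveCover {A P M : Type*} [Ring A] [AddCommGroup P] [Module A P]
    [AddCommGroup M] [Module A M] (π : P →ₗ[A] M) : Prop where
  projective : Module.Projective A P
  surjective : Function.Surjective π
  ker_le : LinearMap.ker π ≤ Module.jacobson A P

/-- `L` has maximal `0`-PIM: the projective cover of the trivial `u(L)`-module (which is unique up
to isomorphism) has dimension `p ^ (dim L - MT(L))`. -/
def HasMaximalZeroPIM (F : Type u) (p : ℕ) (L : Type v) [Field F] [LieRing L]
    [LieAlgebra F L] [RestrictedLieAlgebra F p L] [Fact p.Prime] : Prop :=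
  ∃ (P : Type (max u v)) (_ : AddCommGroup P) (_ : Module F P)
    (_ : Module (RestrictedEnvelopingAlgebra F p L) P)
    (_ : IsScalarTower F (RestrictedEnvelopingAlgebra F p L) P)
    (π : P →ₗ[RestrictedEnvelopingAlgebra F p L] TrivialLModule F p L),
    IsProjectiveCover π ∧ Module.finrank F P = p ^ (Module.finrank F L - maxTorusDim F p L)

/-!
Write `u = u(L)` and let `T` be a torus of maximal dimension. Since `u(T)` is commutative and every
element of `T` is semisimple, `u(T)` contains an idempotent `e` with augmentation `1` that is
annihilated by `T` (`exists_isTrivialIdempotent`): for a single `t` with `t = ∑ c_n t^[p]^n` it is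
`1 - ∑ c_n t ^ (p ^ n - 1)`, and products of these serve for all of `T`. The left ideal `u e` is
projective and is the module induced from the trivial `u(T)`-module
(`nonempty_ind_linearEquiv_leftIdeal`). Multiplied by `e`, the ordered monomials in a basis of a
complement of `T` span it, so its dimension is at most `p ^ (dim L - dim T)`
(`finite_and_finrank_range_mulRight_le`).

What has to be shown is that `e` is local: every element of `u e` with nonzero augmentation
generates `u e`. Then `u e` is a projective cover of the trivial module
(`isProjectiveCover_leftIdealAugmentation`), and every other one is isomorphic to it
(`nonempty_linearEquiv_leftIdeal`).

Locality and the lower bound `p ^ (dim L - dim T) ≤ dim u e` are proved together, for one suitable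
torus, by induction on `dim L` (`exists_torus_isLocalIdempotent`). As `L` is solvable, it has a
maximal proper `p`-subalgebra `I` containing `[L, L]` (`exists_maximal_pSubalgebra`), to which the
induction hypothesis applies. There are two cases.

* If `x^[p] ∈ I` for some `x ∉ I`, then `L = I ⊕ F x`, and the torus of `I` serves for `L`. The
  dimension is multiplied by `p`: with `b = x^[p]`, the algebra `u(L)` acts on the sequences in
  `u(I)` with `f (n + p) = f n * b`, the element `x` as a derivation plus the shift
  (`mul_finrank_le_of_codim_one`).
* Otherwise `L = I + T'` for a torus `T'` containing the torus of `I`, and `T'` serves for `L`. The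
  dimension does not drop, because `T'` acts on `u(I) e` by derivations (`finrank_le_of_torus`).

Locality means that the simple modules not annihilated by the idempotent are trivial
(`isLocalIdempotent_of_simple`). Such a module is annihilated by `I`
(`ι_smul_eq_zero_of_isSimpleModule`), and then also by `x` or `T'`.

The local idempotent so obtained is compared with the idempotent of an arbitrary torus by right
multiplication. The comparison map is onto, so that the torus constructed has maximal dimension, and
for every other torus of maximal dimension it is bijective, which makes the idempotent of that torus
local too (`isLocalIdempotent_of_finrank_eq_maxTorusDim`).

The calculations in `u(L)` rest on Jacobson's formula for `(x + y) ^ p` in an associative algebra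
(`add_pow_char_eq_jacobson`); it allows the relations `x ^ p = x^[p]` to be checked on a spanning
set (`pow_eq_map_pMap_of_span`).
-/

/-! ### Jacobson's formula in associative algebras -/

theorem cast_choose_pred_char {R : Type*} [Ring R] (p : ℕ) [hp : Fact p.Prime] [CharP R p]
    (k : ℕ) (hk : k < p) : ((p - 1).choose k : R) = (-1) ^ k := by
  induction k with
  | zero => simp
  | succ k ih =>
    have h1 : (p.choose (k + 1) : R) = 0 :=
      (CharP.cast_eq_zero_iff R p _).2 (hp.out.dvd_choose_self (by omega) hk)
    have h2 : p.choose (k + 1) = (p - 1).choose k + (p - 1).choose (k + 1) := by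
      rw [Nat.choose_eq_choose_pred_add hp.out.pos (by omega)]; simp
    rw [h2, Nat.cast_add, ih (by omega)] at h1
    rw [pow_succ, mul_neg_one]
    exact eq_neg_of_add_eq_zero_right h1

theorem neg_one_pow_pred_char {R : Type*} [Ring R] (p : ℕ) [hp : Fact p.Prime] [CharP R p] :
    (-1 : R) ^ (p - 1) = 1 := by
  rw [← cast_choose_pred_char p (p - 1) (Nat.sub_lt hp.out.pos one_pos)]
  simp

theorem Commute.sub_pow_pred_char {R : Type*} [Ring R] (p : ℕ) [hp : Fact p.Prime] [CharP R p]
    {x y : R} (h : Commute x y) :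
    (x - y) ^ (p - 1) = ∑ i ∈ Finset.range p, x ^ i * y ^ (p - 1 - i) := by
  rw [sub_eq_add_neg, h.neg_right.add_pow, Nat.sub_add_cancel hp.out.one_le]
  refine Finset.sum_congr rfl fun i hi => ?_
  have hi' := Finset.mem_range.1 hi
  rw [cast_choose_pred_char p i hi', neg_pow y, mul_assoc, mul_assoc]
  have hc : y ^ (p - 1 - i) * (-1) ^ i = (-1) ^ i * y ^ (p - 1 - i) :=
    ((Commute.neg_one_left _).pow_left i).symm
  rw [hc, ← mul_assoc ((-1) ^ (p - 1 - i)), ← pow_add, Nat.sub_add_cancel (by omega),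
    neg_one_pow_pred_char, one_mul]

/-- In characteristic `p`, the derivative of `a ↦ a ^ p` in the direction `h` is
`(ad a) ^ (p - 1) (h)`. -/
theorem sum_pow_mul_pow_eq_ad_pow {R : Type*} [Ring R] (p : ℕ) [hp : Fact p.Prime] [CharP R p]
    (a h : R) :
    ∑ i ∈ Finset.range p, a ^ i * h * a ^ (p - 1 - i) = (fun z => a * z - z * a)^[p - 1] h := by
  have : CharP (Module.End ℤ R) p := by
    refine ⟨fun x => ?_⟩
    rw [← CharP.cast_eq_zero_iff R p x]
    constructor
    · intro hx
      simpa [Module.End.natCast_apply] using LinearMap.congr_fun hx (1 : R)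
    · intro hx
      ext r
      simp [Module.End.natCast_apply, hx]
  have key := LinearMap.congr_fun
    (Commute.sub_pow_pred_char p (LinearMap.commute_mulLeft_right (R := ℤ) a a)) h
  have h1 : (fun z => a * z - z * a) = ⇑(LinearMap.mulLeft ℤ a - LinearMap.mulRight ℤ a) := by
    ext z; simp
  rw [h1, ← Module.End.coe_pow, key, LinearMap.sum_apply]
  refine Finset.sum_congr rfl fun i _ => ?_
  rw [Module.End.mul_apply, LinearMap.pow_mulLeft, LinearMap.pow_mulRight, LinearMap.mulLeft_apply,
    LinearMap.mulRight_apply, mul_assoc]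

theorem Polynomial.derivative_pow_noncomm {R : Type*} [Semiring R] (g : Polynomial R) (n : ℕ) :
    derivative (g ^ n) = ∑ i ∈ Finset.range n, g ^ i * derivative g * g ^ (n - 1 - i) := by
  induction n with
  | zero => simp
  | succ n ih =>
    rw [pow_succ, derivative_mul, ih, Finset.sum_range_succ, Finset.sum_mul]
    simp only [add_tsub_cancel_right, tsub_self, pow_zero, mul_one]
    congr 1
    refine Finset.sum_congr rfl fun i hi => ?_
    have := Finset.mem_range.1 hi
    rw [mul_assoc, ← pow_succ]
    congr 2
    omega

theorem iterate_commutator_eq_sum_jacobsonCoeff {A : Type*} [Ring A] (x y : A) (n : ℕ) :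
    (fun z => (Polynomial.C x * Polynomial.X + Polynomial.C y) * z -
      z * (Polynomial.C x * Polynomial.X + Polynomial.C y))^[n] (Polynomial.C x) =
    ∑ k ∈ Finset.range (n + 1), Polynomial.C (jacobsonCoeff x y n k) * Polynomial.X ^ k := by
  induction n with
  | zero => simp [jacobsonCoeff]
  | succ n ih =>
    have hstep : ∀ c : A, ∀ k : ℕ, (Polynomial.C x * Polynomial.X + Polynomial.C y) *
        (Polynomial.C c * Polynomial.X ^ k) -
        (Polynomial.C c * Polynomial.X ^ k) * (Polynomial.C x * Polynomial.X + Polynomial.C y) =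
        Polynomial.C ⁅x, c⁆ * Polynomial.X ^ (k + 1) + Polynomial.C ⁅y, c⁆ * Polynomial.X ^ k := by
      intro c k
      ext m
      simp only [Ring.lie_def, add_mul, mul_add, Polynomial.coeff_sub, Polynomial.coeff_add,
        map_sub, sub_mul]
      have e1 : Polynomial.C x * Polynomial.X * (Polynomial.C c * Polynomial.X ^ k) =
          Polynomial.C (x * c) * Polynomial.X ^ (k + 1) := by
        rw [mul_assoc, ← mul_assoc Polynomial.X, Polynomial.X_mul_C, map_mul, mul_assoc, mul_assoc,
          pow_succ']
      have e2 : Polynomial.C c * Polynomial.X ^ k * (Polynomial.C x * Polynomial.X) =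
          Polynomial.C (c * x) * Polynomial.X ^ (k + 1) := by
        rw [mul_assoc, ← mul_assoc (Polynomial.X ^ k), Polynomial.X_pow_mul_C, map_mul, mul_assoc,
          mul_assoc, pow_succ]
      have e3 : Polynomial.C c * Polynomial.X ^ k * Polynomial.C y =
          Polynomial.C (c * y) * Polynomial.X ^ k := by
        rw [mul_assoc, Polynomial.X_pow_mul_C, map_mul, mul_assoc]
      have e4 : Polynomial.C y * (Polynomial.C c * Polynomial.X ^ k) =
          Polynomial.C (y * c) * Polynomial.X ^ k := by
        rw [map_mul, mul_assoc]
      rw [e1, e2, e3, e4]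
      simp only [map_mul]
      abel
    rw [Function.iterate_succ_apply', ih, Finset.mul_sum, Finset.sum_mul, ← Finset.sum_sub_distrib]
    simp only [hstep, Finset.sum_add_distrib]
    rw [Finset.sum_range_succ' _ (n + 1)]
    simp only [jacobsonCoeff, map_add, add_mul, Finset.sum_add_distrib]
    rw [add_assoc, Finset.sum_range_succ' (fun k => Polynomial.C ⁅y, jacobsonCoeff x y n k⁆ *
      Polynomial.X ^ k) n, Finset.sum_range_succ (fun k =>
      Polynomial.C ⁅y, jacobsonCoeff x y n (k + 1)⁆ * Polynomial.X ^ (k + 1)) n,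
      jacobsonCoeff_eq_zero x y n (n + 1) (by omega)]
    simp

theorem add_pow_char_eq_jacobson (F : Type*) (p : ℕ) [Field F] [hp : Fact p.Prime] [CharP F p]
    {A : Type*} [Ring A] [Algebra F A] (x y : A) :
    (x + y) ^ p = x ^ p + y ^ p + ∑ i ∈ Finset.Icc 1 (p - 1), jacobsonS F p i x y := by
  rcases subsingleton_or_nontrivial A with hA | hA
  · exact Subsingleton.elim _ _
  have : CharP A p := charP_of_injective_algebraMap (algebraMap F A).injective p
  have : CharP (Polynomial A) p := charP_of_injective_ringHom Polynomial.C_injective p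
  set g : Polynomial A := Polynomial.C x * Polynomial.X + Polynomial.C y with hg
  have hdg : Polynomial.derivative g = Polynomial.C x := by simp [hg]
  have hnat : g.natDegree ≤ 1 := Polynomial.natDegree_linear_le
  have hnat' : (g ^ p).natDegree < p + 1 := by
    have := Polynomial.natDegree_pow_le_of_le p hnat
    omega
  -- the coefficients of `(x X + y) ^ p` in degrees `1, …, p - 1` are read off its derivative
  have hcoeff : ∀ k, k < p → ((k + 1 : ℕ) : F) • (g ^ p).coeff (k + 1) =
      jacobsonCoeff x y (p - 1) k := by
    intro k hk
    have h1 := congrArg (fun q => Polynomial.coeff q k) (Polynomial.derivative_pow_noncomm g p)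
    simp only [hdg] at h1
    rw [sum_pow_mul_pow_eq_ad_pow, hg, iterate_commutator_eq_sum_jacobsonCoeff,
      Nat.sub_add_cancel hp.out.one_le, ← hg, Polynomial.coeff_derivative,
      Polynomial.finsetSum_coeff] at h1
    simp only [Polynomial.coeff_C_mul_X_pow] at h1
    rw [Finset.sum_ite_eq, if_pos (Finset.mem_range.2 hk)] at h1
    rw [← h1, Nat.cast_smul_eq_nsmul, nsmul_eq_mul, ← Nat.cast_succ]
    exact (Nat.cast_commute _ _).eq
  have heval : (x + y) ^ p = ∑ k ∈ Finset.range (p + 1), (g ^ p).coeff k := by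
    let φ := Polynomial.eval₂RingHom' (RingHom.id A) 1 (fun a => Commute.one_right _)
    have h1 : φ g = x + y := by simp [φ, hg, Polynomial.eval₂RingHom']
    have h2 : φ (g ^ p) = ∑ k ∈ Finset.range (p + 1), (g ^ p).coeff k := by
      change Polynomial.eval₂ (RingHom.id A) 1 (g ^ p) = _
      rw [Polynomial.eval₂_eq_sum_range' _ hnat']
      simp
    rw [← h1, ← map_pow, h2]
  have h0 : (g ^ p).coeff 0 = y ^ p := by
    change Polynomial.constantCoeff (g ^ p) = _
    rw [map_pow]
    simp [hg]
  have htop : (g ^ p).coeff p = x ^ p := by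
    have := Polynomial.coeff_pow_of_natDegree_le (m := p) hnat
    rw [mul_one] at this
    rw [this]
    simp [hg]
  rw [heval, Finset.sum_range_succ, htop]
  obtain ⟨q, hq⟩ : ∃ q, p = q + 1 := ⟨p - 1, by have := hp.out.pos; omega⟩
  have hsum : ∑ k ∈ Finset.range p, (g ^ p).coeff k =
      ∑ i ∈ Finset.Icc 1 (p - 1), jacobsonS F p i x y + y ^ p := by
    rw [← h0]
    conv_lhs => rw [hq]
    rw [Finset.sum_range_succ', ← hq]
    congr 1
    have : Finset.Icc 1 (p - 1) = Finset.Ico 1 (q + 1) := by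
      ext; simp; omega
    rw [this, Finset.sum_Ico_eq_sum_range]
    refine Finset.sum_congr (by simp) fun k hk => ?_
    have hk' := Finset.mem_range.1 hk
    have hne : ((k + 1 : ℕ) : F) ≠ 0 := fun h => by
      have := Nat.le_of_dvd (by omega) ((CharP.cast_eq_zero_iff F p _).1 h)
      omega
    rw [jacobsonS, add_comm 1 k, add_tsub_cancel_right, ← hcoeff k (by omega),
      smul_smul, inv_mul_cancel₀ hne, one_smul]
  rw [hsum]
  abel

/-! ### Restricted representations and the algebra `u(L)` -/

theorem map_jacobsonCoeff {F : Type*} [Field F] {L M : Type*} [LieRing L] [LieAlgebra F L]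
    [LieRing M] [LieAlgebra F M] (f : L →ₗ⁅F⁆ M) (x y : L) (n k : ℕ) :
    f (jacobsonCoeff x y n k) = jacobsonCoeff (f x) (f y) n k := by
  induction n generalizing k with
  | zero => cases k <;> simp [jacobsonCoeff]
  | succ n ih => cases k <;> simp [jacobsonCoeff, ih]

/-- By Jacobson's formula, compatibility of a Lie homomorphism into an associative algebra with
the `[p]`-map need only be checked on a spanning set. -/
theorem pow_eq_map_pMap_of_span {F : Type*} {p : ℕ} [Field F] [hp : Fact p.Prime] [CharP F p]
    {L : Type*} [LieRing L] [LieAlgebra F L] [RestrictedLieAlgebra F p L]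
    {A : Type*} [Ring A] [Algebra F A] (f : L →ₗ⁅F⁆ A) {s : Set L}
    (hs : Submodule.span F s = ⊤) (h : ∀ x ∈ s, f x ^ p = f (pMap F p x)) (x : L) :
    f x ^ p = f (pMap F p x) := by
  have hx : x ∈ Submodule.span F s := hs ▸ Submodule.mem_top
  induction hx using Submodule.span_induction with
  | mem x hx => exact h x hx
  | zero => rw [pMap_zero F p L, map_zero, zero_pow hp.out.ne_zero]
  | add x y _ _ hx hy =>
    rw [map_add, add_pow_char_eq_jacobson F p, pMap_add, hx, hy, map_add, map_add, map_sum]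
    simp [jacobsonS, map_jacobsonCoeff]
  | smul a x _ hx => rw [map_smul, smul_pow, hx, pMap_smul, map_smul]

namespace RestrictedEnvelopingAlgebra

section Basic

variable {F : Type u} {p : ℕ} {L : Type v} [Field F] [LieRing L] [LieAlgebra F L]
  [RestrictedLieAlgebra F p L]

theorem algHom_ext {A : Type*} [Ring A] [Algebra F A]
    {f g : RestrictedEnvelopingAlgebra F p L →ₐ[F] A} (h : ∀ x : L, f (ι F p L x) = g (ι F p L x)) :
    f = g := by
  apply RingQuot.ringQuot_ext'
  apply UniversalEnvelopingAlgebra.hom_ext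
  ext x
  exact h x

theorem adjoin_range_ι : Algebra.adjoin F (Set.range (ι F p L)) = ⊤ := by
  set S := Algebra.adjoin F (Set.range (ι F p L)) with hS
  let f : L →ₗ⁅F⁆ S :=
    { toFun := fun x => ⟨ι F p L x, Algebra.subset_adjoin ⟨x, rfl⟩⟩
      map_add' := fun x y => Subtype.ext (by simp)
      map_smul' := fun a x => Subtype.ext (by simp)
      map_lie' := fun {x y} => Subtype.ext (by simp [Ring.lie_def]) }
  let φ : RestrictedEnvelopingAlgebra F p L →ₐ[F] S :=
    lift f fun x => Subtype.ext (by simpa [f] using ι_pow F p L x)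
  have h : S.val.comp φ = AlgHom.id F _ := algHom_ext fun x => by
    simp only [AlgHom.comp_apply, φ, lift_ι]
    rfl
  rw [eq_top_iff]
  intro x _
  have := DFunLike.congr_fun h x
  simp only [AlgHom.comp_apply, AlgHom.id_apply] at this
  rw [← this]
  exact (φ x).2

@[elab_as_elim]
theorem induction_on {C : RestrictedEnvelopingAlgebra F p L → Prop}
    (a : RestrictedEnvelopingAlgebra F p L) (hι : ∀ x : L, C (ι F p L x))
    (hF : ∀ c : F, C (algebraMap F _ c)) (hadd : ∀ a b, C a → C b → C (a + b))
    (hmul : ∀ a b, C a → C b → C (a * b)) : C a := by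
  have ha : a ∈ Algebra.adjoin F (Set.range (ι F p L)) := by
    rw [adjoin_range_ι]
    exact Algebra.mem_top
  induction ha using Algebra.adjoin_induction with
  | mem x hx => obtain ⟨y, rfl⟩ := hx; exact hι y
  | algebraMap r => exact hF r
  | add x y _ _ hx hy => exact hadd _ _ hx hy
  | mul x y _ _ hx hy => exact hmul _ _ hx hy

theorem augmentation_ι [Fact p.Prime] (x : L) : augmentation F p L (ι F p L x) = 0 :=
  lift_ι _ _ x

theorem smul_mem_of_forall_ι_smul_mem {S : Type*} [AddCommGroup S] [Module F S]
    [Module (RestrictedEnvelopingAlgebra F p L) S]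
    [IsScalarTower F (RestrictedEnvelopingAlgebra F p L) S] (N : Submodule F S)
    (h : ∀ x, ∀ s ∈ N, ι F p L x • s ∈ N) (a : RestrictedEnvelopingAlgebra F p L) :
    ∀ s ∈ N, a • s ∈ N := by
  induction a using induction_on with
  | hι x => exact h x
  | hF c => intro s hs; rw [algebraMap_smul]; exact N.smul_mem c hs
  | hadd a b ha hb => intro s hs; rw [add_smul]; exact N.add_mem (ha s hs) (hb s hs)
  | hmul a b ha hb => intro s hs; rw [mul_smul]; exact ha _ (hb s hs)

theorem smul_eq_augmentation_smul [Fact p.Prime] {S : Type*} [AddCommGroup S] [Module F S]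
    [Module (RestrictedEnvelopingAlgebra F p L) S]
    [IsScalarTower F (RestrictedEnvelopingAlgebra F p L) S] (s : S)
    (h : ∀ x : L, ι F p L x • s = 0) (a : RestrictedEnvelopingAlgebra F p L) :
    a • s = augmentation F p L a • s := by
  induction a using induction_on with
  | hι x => rw [h, augmentation_ι, zero_smul]
  | hF c => rw [algebraMap_smul, AlgHom.commutes]; rfl
  | hadd a b ha hb => rw [add_smul, ha, hb, map_add, add_smul]
  | hmul a b ha hb =>
    rw [mul_smul, hb, map_mul, mul_comm, mul_smul, ← ha]
    exact (smul_comm (augmentation F p L b) a s).symm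

theorem inclusion_ι (I : PSubalgebra F p L) (x : I.toLieSubalgebra) :
    inclusion I (ι F p _ x) = ι F p L x := by
  exact lift_ι _ _ x

theorem augmentation_inclusion [Fact p.Prime] (I : PSubalgebra F p L)
    (a : RestrictedEnvelopingAlgebra F p I.toLieSubalgebra) :
    augmentation F p L (inclusion I a) = augmentation F p _ a := by
  have : (augmentation F p L).comp (inclusion I) = augmentation F p _ := algHom_ext fun x => by
    simp [inclusion_ι, augmentation_ι]
  exact DFunLike.congr_fun this a

end Basic

end RestrictedEnvelopingAlgebra

/-! ### Derivations -/

/-- A linear endomorphism of an associative, possibly noncommutative, algebra satisfying the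
Leibniz rule. -/
def IsLeibniz {F A : Type*} [Field F] [Ring A] [Algebra F A] (D : Module.End F A) : Prop :=
  ∀ a b, D (a * b) = D a * b + a * D b

namespace IsLeibniz

variable {F A : Type*} [Field F] [Ring A] [Algebra F A] {D D' : Module.End F A}

theorem map_one (h : IsLeibniz D) : D 1 = 0 := by
  have := h 1 1
  simpa using this

theorem map_algebraMap (h : IsLeibniz D) (c : F) : D (algebraMap F A c) = 0 := by
  rw [Algebra.algebraMap_eq_smul_one, map_smul, h.map_one, smul_zero]

theorem add (h : IsLeibniz D) (h' : IsLeibniz D') : IsLeibniz (D + D') := fun a b => by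
  simp only [LinearMap.add_apply, h a b, h' a b, add_mul, mul_add]
  abel

theorem smul (h : IsLeibniz D) (c : F) : IsLeibniz (c • D) := fun a b => by
  simp [h a b]

theorem commutator (h : IsLeibniz D) (h' : IsLeibniz D') : IsLeibniz (D * D' - D' * D) :=
  fun a b => by
  simp only [LinearMap.sub_apply, Module.End.mul_apply, h a b, h' a b, h _ _, h' _ _, map_add,
    sub_mul, mul_sub]
  abel

theorem inner (x : A) : IsLeibniz (LinearMap.mulLeft F x - LinearMap.mulRight F x) := fun a b => by
  simp [sub_mul, mul_sub, mul_assoc]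

theorem commutator_mulLeft (h : IsLeibniz D) (a : A) :
    D * LinearMap.mulLeft F a - LinearMap.mulLeft F a * D = LinearMap.mulLeft F (D a) := by
  ext b
  simp [h a b]

/-- In characteristic `p` the `p`-th power of a derivation is a derivation: on `A ⊗ A` the
operators `D ⊗ 1` and `1 ⊗ D` commute, so `(D ⊗ 1 + 1 ⊗ D) ^ p = D ^ p ⊗ 1 + 1 ⊗ D ^ p`. -/
theorem pow_char {p : ℕ} [hp : Fact p.Prime] [CharP F p] (h : IsLeibniz D) :
    IsLeibniz (D ^ p) := by
  set E : Module.End F (A ⊗[F] A) := LinearMap.rTensor A D + LinearMap.lTensor A D with hE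
  have h1 : ∀ (n : ℕ) (z : A ⊗[F] A),
      (D ^ n) (LinearMap.mul' F A z) = LinearMap.mul' F A ((E ^ n) z) := by
    intro n
    induction n with
    | zero => simp
    | succ n ih =>
      intro z
      rw [pow_succ, pow_succ, Module.End.mul_apply, Module.End.mul_apply, ← ih]
      congr 1
      induction z using TensorProduct.induction_on with
      | zero => simp
      | tmul a b => simp [hE, h a b]
      | add x y hx hy => rw [map_add, map_add, map_add, map_add, hx, hy]
  have h2 : E ^ p = LinearMap.rTensor A (D ^ p) + LinearMap.lTensor A (D ^ p) := by
    have hc : Commute (LinearMap.rTensor A D) (LinearMap.lTensor A D) := by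
      refine TensorProduct.ext' fun a b => ?_
      simp
    rcases subsingleton_or_nontrivial (Module.End F (A ⊗[F] A)) with hs | hn
    · exact Subsingleton.elim _ _
    · have : CharP (Module.End F (A ⊗[F] A)) p :=
        charP_of_injective_algebraMap (algebraMap F _).injective p
      rw [hE, add_pow_char_of_commute p hc, LinearMap.rTensor_pow, LinearMap.lTensor_pow]
  intro a b
  have := h1 p (a ⊗ₜ b)
  rw [h2] at this
  simpa using this

theorem ext_ι {p : ℕ} {L : Type*} [LieRing L] [LieAlgebra F L] [RestrictedLieAlgebra F p L]
    {D D' : Module.End F (RestrictedEnvelopingAlgebra F p L)} (h : IsLeibniz D)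
    (h' : IsLeibniz D') (hι : ∀ x, D (RestrictedEnvelopingAlgebra.ι F p L x) =
      D' (RestrictedEnvelopingAlgebra.ι F p L x)) : D = D' := by
  ext a
  induction a using RestrictedEnvelopingAlgebra.induction_on with
  | hι x => exact hι x
  | hF c => rw [h.map_algebraMap, h'.map_algebraMap]
  | hadd a b ha hb => rw [map_add, map_add, ha, hb]
  | hmul a b ha hb => rw [h a b, h' a b, ha, hb]

end IsLeibniz

namespace RestrictedEnvelopingAlgebra

section AdjointDerivation

variable {F : Type u} {p : ℕ} {L : Type v} [Field F] [hp : Fact p.Prime] [CharP F p] [LieRing L]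
  [LieAlgebra F L] [RestrictedLieAlgebra F p L]

/-- For `y` normalising the `p`-subalgebra `I`, the map `ad y` of `I` extends to a derivation of
`u(I)`. It is obtained as the second component of a homomorphism from `u(I)` to the dual numbers
over `u(I)`. -/
theorem exists_isLeibniz_ι (I : PSubalgebra F p L) (y : L)
    (hy : ∀ a ∈ I.toLieSubalgebra, ⁅y, a⁆ ∈ I.toLieSubalgebra) :
    ∃ D : Module.End F (RestrictedEnvelopingAlgebra F p I.toLieSubalgebra), IsLeibniz D ∧
      ∀ a : I.toLieSubalgebra, D (ι F p _ a) = ι F p _ ⟨⁅y, (a : L)⁆, hy a a.2⟩ := by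
  set A := RestrictedEnvelopingAlgebra F p I.toLieSubalgebra
  let δ : I.toLieSubalgebra →ₗ[F] I.toLieSubalgebra :=
    { toFun := fun a => ⟨⁅y, (a : L)⁆, hy a a.2⟩
      map_add' := fun a b => Subtype.ext (by simp)
      map_smul' := fun c a => Subtype.ext (by simp) }
  have hδ : ∀ a b, δ ⁅a, b⁆ = ⁅δ a, b⁆ + ⁅a, δ b⁆ := fun a b => Subtype.ext (by simp [δ])
  let f : I.toLieSubalgebra →ₗ⁅F⁆ TrivSqZeroExt A A :=
    { toFun := fun a => TrivSqZeroExt.inl (ι F p _ a) + TrivSqZeroExt.inr (ι F p _ (δ a))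
      map_add' := fun a b => by ext <;> simp
      map_smul' := fun c a => by ext <;> simp
      map_lie' := fun {a b} => by
        ext
        · simp [Ring.lie_def]
        · simp [hδ, Ring.lie_def]
          abel }
  have hf : ∀ a, f a ^ p = f (pMap F p a) := by
    intro a
    ext
    · simpa [f] using ι_pow F p _ a
    · have h1 : (f a ^ p).snd = ∑ i ∈ Finset.range p,
          ι F p _ a ^ i * ι F p _ (δ a) * ι F p _ a ^ (p - 1 - i) := by
        rw [TrivSqZeroExt.snd_pow_eq_sum, ← Finset.sum_range_reflect]
        have e (g : ℕ → A) : ((List.range p).map g).sum = ∑ i ∈ Finset.range p, g i := rfl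
        rw [e]
        refine Finset.sum_congr rfl fun i hi => ?_
        have hi' := Finset.mem_range.1 hi
        have e3 : p - 1 - (p - 1 - i) = i := by omega
        rw [e3]
        simp [f, mul_assoc]
      have h2 : ∀ n : ℕ, (fun z => ι F p _ a * z - z * ι F p _ a)^[n] (ι F p _ (δ a)) =
          ι F p _ ((LieAlgebra.ad F _ a ^ n) (δ a)) := by
        intro n
        induction n with
        | zero => simp
        | succ n ih =>
          rw [Function.iterate_succ_apply', ih, pow_succ', Module.End.mul_apply,
            LieAlgebra.ad_apply, LieHom.map_lie, Ring.lie_def]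
      have h3 : (LieAlgebra.ad F _ a ^ (p - 1)) (δ a) = δ (pMap F p a) := by
        apply Subtype.ext
        have e1 : ((δ (pMap F p a) : I.toLieSubalgebra) : L) = ⁅y, pMap F p (a : L)⁆ := rfl
        rw [LieSubalgebra.coe_ad_pow, e1, ← lie_skew, ← LieAlgebra.ad_apply F, ad_pMap]
        have e2 : LieAlgebra.ad F L (a : L) ^ p =
            LieAlgebra.ad F L (a : L) ^ (p - 1) * LieAlgebra.ad F L (a : L) :=
          (pow_sub_one_mul hp.out.ne_zero _).symm
        rw [e2, Module.End.mul_apply, LieAlgebra.ad_apply, ← map_neg, lie_skew]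
        rfl
      rw [h1]
      rcases subsingleton_or_nontrivial A with hA | hA
      · exact Subsingleton.elim _ _
      have : CharP A p := charP_of_injective_algebraMap (algebraMap F A).injective p
      rw [sum_pow_mul_pow_eq_ad_pow, h2, h3]
      simp [f]
  refine ⟨(TrivSqZeroExt.sndHom A A).restrictScalars F ∘ₗ (lift f hf).toLinearMap, ?_, ?_⟩
  · have hfst : ∀ a, (lift f hf a).fst = a := fun a => by
      have : (TrivSqZeroExt.fstHom F A A).comp (lift f hf) = AlgHom.id F A :=
        algHom_ext fun x => by
          simp [lift_ι, f]
          rfl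
      exact DFunLike.congr_fun this a
    intro a b
    simp [hfst]
    abel
  · intro a
    simp [lift_ι, f, δ]

end AdjointDerivation

end RestrictedEnvelopingAlgebra

namespace RestrictedEnvelopingAlgebra

section AdDer

variable {F : Type u} {p : ℕ} {L : Type v} [Field F] [hp : Fact p.Prime] [CharP F p] [LieRing L]
  [LieAlgebra F L] [RestrictedLieAlgebra F p L] (I : PSubalgebra F p L)
  (hI : ∀ x y : L, ⁅x, y⁆ ∈ I.toLieSubalgebra)

/-- The derivation of `u(I)` extending `ad y`, for `y ∈ L` and a `p`-subalgebra `I` that contains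
the derived algebra of `L`. -/
noncomputable def adDer :
    L →ₗ[F] Module.End F (RestrictedEnvelopingAlgebra F p I.toLieSubalgebra) :=
  have h := fun y => (exists_isLeibniz_ι I y fun a _ => hI y a).choose_spec
  { toFun := fun y => (exists_isLeibniz_ι I y fun a _ => hI y a).choose
    map_add' := fun y z => (h _).1.ext_ι ((h y).1.add (h z).1) fun a => by
      rw [(h _).2, LinearMap.add_apply, (h _).2, (h _).2, ← map_add]
      exact congrArg _ (Subtype.ext (add_lie y z (a : L)))
    map_smul' := fun c y => (h _).1.ext_ι ((h y).1.smul c) fun a => by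
      rw [(h _).2, RingHom.id_apply, LinearMap.smul_apply, (h _).2, ← map_smul]
      exact congrArg _ (Subtype.ext (smul_lie c y (a : L))) }

theorem isLeibniz_adDer (y : L) : IsLeibniz (adDer I hI y) :=
  (exists_isLeibniz_ι I y fun a _ => hI y a).choose_spec.1

theorem adDer_ι (y : L) (a : I.toLieSubalgebra) :
    adDer I hI y (ι F p _ a) = ι F p _ ⟨⁅y, (a : L)⁆, hI y a⟩ :=
  (exists_isLeibniz_ι I y fun a _ => hI y a).choose_spec.2 a

theorem adDer_coe (a : I.toLieSubalgebra) : adDer I hI (a : L) =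
    LinearMap.mulLeft F (ι F p _ a) - LinearMap.mulRight F (ι F p _ a) :=
  (isLeibniz_adDer I hI _).ext_ι (IsLeibniz.inner _) fun b => by
    rw [adDer_ι, LinearMap.sub_apply, LinearMap.mulLeft_apply, LinearMap.mulRight_apply,
      ← Ring.lie_def, ← LieHom.map_lie]
    rfl

theorem adDer_lie (y z : L) :
    adDer I hI ⁅y, z⁆ = adDer I hI y * adDer I hI z - adDer I hI z * adDer I hI y :=
  (isLeibniz_adDer I hI _).ext_ι
    ((isLeibniz_adDer I hI _).commutator (isLeibniz_adDer I hI _)) fun b => by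
    rw [LinearMap.sub_apply, Module.End.mul_apply, Module.End.mul_apply]
    simp only [adDer_ι]
    rw [← map_sub]
    exact congrArg _ (Subtype.ext (lie_lie y z (b : L)))

theorem adDer_pow (y : L) : adDer I hI y ^ p = adDer I hI (pMap F p y) := by
  refine (isLeibniz_adDer I hI _).pow_char.ext_ι (isLeibniz_adDer I hI _) fun b => ?_
  have h : ∀ n : ℕ, ∃ h : (LieAlgebra.ad F L y ^ n) (b : L) ∈ I.toLieSubalgebra,
      (adDer I hI y ^ n) (ι F p _ b) = ι F p _ ⟨_, h⟩ := by
    intro n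
    induction n with
    | zero => exact ⟨b.2, rfl⟩
    | succ n ih =>
      obtain ⟨h, ih⟩ := ih
      refine ⟨?_, ?_⟩
      · rw [pow_succ', Module.End.mul_apply]
        exact hI _ _
      · rw [pow_succ', Module.End.mul_apply, ih, adDer_ι]
        refine congrArg _ (Subtype.ext ?_)
        change _ = (LieAlgebra.ad F L y ^ (n + 1)) (b : L)
        rw [pow_succ', Module.End.mul_apply]
        rfl
  obtain ⟨h1, h2⟩ := h p
  rw [h2, adDer_ι]
  refine congrArg _ (Subtype.ext ?_)
  change (LieAlgebra.ad F L y ^ p) (b : L) = LieAlgebra.ad F L (pMap F p y) (b : L)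
  rw [ad_pMap]

theorem ι_mul_inclusion (y : L) (a : RestrictedEnvelopingAlgebra F p I.toLieSubalgebra) :
    ι F p L y * inclusion I a = inclusion I a * ι F p L y + inclusion I (adDer I hI y a) := by
  induction a using induction_on with
  | hι x =>
    rw [adDer_ι, inclusion_ι, inclusion_ι, LieHom.map_lie, Ring.lie_def]
    abel
  | hF c =>
    rw [(isLeibniz_adDer I hI y).map_algebraMap, AlgHom.commutes, map_zero, add_zero,
      Algebra.commutes]
  | hadd a b ha hb =>
    simp only [map_add, mul_add, add_mul, ha, hb]
    abel
  | hmul a b ha hb =>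
    rw [isLeibniz_adDer I hI y a b, map_add, map_mul, map_mul, map_mul, ← mul_assoc, ha, add_mul,
      mul_assoc, hb, mul_add, mul_assoc]
    abel

end AdDer

/-! ### Ordered monomials span `u(L)` -/

section Spanning

variable {F : Type u} {p : ℕ} {L : Type v} [Field F] [LieRing L] [LieAlgebra F L]
  [RestrictedLieAlgebra F p L] {κ : Type*}

/-- The span of the products of at most `d` members of the family `X` in `u(L)`. -/
def monomialFiltration (F : Type u) (p : ℕ) {L : Type v} [Field F] [LieRing L] [LieAlgebra F L]
    [RestrictedLieAlgebra F p L] {κ : Type*} (X : κ → L) (d : ℕ) :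
    Submodule F (RestrictedEnvelopingAlgebra F p L) :=
  Submodule.span F {a | ∃ l : List κ, l.length ≤ d ∧ a = (l.map fun k => ι F p L (X k)).prod}

variable {X : κ → L}

theorem prod_mem_monomialFiltration {l : List κ} {d : ℕ} (h : l.length ≤ d) :
    (l.map fun k => ι F p L (X k)).prod ∈ monomialFiltration F p X d :=
  Submodule.subset_span ⟨l, h, rfl⟩

theorem monomialFiltration_mono {d d' : ℕ} (h : d ≤ d') :
    monomialFiltration F p X d ≤ monomialFiltration F p X d' :=
  Submodule.span_mono fun _ ⟨l, hl, ha⟩ => ⟨l, hl.trans h, ha⟩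

theorem ι_mul_mem_monomialFiltration (hX : Submodule.span F (Set.range X) = ⊤) (y : L) {d : ℕ}
    {a : RestrictedEnvelopingAlgebra F p L} (ha : a ∈ monomialFiltration F p X d) :
    ι F p L y * a ∈ monomialFiltration F p X (d + 1) := by
  have hy : y ∈ Submodule.span F (Set.range X) := hX ▸ Submodule.mem_top
  induction hy using Submodule.span_induction with
  | mem y hy =>
    obtain ⟨k, rfl⟩ := hy
    induction ha using Submodule.span_induction with
    | mem a ha =>
      obtain ⟨l, hl, rfl⟩ := ha
      exact Submodule.subset_span ⟨k :: l, by simpa using hl, by simp⟩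
    | zero => simp
    | add a b _ _ ha hb => rw [mul_add]; exact add_mem ha hb
    | smul c a _ ha => rw [mul_smul_comm]; exact Submodule.smul_mem _ _ ha
  | zero => simp
  | add y z _ _ hy hz => rw [map_add, add_mul]; exact add_mem hy hz
  | smul c y _ hy => rw [map_smul, smul_mul_assoc]; exact Submodule.smul_mem _ _ hy

/-- Permuting the factors of a product changes it by terms of lower degree. -/
theorem prod_sub_prod_mem_of_perm (hX : Submodule.span F (Set.range X) = ⊤) {l l' : List κ}
    (h : l.Perm l') {d : ℕ} (hl : l.length ≤ d + 1) :
    (l.map fun k => ι F p L (X k)).prod - (l'.map fun k => ι F p L (X k)).prod ∈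
      monomialFiltration F p X d := by
  induction h generalizing d with
  | nil => simp
  | cons k h ih =>
    rw [List.map_cons, List.map_cons, List.prod_cons, List.prod_cons, ← mul_sub]
    rcases d with _ | d
    · have h1 : _ = [] := List.length_eq_zero_iff.1 (by simpa using hl)
      subst h1
      rw [← h.nil_eq]
      simp
    · exact ι_mul_mem_monomialFiltration hX _ (ih (by simpa using hl))
  | swap k k' l =>
    simp only [List.map_cons, List.prod_cons, ← mul_assoc, ← sub_mul]
    rw [← Ring.lie_def, ← LieHom.map_lie]
    have hd : l.length + 1 ≤ d := by simpa using hl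
    exact monomialFiltration_mono hd
      (ι_mul_mem_monomialFiltration hX _ (prod_mem_monomialFiltration le_rfl))
  | trans h1 h2 ih1 ih2 =>
    rw [← sub_add_sub_cancel]
    exact add_mem (ih1 hl) (ih2 (by rwa [← h1.length_eq]))

theorem exists_mem_monomialFiltration (hX : Submodule.span F (Set.range X) = ⊤)
    (a : RestrictedEnvelopingAlgebra F p L) : ∃ d, a ∈ monomialFiltration F p X d := by
  let N : Submodule F (RestrictedEnvelopingAlgebra F p L) :=
    { carrier := {a | ∃ d, a ∈ monomialFiltration F p X d}
      add_mem' := fun ⟨d, hd⟩ ⟨d', hd'⟩ => ⟨max d d', add_mem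
        (monomialFiltration_mono (le_max_left _ _) hd)
        (monomialFiltration_mono (le_max_right _ _) hd')⟩
      zero_mem' := ⟨0, zero_mem _⟩
      smul_mem' := fun c _ ⟨d, hd⟩ => ⟨d, Submodule.smul_mem _ c hd⟩ }
  have h1 : (1 : RestrictedEnvelopingAlgebra F p L) ∈ N :=
    ⟨0, Submodule.subset_span ⟨[], by simp⟩⟩
  have := smul_mem_of_forall_ι_smul_mem N
    (fun x s ⟨d, hd⟩ => ⟨d + 1, ι_mul_mem_monomialFiltration hX x hd⟩) a 1 h1
  rwa [smul_eq_mul, mul_one] at this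

/-- If `T` is annihilated by right multiplication by `e`, then `u(L) e` is spanned by the elements
`m e`, where `m` runs over the monomials with exponents less than `p` in a basis of a complement
of `T`. -/
theorem range_mulRight_le_span [hp : Fact p.Prime] {κ₁ κ₂ : Type*} [Fintype κ₁] {X : κ₁ ⊕ κ₂ → L}
    (hX : Submodule.span F (Set.range X) = ⊤) (e : RestrictedEnvelopingAlgebra F p L)
    (he : ∀ j, ι F p L (X (Sum.inr j)) * e = 0) :
    LinearMap.range (LinearMap.mulRight F e) ≤ Submodule.span F (Set.range fun α : κ₁ → Fin p =>
      (((∑ i, (α i : ℕ) • ({Sum.inl i} : Multiset (κ₁ ⊕ κ₂))).toList).map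
        fun k => ι F p L (X k)).prod * e) := by
  classical
  set S := Submodule.span F (Set.range fun α : κ₁ → Fin p =>
      (((∑ i, (α i : ℕ) • ({Sum.inl i} : Multiset (κ₁ ⊕ κ₂))).toList).map
        fun k => ι F p L (X k)).prod * e) with hS
  have hcanon : ∀ l : List (κ₁ ⊕ κ₂), (∀ j, Sum.inr j ∉ l) →
      ∀ h : (∀ i, (l : Multiset (κ₁ ⊕ κ₂)).count (Sum.inl i) < p),
      l.Perm (∑ i, (((⟨_, h i⟩ : Fin p) : ℕ)) • ({Sum.inl i} : Multiset (κ₁ ⊕ κ₂))).toList := by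
    intro l hl h
    rw [← Multiset.coe_eq_coe, Multiset.coe_toList]
    ext k
    rw [Multiset.count_sum']
    simp only [Multiset.count_nsmul, Multiset.count_singleton]
    rcases k with i | j
    · simp
    · rw [Multiset.count_eq_zero_of_notMem (by simpa using hl j)]
      simp
  have key : ∀ d, (∀ a ∈ monomialFiltration F p X d, a * e ∈ S) := by
    intro d
    induction d with
    | zero =>
      intro a ha
      induction ha using Submodule.span_induction with
      | mem a ha =>
        obtain ⟨l, hl, rfl⟩ := ha
        have hl : l = [] := List.length_eq_zero_iff.1 (by omega)
        subst hl
        refine Submodule.subset_span ⟨fun _ => ⟨0, hp.out.pos⟩, ?_⟩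
        simp
      | zero => simp
      | add a b _ _ ha hb => rw [add_mul]; exact add_mem ha hb
      | smul c a _ ha => rw [smul_mul_assoc]; exact Submodule.smul_mem _ _ ha
    | succ d ih =>
      intro a ha
      induction ha using Submodule.span_induction with
      | mem a ha =>
        obtain ⟨l, hl, rfl⟩ := ha
        -- it suffices to treat some rearrangement of the factors
        have hperm : ∀ l', l.Perm l' → (l'.map fun k => ι F p L (X k)).prod * e ∈ S →
            (l.map fun k => ι F p L (X k)).prod * e ∈ S := by
          intro l' hll hl'
          have := ih _ (prod_sub_prod_mem_of_perm hX hll hl)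
          rw [sub_mul] at this
          simpa using add_mem this hl'
        by_cases h1 : ∃ j, Sum.inr j ∈ l
        · obtain ⟨j, hj⟩ := h1
          obtain ⟨s, t, rfl⟩ := List.append_of_mem hj
          refine hperm ((s ++ t) ++ [Sum.inr j]) ?_ ?_
          · exact List.perm_middle.trans (List.perm_append_singleton _ _).symm
          · simp [mul_assoc, he]
        by_cases h2 : ∃ i, p ≤ (l : Multiset (κ₁ ⊕ κ₂)).count (Sum.inl i)
        · obtain ⟨i, hi⟩ := h2
          obtain ⟨l', hl'⟩ : ∃ l', l.Perm (List.replicate p (Sum.inl i) ++ l') := by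
            obtain ⟨m, hm⟩ := Multiset.le_iff_exists_add.1 (Multiset.le_count_iff_replicate_le.1 hi)
            refine ⟨m.toList, ?_⟩
            rw [← Multiset.coe_eq_coe, hm, ← Multiset.coe_add, Multiset.coe_toList,
              Multiset.coe_replicate]
          refine hperm _ hl' (ih _ ?_)
          have hlen := hl'.length_eq
          rw [List.length_append, List.length_replicate] at hlen
          have := hp.out.two_le
          rw [List.map_append, List.prod_append, List.map_replicate, List.prod_replicate, ι_pow]
          exact monomialFiltration_mono (d := l'.length + 1) (by omega)
            (ι_mul_mem_monomialFiltration hX _ (prod_mem_monomialFiltration le_rfl))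
        · push Not at h1 h2
          exact hperm _ (hcanon l h1 h2) (Submodule.subset_span ⟨_, rfl⟩)
      | zero => simp
      | add a b _ _ ha hb => rw [add_mul]; exact add_mem ha hb
      | smul c a _ ha => rw [smul_mul_assoc]; exact Submodule.smul_mem _ _ ha
  rintro _ ⟨a, rfl⟩
  obtain ⟨d, hd⟩ := exists_mem_monomialFiltration hX a
  exact key d a hd

theorem finite_and_finrank_range_mulRight_le [hp : Fact p.Prime] [FiniteDimensional F L]
    (T : Submodule F L) (e : RestrictedEnvelopingAlgebra F p L)
    (he : ∀ t ∈ T, ι F p L t * e = 0) :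
    Module.Finite F (LinearMap.range (LinearMap.mulRight F e)) ∧
    Module.finrank F (LinearMap.range (LinearMap.mulRight F e)) ≤
      p ^ (Module.finrank F L - Module.finrank F T) := by
  obtain ⟨C, hC⟩ := T.exists_isCompl
  let b := Module.finBasis F C
  let t := Module.finBasis F T
  have hX : Submodule.span F
      (Set.range (Sum.elim (fun i => (b i : L)) fun j => (t j : L))) = ⊤ := by
    rw [Set.Sum.elim_range, Submodule.span_union]
    have h1 : ∀ (W : Submodule F L) {n : ℕ} (c : Module.Basis (Fin n) F W),
        Submodule.span F (Set.range fun i => (c i : L)) = W := by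
      intro W n c
      have := congrArg (Submodule.map W.subtype) c.span_eq
      rw [Submodule.map_span, ← Set.range_comp, Submodule.map_top, Submodule.range_subtype] at this
      exact this
    rw [h1, h1, sup_comm]
    exact hC.sup_eq_top
  have hle := range_mulRight_le_span hX e fun j => he _ (t j).2
  have hfin : Module.Finite F (Submodule.span F (Set.range fun α : Fin _ → Fin p =>
      (((∑ i, (α i : ℕ) • ({Sum.inl i} : Multiset (Fin _ ⊕ Fin _))).toList).map
        fun k => ι F p L (Sum.elim (fun i => (b i : L)) (fun j => (t j : L)) k)).prod * e)) :=
    FiniteDimensional.span_of_finite F (Set.finite_range _)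
  refine ⟨Submodule.finiteDimensional_of_le hle, (Submodule.finrank_mono hle).trans ?_⟩
  refine (finrank_range_le_card _).trans ?_
  have h2 := Submodule.finrank_add_eq_of_isCompl hC
  simp only [Fintype.card_pi, Fintype.card_fin, Finset.prod_const, Finset.card_univ]
  rw [← h2, add_tsub_cancel_left]

instance [hp : Fact p.Prime] [FiniteDimensional F L] :
    Module.Finite F (RestrictedEnvelopingAlgebra F p L) := by
  have h := (finite_and_finrank_range_mulRight_le (F := F) (p := p) (L := L) ⊥ 1 fun t ht => by
    rw [(Submodule.mem_bot F).1 ht, map_zero, zero_mul]).1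
  have h2 : LinearMap.range (LinearMap.mulRight F (1 : RestrictedEnvelopingAlgebra F p L)) = ⊤ := by
    rw [LinearMap.mulRight_one, LinearMap.range_id]
  rw [h2] at h
  exact Module.Finite.equiv Submodule.topEquiv

end Spanning

end RestrictedEnvelopingAlgebra

/-! ### The `[p]`-map and tori -/

section PMap

variable {F : Type u} {p : ℕ} {L : Type v} [Field F] [hp : Fact p.Prime] [LieRing L]
  [LieAlgebra F L] [RestrictedLieAlgebra F p L]

theorem jacobsonCoeff_mem {N : Submodule F L} {x y : L} (hx : x ∈ N)
    (h : ∀ z ∈ N, ⁅x, z⁆ ∈ N ∧ ⁅y, z⁆ ∈ N) (n k : ℕ) : jacobsonCoeff x y n k ∈ N := by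
  induction n generalizing k with
  | zero => cases k with
    | zero => exact hx
    | succ k => exact zero_mem _
  | succ n ih => cases k with
    | zero => exact (h _ (ih 0)).2
    | succ k => exact add_mem (h _ (ih k)).1 (h _ (ih (k + 1))).2

/-- The `[p]`-map is `p`-semilinear modulo brackets, so that `x^[p] ∈ N` need only be checked on a
spanning set if `N` contains the brackets. -/
theorem pMap_mem_of_mem_span {s : Set L} {N : Submodule F L}
    (hbr : ∀ x ∈ Submodule.span F s, ∀ y ∈ Submodule.span F s, ⁅x, y⁆ ∈ N ⊓ Submodule.span F s)
    (hs : ∀ x ∈ s, pMap F p x ∈ N) {x : L} (hx : x ∈ Submodule.span F s) : pMap F p x ∈ N := by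
  induction hx using Submodule.span_induction with
  | mem x hx => exact hs x hx
  | zero => rw [pMap_zero]; exact zero_mem _
  | smul c x _ hx => rw [pMap_smul]; exact N.smul_mem _ hx
  | add x y hx' hy' hx hy =>
    rw [pMap_add]
    refine add_mem (add_mem hx hy) (sum_mem fun i _ => N.smul_mem _ ?_)
    obtain ⟨n, hn⟩ : ∃ n, p - 1 = n + 1 := ⟨p - 2, by have := hp.out.two_le; omega⟩
    have hc : ∀ k, jacobsonCoeff x y n k ∈ Submodule.span F s :=
      jacobsonCoeff_mem hx' (fun z hz => ⟨(hbr x hx' z hz).2, (hbr y hy' z hz).2⟩) n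
    rw [hn]
    cases i - 1 with
    | zero => exact (hbr y hy' _ (hc 0)).1
    | succ k => exact add_mem (hbr x hx' _ (hc k)).1 (hbr y hy' _ (hc (k + 1))).1

theorem lie_pMap_iterate_eq_zero {w y : L} (h : ⁅w, y⁆ = 0) (n : ℕ) :
    ⁅(pMap F p)^[n] w, y⁆ = 0 := by
  induction n with
  | zero => exact h
  | succ n ih =>
    rw [Function.iterate_succ_apply', ← LieAlgebra.ad_apply F, ad_pMap,
      ← pow_sub_one_mul hp.out.ne_zero, Module.End.mul_apply, LieAlgebra.ad_apply, ih, map_zero]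

omit hp in
/-- Some iterate of the `[p]`-map takes every element to a semisimple one. -/
theorem exists_isPSemisimple_iterate [FiniteDimensional F L] (x : L) :
    ∃ n, IsPSemisimple F p ((pMap F p)^[n] x) := by
  let V : ℕ → Submodule F L := fun n =>
    Submodule.span F {y | ∃ m, n ≤ m ∧ y = (pMap F p)^[m] x}
  obtain ⟨n, hn⟩ := IsArtinian.monotone_stabilizes (R := F) (M := L)
    ⟨fun n => OrderDual.toDual (V n), fun n m hnm =>
      Submodule.span_mono fun y ⟨k, hk, hy⟩ => ⟨k, hnm.trans hk, hy⟩⟩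
  refine ⟨n, ?_⟩
  have h1 : (pMap F p)^[n] x ∈ V n := Submodule.subset_span ⟨n, le_rfl, rfl⟩
  have h2 : V n = V (n + 1) := hn (n + 1) (Nat.le_succ n)
  rw [h2] at h1
  refine Submodule.span_mono ?_ h1
  rintro y ⟨m, hm, rfl⟩
  refine ⟨m - n, by omega, ?_⟩
  rw [← Function.iterate_add_apply, Nat.sub_add_cancel (by omega)]

/-- If `I` contains the derived algebra and `y ∈ I + span {y^[p]^n | n ≥ 1}` for all `y`, then
the latter span may be restricted to `n ≥ k`. -/
theorem mem_sup_span_iterate {I : Submodule F L} (hbr : ∀ x y : L, ⁅x, y⁆ ∈ I)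
    (hI : ∀ x ∈ I, pMap F p x ∈ I) {y : L}
    (hy : y ∈ I ⊔ Submodule.span F {z | ∃ n : ℕ, 1 ≤ n ∧ z = (pMap F p)^[n] y}) (k : ℕ) :
    y ∈ I ⊔ Submodule.span F {z | ∃ n : ℕ, k ≤ n ∧ z = (pMap F p)^[n] y} := by
  set V : ℕ → Submodule F L := fun k =>
    I ⊔ Submodule.span F {z | ∃ n : ℕ, k ≤ n ∧ z = (pMap F p)^[n] y} with hV
  have hVs : ∀ k, V k =
      Submodule.span F ((I : Set L) ∪ {z | ∃ n : ℕ, k ≤ n ∧ z = (pMap F p)^[n] y}) := fun k => by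
    rw [Submodule.span_union, Submodule.span_eq]
  have hmono : ∀ k, V (k + 1) ≤ V k := by
    intro k
    refine sup_le_sup_left (Submodule.span_mono ?_) _
    rintro z ⟨n, hn, hz⟩
    exact ⟨n, by omega, hz⟩
  have hstep : ∀ k x, x ∈ V k → pMap F p x ∈ V (k + 1) := by
    intro k x hx
    rw [hVs k] at hx
    refine pMap_mem_of_mem_span (fun a _ b _ => ⟨Submodule.mem_sup_left (hbr a b), ?_⟩) ?_ hx
    · rw [← hVs]; exact Submodule.mem_sup_left (hbr a b)
    · rintro x (hx | ⟨n, hn, rfl⟩)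
      · exact Submodule.mem_sup_left (hI x hx)
      · refine Submodule.mem_sup_right (Submodule.subset_span ⟨n + 1, by omega, ?_⟩)
        rw [Function.iterate_succ_apply']
  have hit : ∀ n, (pMap F p)^[n] y ∈ V (n + 1) := by
    intro n
    induction n with
    | zero => exact hy
    | succ n ih => rw [Function.iterate_succ_apply']; exact hstep _ _ ih
  have hle : ∀ k, V k ≤ V (k + 1) := by
    intro k
    refine sup_le le_sup_left (Submodule.span_le.2 ?_)
    rintro _ ⟨n, hn, rfl⟩
    rcases hn.eq_or_lt with rfl | hn
    · exact hit _
    · exact Submodule.mem_sup_right (Submodule.subset_span ⟨n, hn, rfl⟩)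
  have hall : ∀ k, V 1 ≤ V (k + 1) := by
    intro k
    induction k with
    | zero => exact le_rfl
    | succ k ih => exact ih.trans (hle _)
  exact hmono k (hall k hy)

theorem finrank_span_pMap_image_le [FiniteDimensional F L] (V : Submodule F L)
    (hV : ∀ x ∈ V, ∀ y ∈ V, ⁅x, y⁆ = 0) :
    Module.finrank F (Submodule.span F (pMap F p '' (V : Set L))) ≤ Module.finrank F V := by
  let b := Module.finBasis F V
  have hb : Submodule.span F (Set.range fun i => (b i : L)) = V := by
    have := congrArg (Submodule.map V.subtype) b.span_eq
    rw [Submodule.map_span, ← Set.range_comp, Submodule.map_top, Submodule.range_subtype] at this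
    exact this
  have hle : Submodule.span F (pMap F p '' (V : Set L)) ≤
      Submodule.span F (Set.range fun i => pMap F p (b i : L)) := by
    rw [Submodule.span_le]
    rintro _ ⟨x, hx, rfl⟩
    have hx' : x ∈ Submodule.span F (Set.range fun i => (b i : L)) := hb.symm ▸ hx
    refine pMap_mem_of_mem_span (fun y hy z hz => ?_) ?_ hx'
    · rw [hb] at hy hz
      rw [hV y hy z hz]
      exact zero_mem _
    · rintro _ ⟨i, rfl⟩
      exact Submodule.subset_span ⟨i, rfl⟩
  refine (Submodule.finrank_mono hle).trans ((finrank_range_le_card _).trans ?_)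
  simp

/-- An abelian `p`-subalgebra that is spanned by its `p`-th powers consists of semisimple
elements: the `[p]`-map then preserves the dimension of spans, so that `x` lies in the span of the
higher `p`-th powers of `x` for reasons of dimension. -/
theorem isPSemisimple_of_le_span_pMap_image [FiniteDimensional F L] {H : Submodule F L}
    (hab : ∀ x ∈ H, ∀ y ∈ H, ⁅x, y⁆ = 0) (hH : ∀ x ∈ H, pMap F p x ∈ H)
    (hspan : H ≤ Submodule.span F (pMap F p '' (H : Set L))) {x : L} (hx : x ∈ H) :
    IsPSemisimple F p x := by
  set V := Submodule.span F {y | ∃ n : ℕ, y = (pMap F p)^[n] x} with hV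
  set V' := Submodule.span F {y | ∃ n : ℕ, 1 ≤ n ∧ y = (pMap F p)^[n] x} with hV'
  have hVH : V ≤ H := by
    rw [hV, Submodule.span_le]
    rintro _ ⟨n, rfl⟩
    induction n with
    | zero => exact hx
    | succ n ih => rw [Function.iterate_succ_apply']; exact hH _ ih
  have hV'V : V' ≤ V := Submodule.span_mono fun y ⟨n, _, hy⟩ => ⟨n, hy⟩
  have hpV : Submodule.span F (pMap F p '' (V : Set L)) ≤ V' := by
    rw [Submodule.span_le]
    rintro _ ⟨y, hy, rfl⟩
    refine pMap_mem_of_mem_span (fun a ha b hb => ?_) ?_ hy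
    · rw [hab a (hVH ha) b (hVH hb)]; exact zero_mem _
    · rintro _ ⟨n, rfl⟩
      exact Submodule.subset_span ⟨n + 1, by omega, (Function.iterate_succ_apply' _ _ _).symm⟩
  obtain ⟨C, hC⟩ := V.exists_isCompl
  set W := C ⊓ H with hW
  have hVW : V ⊔ W = H := by
    rw [hW, ← sup_inf_assoc_of_le C hVH, hC.sup_eq_top, top_inf_eq]
  have hdis : V ⊓ W = ⊥ := by
    rw [hW, ← inf_assoc, hC.inf_eq_bot, bot_inf_eq]
  have hdim := Submodule.finrank_sup_add_finrank_inf_eq V W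
  rw [hVW, hdis, finrank_bot, add_zero] at hdim
  have hle : H ≤ Submodule.span F (pMap F p '' (V : Set L)) ⊔
      Submodule.span F (pMap F p '' (W : Set L)) := by
    refine hspan.trans (Submodule.span_le.2 ?_)
    rintro _ ⟨y, hy, rfl⟩
    have hspanVW : Submodule.span F ((V : Set L) ∪ W) = H := by
      rw [Submodule.span_union, Submodule.span_eq, Submodule.span_eq, hVW]
    have hy' : y ∈ Submodule.span F ((V : Set L) ∪ W) := hspanVW.symm ▸ hy
    refine pMap_mem_of_mem_span (fun a ha b hb => ?_) ?_ hy'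
    · rw [hspanVW] at ha hb
      rw [hab a ha b hb]; exact zero_mem _
    · rintro z (hz | hz)
      · exact Submodule.mem_sup_left (Submodule.subset_span ⟨z, hz, rfl⟩)
      · exact Submodule.mem_sup_right (Submodule.subset_span ⟨z, hz, rfl⟩)
  have h1 := (Submodule.finrank_mono hle).trans (Submodule.finrank_add_le_finrank_add_finrank _ _)
  have h2 := finrank_span_pMap_image_le (p := p) W fun a ha b hb => hab a ha.2 b hb.2
  have h3 := Submodule.finrank_mono hpV
  have h4 : V' = V := Submodule.eq_of_le_of_finrank_le hV'V (by omega)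
  have h5 : x ∈ V := Submodule.subset_span ⟨0, rfl⟩
  rw [← h4] at h5
  exact h5

/-- A semisimple element centralising a torus lies together with it in a torus. -/
theorem PSubalgebra.IsTorus.exists_le_mem [FiniteDimensional F L] {T : PSubalgebra F p L}
    (hT : T.IsTorus) {z : L} (hz : IsPSemisimple F p z)
    (hzT : ∀ t ∈ T.toLieSubalgebra, ⁅z, t⁆ = 0) :
    ∃ T' : PSubalgebra F p L, T'.IsTorus ∧ T.toLieSubalgebra ≤ T'.toLieSubalgebra ∧
      z ∈ T'.toLieSubalgebra := by
  set s : Set L := (T.toLieSubalgebra : Set L) ∪ {y | ∃ n : ℕ, y = (pMap F p)^[n] z} with hs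
  set H := Submodule.span F s with hH
  have hgen : ∀ x ∈ s, ∀ y ∈ s, ⁅x, y⁆ = 0 := by
    have h1 : ∀ n, ∀ t ∈ T.toLieSubalgebra, ⁅(pMap F p)^[n] z, t⁆ = 0 := fun n t ht =>
      lie_pMap_iterate_eq_zero (hzT t ht) n
    rintro x (hx | ⟨n, rfl⟩) y (hy | ⟨m, rfl⟩)
    · exact hT.1 x hx y hy
    · rw [← lie_skew, h1 m x hx, neg_zero]
    · exact h1 n y hy
    · refine lie_pMap_iterate_eq_zero ?_ n
      rw [← lie_skew, lie_pMap_iterate_eq_zero (lie_self z) m, neg_zero]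
  have hab : ∀ x ∈ H, ∀ y ∈ H, ⁅x, y⁆ = 0 := by
    intro x hx y hy
    induction hx, hy using Submodule.span_induction₂ with
    | mem_mem x y hx hy => exact hgen x hx y hy
    | zero_left => simp
    | zero_right => simp
    | add_left x y z _ _ _ h h' => rw [add_lie, h, h', add_zero]
    | add_right x y z _ _ _ h h' => rw [lie_add, h, h', add_zero]
    | smul_left c x y _ _ h => rw [smul_lie, h, smul_zero]
    | smul_right c x y _ _ h => rw [lie_smul, h, smul_zero]
  have hp' : ∀ x ∈ H, pMap F p x ∈ H := by
    intro x hx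
    refine pMap_mem_of_mem_span (fun a ha b hb => ?_) ?_ hx
    · rw [hab a ha b hb]; exact zero_mem _
    · rintro x (hx | ⟨n, rfl⟩)
      · exact Submodule.subset_span (Or.inl (T.pMap_mem x hx))
      · exact Submodule.subset_span (Or.inr ⟨n + 1, (Function.iterate_succ_apply' _ _ _).symm⟩)
  have hTH : ∀ t ∈ T.toLieSubalgebra, t ∈ H := fun t ht => Submodule.subset_span (Or.inl ht)
  have hzH : ∀ n, (pMap F p)^[n] z ∈ H := fun n => Submodule.subset_span (Or.inr ⟨n, rfl⟩)
  have hspan : H ≤ Submodule.span F (pMap F p '' (H : Set L)) := by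
    have key : ∀ y, IsPSemisimple F p y → (∀ n, (pMap F p)^[n] y ∈ H) →
        y ∈ Submodule.span F (pMap F p '' (H : Set L)) := by
      intro y hy hyH
      refine Submodule.span_mono ?_ hy
      rintro _ ⟨n, hn, rfl⟩
      refine ⟨_, hyH (n - 1), ?_⟩
      rw [← Function.iterate_succ_apply' (pMap F p), Nat.succ_eq_add_one, Nat.sub_add_cancel hn]
    have keyz := key z hz hzH
    refine Submodule.span_le.2 ?_
    rintro x (hx | ⟨n, rfl⟩)
    · refine key x (hT.2 x hx) fun n => hTH _ ?_
      induction n with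
      | zero => exact hx
      | succ n ih => rw [Function.iterate_succ_apply']; exact T.pMap_mem _ ih
    · cases n with
      | zero => exact keyz
      | succ n =>
        rw [Function.iterate_succ_apply']
        exact Submodule.subset_span ⟨_, hzH n, rfl⟩
  refine ⟨⟨⟨H, fun {x y} hx hy => ?_⟩, hp'⟩, ⟨hab, fun x hx => ?_⟩, hTH, hzH 0⟩
  · change ⁅x, y⁆ ∈ H
    rw [hab x hx y hy]; exact zero_mem _
  · exact isPSemisimple_of_le_span_pMap_image hab hp' hspan hx

/-- The image in `L` of a `p`-subalgebra of a `p`-subalgebra `I`. -/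
def PSubalgebra.map (I : PSubalgebra F p L) (T : PSubalgebra F p I.toLieSubalgebra) :
    PSubalgebra F p L where
  toLieSubalgebra := T.toLieSubalgebra.map I.toLieSubalgebra.incl
  pMap_mem := by
    rintro _ ⟨x, hx, rfl⟩
    exact ⟨pMap F p x, T.pMap_mem x hx, rfl⟩

/-- The intersection with a `p`-subalgebra `I`, as a `p`-subalgebra of `I`. -/
def PSubalgebra.comap (I T : PSubalgebra F p L) : PSubalgebra F p I.toLieSubalgebra where
  toLieSubalgebra := T.toLieSubalgebra.comap I.toLieSubalgebra.incl
  pMap_mem := fun x hx => T.pMap_mem x hx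

omit hp in
theorem coe_pMap_iterate (I : PSubalgebra F p L) (x : I.toLieSubalgebra) (n : ℕ) :
    (((pMap F p)^[n] x : I.toLieSubalgebra) : L) = (pMap F p)^[n] (x : L) := by
  induction n with
  | zero => rfl
  | succ n ih => rw [Function.iterate_succ_apply', Function.iterate_succ_apply', ← ih]; rfl

omit hp in
theorem isPSemisimple_coe_iff (I : PSubalgebra F p L) (x : I.toLieSubalgebra) :
    IsPSemisimple F p (x : L) ↔ IsPSemisimple F p x := by
  have h : Submodule.span F {y : L | ∃ n : ℕ, 1 ≤ n ∧ y = (pMap F p)^[n] (x : L)} =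
      (Submodule.span F {y | ∃ n : ℕ, 1 ≤ n ∧ y = (pMap F p)^[n] x}).map
        I.toLieSubalgebra.toSubmodule.subtype := by
    rw [Submodule.map_span]
    congr 1
    ext y
    constructor
    · rintro ⟨n, hn, rfl⟩
      exact ⟨_, ⟨n, hn, rfl⟩, coe_pMap_iterate I x n⟩
    · rintro ⟨_, ⟨n, hn, rfl⟩, rfl⟩
      exact ⟨n, hn, coe_pMap_iterate I x n⟩
  unfold IsPSemisimple
  rw [h]
  constructor
  · rintro ⟨y, hy, hyx⟩
    have : y = x := Subtype.ext hyx
    exact this ▸ hy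
  · intro hx
    exact ⟨x, hx, rfl⟩

omit hp in
theorem PSubalgebra.IsTorus.map (I : PSubalgebra F p L) {T : PSubalgebra F p I.toLieSubalgebra}
    (hT : T.IsTorus) : (PSubalgebra.map I T).IsTorus := by
  refine ⟨?_, ?_⟩
  · rintro _ ⟨x, hx, rfl⟩ _ ⟨y, hy, rfl⟩
    exact congrArg Subtype.val (hT.1 x hx y hy)
  · rintro _ ⟨x, hx, rfl⟩
    exact (isPSemisimple_coe_iff I x).2 (hT.2 x hx)

omit hp in
theorem PSubalgebra.IsTorus.comap (I : PSubalgebra F p L) {T : PSubalgebra F p L}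
    (hT : T.IsTorus) : (PSubalgebra.comap I T).IsTorus :=
  ⟨fun x hx y hy => Subtype.ext (hT.1 x hx y hy),
    fun x hx => (isPSemisimple_coe_iff I x).1 (hT.2 x hx)⟩

omit hp in
theorem PSubalgebra.finrank_map (I : PSubalgebra F p L) (T : PSubalgebra F p I.toLieSubalgebra) :
    Module.finrank F (PSubalgebra.map I T).toLieSubalgebra = Module.finrank F T.toLieSubalgebra :=
  (Submodule.equivMapOfInjective I.toLieSubalgebra.toSubmodule.subtype
    (Submodule.subtype_injective _) T.toLieSubalgebra.toSubmodule).finrank_eq.symm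

end PMap

namespace RestrictedEnvelopingAlgebra

/-! ### The idempotent of a torus -/

section Idempotent

variable {F : Type u} {p : ℕ} {L : Type v} [Field F] [hp : Fact p.Prime] [LieRing L]
  [LieAlgebra F L] [RestrictedLieAlgebra F p L]

/-- `e` lies in the subalgebra `u(T)` of `u(L)` generated by `T`, is annihilated by `T`, and is
mapped to `1` by the augmentation. Such an `e` is an idempotent, and `u(L) e` is the module induced
from the trivial `u(T)`-module. -/
structure IsTrivialIdempotent (T : PSubalgebra F p L) (e : RestrictedEnvelopingAlgebra F p L) :
    Prop where
  ι_mul : ∀ t ∈ T.toLieSubalgebra, ι F p L t * e = 0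
  mem_adjoin : e ∈ Algebra.adjoin F (ι F p L '' T.toLieSubalgebra)
  augmentation_eq : augmentation F p L e = 1

variable {T : PSubalgebra F p L} {e : RestrictedEnvelopingAlgebra F p L}

namespace IsTrivialIdempotent

theorem mul_eq_of_mem_adjoin (he : IsTrivialIdempotent T e) {c : RestrictedEnvelopingAlgebra F p L}
    (hc : c ∈ Algebra.adjoin F (ι F p L '' T.toLieSubalgebra)) :
    c * e = augmentation F p L c • e := by
  induction hc using Algebra.adjoin_induction with
  | mem c hc =>
    obtain ⟨t, ht, rfl⟩ := hc
    rw [he.ι_mul t ht, augmentation_ι, zero_smul]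
  | algebraMap r => rw [AlgHom.commutes, Algebra.smul_def]; rfl
  | add a b _ _ ha hb => rw [add_mul, ha, hb, map_add, add_smul]
  | mul a b _ _ ha hb =>
    rw [mul_assoc, hb, mul_smul_comm, ha, smul_smul, map_mul, mul_comm]

theorem mul_self (he : IsTrivialIdempotent T e) : e * e = e := by
  rw [he.mul_eq_of_mem_adjoin he.mem_adjoin, he.augmentation_eq, one_smul]

theorem commute_of_lie_eq_zero (he : IsTrivialIdempotent T e) {y : L}
    (hy : ∀ t ∈ T.toLieSubalgebra, ⁅y, t⁆ = 0) : Commute (ι F p L y) e := by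
  have := he.mem_adjoin
  clear he
  induction this using Algebra.adjoin_induction with
  | mem c hc =>
    obtain ⟨t, ht, rfl⟩ := hc
    rw [commute_iff_lie_eq, ← LieHom.map_lie, hy t ht, map_zero]
  | algebraMap r => exact (Algebra.commutes r _).symm
  | add a b _ _ ha hb => exact ha.add_right hb
  | mul a b _ _ ha hb => exact ha.mul_right hb

theorem map_isLeibniz (he : IsTrivialIdempotent T e)
    {D : Module.End F (RestrictedEnvelopingAlgebra F p L)} (hD : IsLeibniz D)
    (h : ∀ t ∈ T.toLieSubalgebra, D (ι F p L t) = 0) : D e = 0 := by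
  have := he.mem_adjoin
  clear he
  induction this using Algebra.adjoin_induction with
  | mem c hc => obtain ⟨t, ht, rfl⟩ := hc; exact h t ht
  | algebraMap r => exact hD.map_algebraMap r
  | add a b _ _ ha hb => rw [map_add, ha, hb, add_zero]
  | mul a b _ _ ha hb => rw [hD a b, ha, hb, zero_mul, mul_zero, add_zero]

theorem inclusion (I : PSubalgebra F p L) {T : PSubalgebra F p I.toLieSubalgebra}
    {e : RestrictedEnvelopingAlgebra F p I.toLieSubalgebra} (he : IsTrivialIdempotent T e) :
    IsTrivialIdempotent (PSubalgebra.map I T) (RestrictedEnvelopingAlgebra.inclusion I e) := by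
  refine ⟨?_, ?_, by rw [augmentation_inclusion, he.augmentation_eq]⟩
  · rintro _ ⟨t, ht, rfl⟩
    have := congrArg (RestrictedEnvelopingAlgebra.inclusion I) (he.ι_mul t ht)
    rw [map_mul, inclusion_ι, map_zero] at this
    exact this
  · have h1 : RestrictedEnvelopingAlgebra.inclusion I e ∈
        (Algebra.adjoin F (ι F p _ '' T.toLieSubalgebra)).map
          (RestrictedEnvelopingAlgebra.inclusion I) := ⟨e, he.mem_adjoin, rfl⟩
    rw [AlgHom.map_adjoin] at h1
    refine Algebra.adjoin_mono ?_ h1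
    rintro _ ⟨_, ⟨t, ht, rfl⟩, rfl⟩
    exact ⟨t, ⟨t, ht, rfl⟩, (inclusion_ι I t).symm⟩

end IsTrivialIdempotent

/-- If `x = ∑ c_n x^[p]^n` with `n ≥ 1`, then `x` is annihilated by
`1 - ∑ c_n x ^ (p ^ n - 1)`. -/
theorem exists_ι_mul_one_sub_eq_zero {x : L} (hx : IsPSemisimple F p x) :
    ∃ c ∈ Algebra.adjoin F {ι F p L x}, augmentation F p L c = 0 ∧
      ι F p L x * (1 - c) = 0 := by
  have key : ∀ y ∈ Submodule.span F {y : L | ∃ n : ℕ, 1 ≤ n ∧ y = (pMap F p)^[n] x},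
      ∃ c ∈ Algebra.adjoin F {ι F p L x}, augmentation F p L c = 0 ∧
        ι F p L y = ι F p L x * c := by
    intro y hy
    induction hy using Submodule.span_induction with
    | mem y hy =>
      obtain ⟨n, hn, rfl⟩ := hy
      have hpow : ∀ n, ι F p L ((pMap F p)^[n] x) = ι F p L x ^ p ^ n := by
        intro n
        induction n with
        | zero => simp
        | succ n ih => rw [Function.iterate_succ_apply', ← ι_pow, ih, ← pow_mul, pow_succ]
      have h2 : 1 < p ^ n := Nat.one_lt_pow (by omega) hp.out.one_lt
      refine ⟨ι F p L x ^ (p ^ n - 1), pow_mem (Algebra.self_mem_adjoin_singleton _ _) _, ?_, ?_⟩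
      · rw [map_pow, augmentation_ι, zero_pow (by omega)]
      · rw [hpow, mul_pow_sub_one (by omega)]
    | zero => exact ⟨0, zero_mem _, map_zero _, by simp⟩
    | add y z _ _ hy hz =>
      obtain ⟨c, hc, hc0, hcy⟩ := hy
      obtain ⟨d, hd, hd0, hdz⟩ := hz
      exact ⟨c + d, add_mem hc hd, by rw [map_add, hc0, hd0, add_zero],
        by rw [map_add, hcy, hdz, mul_add]⟩
    | smul a y _ hy =>
      obtain ⟨c, hc, hc0, hcy⟩ := hy
      exact ⟨a • c, Subalgebra.smul_mem _ hc a, by rw [map_smul, hc0, smul_zero],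
        by rw [map_smul, hcy, mul_smul_comm]⟩
  obtain ⟨c, hc, hc0, hcx⟩ := key x hx
  exact ⟨c, hc, hc0, by rw [mul_sub, mul_one, ← hcx, sub_self]⟩

theorem exists_isTrivialIdempotent [FiniteDimensional F L] (hT : T.IsTorus) :
    ∃ e, IsTrivialIdempotent T e := by
  have hcomm : ∀ x ∈ ι F p L '' (T.toLieSubalgebra : Set L),
      ∀ y ∈ ι F p L '' (T.toLieSubalgebra : Set L), x * y = y * x := by
    rintro _ ⟨x, hx, rfl⟩ _ ⟨y, hy, rfl⟩
    rw [← sub_eq_zero, ← Ring.lie_def, ← LieHom.map_lie, hT.1 x hx y hy, map_zero]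
  have key : ∀ s : Finset L, (s : Set L) ⊆ T.toLieSubalgebra →
      ∃ e ∈ Algebra.adjoin F (ι F p L '' T.toLieSubalgebra), augmentation F p L e = 1 ∧
        ∀ t ∈ s, ι F p L t * e = 0 := by
    classical
    intro s
    induction s using Finset.induction_on with
    | empty => exact fun _ => ⟨1, one_mem _, map_one _, by simp⟩
    | insert t s _ ih =>
      intro hs
      rw [Finset.coe_insert, Set.insert_subset_iff] at hs
      obtain ⟨e, he, he1, hes⟩ := ih hs.2
      obtain ⟨c, hc, hc0, hct⟩ := exists_ι_mul_one_sub_eq_zero (hT.2 t hs.1)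
      have hc' : c ∈ Algebra.adjoin F (ι F p L '' T.toLieSubalgebra) :=
        Algebra.adjoin_mono (Set.singleton_subset_iff.2 (Set.mem_image_of_mem _ hs.1)) hc
      refine ⟨(1 - c) * e, mul_mem (sub_mem (one_mem _) hc') he, ?_, fun t' ht' => ?_⟩
      · rw [map_mul, map_sub, map_one, hc0, sub_zero, he1, one_mul]
      · rcases Finset.mem_insert.1 ht' with rfl | ht'
        · rw [← mul_assoc, hct, zero_mul]
        · have : Commute (ι F p L t') (1 - c) := by
            refine (Commute.one_right _).sub_right ?_
            refine Algebra.commute_of_mem_adjoin_of_forall_mem_commute hc' fun b hb => ?_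
            exact hcomm _ (Set.mem_image_of_mem _ (hs.2 ht')) b hb
          rw [← mul_assoc, this.eq, mul_assoc, hes t' ht', mul_zero]
  obtain ⟨s, hs⟩ := IsNoetherian.noetherian T.toLieSubalgebra.toSubmodule
  obtain ⟨e, he, he1, hes⟩ := key s fun x hx => by
    have : x ∈ Submodule.span F (s : Set L) := Submodule.subset_span hx
    rw [hs] at this
    exact this
  refine ⟨e, fun t ht => ?_, he, he1⟩
  have ht' : t ∈ Submodule.span F (s : Set L) := by rw [hs]; exact ht
  induction ht' using Submodule.span_induction with
  | mem x hx => exact hes x hx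
  | zero => simp
  | add x y hx hy h h' =>
    rw [map_add, add_mul, h (hs.le hx), h' (hs.le hy), add_zero]
  | smul a x hx h => rw [map_smul, smul_mul_assoc, h (hs.le hx), smul_zero]

/-- The action of `u(L)` on `L` extending the adjoint representation. -/
noncomputable def adjointAction (F : Type u) (p : ℕ) (L : Type v) [Field F] [LieRing L]
    [LieAlgebra F L] [RestrictedLieAlgebra F p L] :
    RestrictedEnvelopingAlgebra F p L →ₐ[F] Module.End F L :=
  lift (LieAlgebra.ad F L) fun x => (ad_pMap x).symm

omit hp in
theorem adjointAction_ι (x y : L) : adjointAction F p L (ι F p L x) y = ⁅x, y⁆ := by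
  rw [adjointAction, lift_ι, LieAlgebra.ad_apply]

theorem adjointAction_sub_mem {N : Submodule F L} (hN : ∀ x y : L, ⁅x, y⁆ ∈ N)
    (a : RestrictedEnvelopingAlgebra F p L) (y : L) :
    adjointAction F p L a y - augmentation F p L a • y ∈ N := by
  induction a using induction_on generalizing y with
  | hι x => rw [adjointAction_ι, augmentation_ι, zero_smul, sub_zero]; exact hN x y
  | hF c => rw [AlgHom.commutes, AlgHom.commutes, Module.algebraMap_end_apply]; simp
  | hadd a b ha hb =>
    rw [map_add, map_add, add_smul, LinearMap.add_apply, add_sub_add_comm]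
    exact add_mem (ha y) (hb y)
  | hmul a b ha hb =>
    rw [map_mul, map_mul, Module.End.mul_apply, mul_smul]
    have := add_mem (ha (adjointAction F p L b y)) (N.smul_mem (augmentation F p L a) (hb y))
    rwa [smul_sub, sub_add_sub_cancel] at this

/-- Modulo the derived algebra every element of `L` centralises a given torus. -/
theorem exists_centralizing_sub_mem [FiniteDimensional F L] (hT : T.IsTorus)
    {N : Submodule F L} (hN : ∀ x y : L, ⁅x, y⁆ ∈ N) (y : L) :
    ∃ z, y - z ∈ N ∧ ∀ t ∈ T.toLieSubalgebra, ⁅z, t⁆ = 0 := by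
  obtain ⟨e, he⟩ := exists_isTrivialIdempotent hT
  refine ⟨adjointAction F p L e y, ?_, fun t ht => ?_⟩
  · have := adjointAction_sub_mem hN e y
    rw [he.augmentation_eq, one_smul] at this
    rw [← neg_sub]
    exact neg_mem this
  · rw [← lie_skew, ← adjointAction_ι (F := F) (p := p), ← Module.End.mul_apply, ← map_mul,
      he.ι_mul t ht, map_zero, LinearMap.zero_apply, neg_zero]

end Idempotent

end RestrictedEnvelopingAlgebra

namespace RestrictedEnvelopingAlgebra

/-! ### Locality of `u(L) e` -/

section Locality

variable {F : Type u} {p : ℕ} {L : Type v} [Field F] [hp : Fact p.Prime] [LieRing L]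
  [LieAlgebra F L] [RestrictedLieAlgebra F p L]

/-- Every element of `u(L) e` outside the kernel of the augmentation generates `u(L) e`. For an
idempotent `e` of augmentation `1` this says that the kernel of the augmentation is the only
maximal submodule of `u(L) e`. -/
def IsLocalIdempotent (e : RestrictedEnvelopingAlgebra F p L) : Prop :=
  ∀ q, q * e = q → augmentation F p L q ≠ 0 → ∃ a, a * q = e

omit hp in
theorem eq_bot_or_eq_top_of_ι_smul_mem {S : Type*} [AddCommGroup S] [Module F S]
    [Module (RestrictedEnvelopingAlgebra F p L) S]
    [IsScalarTower F (RestrictedEnvelopingAlgebra F p L) S]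
    [IsSimpleModule (RestrictedEnvelopingAlgebra F p L) S] (N : Submodule F S)
    (h : ∀ x, ∀ s ∈ N, ι F p L x • s ∈ N) : N = ⊥ ∨ N = ⊤ := by
  let N' : Submodule (RestrictedEnvelopingAlgebra F p L) S :=
    { carrier := N
      add_mem' := N.add_mem
      zero_mem' := N.zero_mem
      smul_mem' := fun a s hs => smul_mem_of_forall_ι_smul_mem N h a s hs }
  have hN : ∀ s, s ∈ N ↔ s ∈ N' := fun _ => Iff.rfl
  rcases eq_bot_or_eq_top N' with h1 | h1
  · left
    ext s
    rw [hN, h1]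
    rfl
  · right
    ext s
    rw [hN, h1]
    simp

/-- If every simple module not annihilated by `e` is trivial, then `e` is local. -/
theorem isLocalIdempotent_of_simple [FiniteDimensional F L] {e : RestrictedEnvelopingAlgebra F p L}
    (he : e * e = e) (h : ∀ (S : Type (max u v)) [AddCommGroup S] [Module F S]
      [Module (RestrictedEnvelopingAlgebra F p L) S]
      [IsScalarTower F (RestrictedEnvelopingAlgebra F p L) S]
      [IsSimpleModule (RestrictedEnvelopingAlgebra F p L) S] [FiniteDimensional F S] (s : S),
      e • s ≠ 0 → ∀ (x : L) (s : S), ι F p L x • s = 0) :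
    IsLocalIdempotent e := by
  intro q hq hq0
  by_contra hne
  set N : Ideal (RestrictedEnvelopingAlgebra F p L) := Ideal.span {q} ⊔ Ideal.span {1 - e} with hN
  have hN1 : N ≠ ⊤ := by
    intro htop
    have h1 : (1 : RestrictedEnvelopingAlgebra F p L) ∈ N := htop ▸ Submodule.mem_top
    obtain ⟨x, hx, y, hy, hxy⟩ := Submodule.mem_sup.1 h1
    obtain ⟨a, rfl⟩ := Ideal.mem_span_singleton'.1 hx
    obtain ⟨b, rfl⟩ := Ideal.mem_span_singleton'.1 hy
    -- multiplying `a q + b (1 - e) = 1` by `e` on the right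
    refine hne ⟨a, ?_⟩
    have := congrArg (· * e) hxy
    simp only [add_mul, mul_assoc, sub_mul, one_mul, he, sub_self, mul_zero, add_zero, hq] at this
    exact this
  obtain ⟨m, hm, hNm⟩ := Ideal.exists_le_maximal N hN1
  have hqm : q ∈ m := hNm (Submodule.mem_sup_left (Ideal.mem_span_singleton_self q))
  have hem : 1 - e ∈ m := hNm (Submodule.mem_sup_right (Ideal.mem_span_singleton_self _))
  let M : Submodule (RestrictedEnvelopingAlgebra F p L) (RestrictedEnvelopingAlgebra F p L) := m
  have hsimple : IsSimpleModule (RestrictedEnvelopingAlgebra F p L)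
      (RestrictedEnvelopingAlgebra F p L ⧸ M) := isSimpleModule_iff_isCoatom.2 hm.out
  have h1 : M.mkQ 1 ≠ 0 := by
    rw [Submodule.mkQ_apply, ne_eq, Submodule.Quotient.mk_eq_zero]
    exact fun h1 => hm.ne_top ((Ideal.eq_top_iff_one _).2 h1)
  have h2 : e • M.mkQ 1 = M.mkQ 1 := by
    rw [← map_smul, smul_eq_mul, mul_one, eq_comm, ← sub_eq_zero, ← map_sub,
      Submodule.mkQ_apply, Submodule.Quotient.mk_eq_zero]
    exact hem
  have hfin : FiniteDimensional F (RestrictedEnvelopingAlgebra F p L ⧸ M) :=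
    Module.Finite.of_surjective (M.mkQ.restrictScalars F) M.mkQ_surjective
  have h3 := h _ (M.mkQ 1) (by rwa [h2])
  have h4 := smul_eq_augmentation_smul (M.mkQ 1) (fun x => h3 x _) q
  rw [← map_smul, smul_eq_mul, mul_one, Submodule.mkQ_apply,
    (Submodule.Quotient.mk_eq_zero M).2 hqm] at h4
  exact (smul_ne_zero hq0 h1) h4.symm

/-- A simple `u(L)`-module `S` with `e₀ S ≠ 0` is annihilated by `I`. The vectors `s` with
`e₀ u(I) s = 0` form a submodule, since `L` is spanned by `I` and elements commuting with `e₀`;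
so every minimal `u(I)`-submodule of `S` is a quotient of `u(I) e₀` and is trivial by locality of
`e₀`. Hence `S` has nonzero `I`-invariants, and these form a submodule. -/
theorem ι_smul_eq_zero_of_isSimpleModule [CharP F p] [FiniteDimensional F L]
    (I : PSubalgebra F p L) (hI : ∀ x y : L, ⁅x, y⁆ ∈ I.toLieSubalgebra)
    {T : PSubalgebra F p I.toLieSubalgebra} (hT : T.IsTorus)
    {e : RestrictedEnvelopingAlgebra F p I.toLieSubalgebra} (he : IsTrivialIdempotent T e)
    (hloc : IsLocalIdempotent e) {S : Type*} [AddCommGroup S] [Module F S]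
    [Module (RestrictedEnvelopingAlgebra F p L) S]
    [IsScalarTower F (RestrictedEnvelopingAlgebra F p L) S]
    [IsSimpleModule (RestrictedEnvelopingAlgebra F p L) S] [FiniteDimensional F S]
    {s₀ : S} (hs₀ : inclusion I e • s₀ ≠ 0) (a : I.toLieSubalgebra) (s : S) :
    ι F p L a • s = 0 := by
  let N₀ : Submodule F S :=
    { carrier := {s | ∀ a, inclusion I (e * a) • s = 0}
      add_mem' := fun hs ht a => by rw [smul_add, hs a, ht a, add_zero]
      zero_mem' := fun a => smul_zero _
      smul_mem' := fun c s hs a => by rw [smul_comm, hs a, smul_zero] }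
  have hN₀ : ∀ x, ∀ s ∈ N₀, ι F p L x • s ∈ N₀ := by
    intro x s hs a
    obtain ⟨z, hz, hzT⟩ := exists_centralizing_sub_mem (PSubalgebra.IsTorus.map I hT)
      (N := I.toLieSubalgebra.toSubmodule) hI x
    have hzD : adDer I hI z e = 0 := he.map_isLeibniz (isLeibniz_adDer I hI z) fun t ht => by
      rw [adDer_ι]
      have : (⟨⁅z, (t : L)⁆, hI z t⟩ : I.toLieSubalgebra) = 0 :=
        Subtype.ext (hzT t ⟨t, ht, rfl⟩)
      rw [this, map_zero]
    have h1 : inclusion I (e * a) • ι F p L z • s = 0 := by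
      have h := congrArg (· • s) (ι_mul_inclusion I hI z (e * a))
      simp only [mul_smul, add_smul] at h
      rw [hs a, smul_zero, isLeibniz_adDer I hI z, hzD, zero_mul, zero_add, hs, add_zero] at h
      exact h.symm
    have h2 : inclusion I (e * a) • ι F p L (x - z) • s = 0 := by
      have h := hs (a * ι F p _ ⟨x - z, hz⟩)
      rwa [← mul_assoc, map_mul, inclusion_ι, mul_smul] at h
    have h3 := congrArg₂ (· + ·) h1 h2
    simpa [← smul_add, ← add_smul, ← map_add] using h3
  have hN₀bot : N₀ = ⊥ := (eq_bot_or_eq_top_of_ι_smul_mem N₀ hN₀).resolve_right fun htop => by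
    have h1 : s₀ ∈ N₀ := htop ▸ Submodule.mem_top
    exact hs₀ (by simpa using h1 1)
  let f : S → RestrictedEnvelopingAlgebra F p I.toLieSubalgebra →ₗ[F] S := fun s =>
    (LinearMap.toSpanSingleton (RestrictedEnvelopingAlgebra F p L) S s).restrictScalars F ∘ₗ
      (inclusion I).toLinearMap
  have hf : ∀ s a, f s a = inclusion I a • s := fun s a => rfl
  obtain ⟨s₁, hs₁, hmin⟩ := (measure fun s => Module.finrank F (LinearMap.range (f s))).wf.has_min
    {s : S | s ≠ 0} ⟨s₀, fun h => hs₀ (by rw [h, smul_zero])⟩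
  obtain ⟨a₁, ha₁⟩ : ∃ a, inclusion I (e * a) • s₁ ≠ 0 := by
    by_contra! h
    have h1 : s₁ ∈ N₀ := h
    rw [hN₀bot] at h1
    exact hs₁ h1
  have hback : ∀ a, inclusion I a • s₁ ≠ 0 → ∃ b, inclusion I b • inclusion I a • s₁ = s₁ := by
    intro a ha
    have hle : LinearMap.range (f (inclusion I a • s₁)) ≤ LinearMap.range (f s₁) := by
      rintro _ ⟨b, rfl⟩
      exact ⟨b * a, by rw [hf, hf, map_mul, mul_smul]⟩
    have heq := Submodule.eq_of_le_of_finrank_le hle (not_lt.1 (hmin _ ha))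
    have h1 : s₁ ∈ LinearMap.range (f s₁) := ⟨1, by rw [hf, map_one, one_smul]⟩
    rw [← heq] at h1
    exact h1
  set s₂ := inclusion I (e * a₁) • s₁ with hs₂
  have hes₂ : inclusion I e • s₂ = s₂ := by
    rw [hs₂, ← mul_smul, ← map_mul, ← mul_assoc, he.mul_self]
  have hs₂I : ∀ a, augmentation F p _ a = 0 → inclusion I a • s₂ = 0 := by
    intro a ha
    by_contra hne
    rw [hs₂, ← mul_smul, ← map_mul] at hne
    obtain ⟨b, hb⟩ := hback _ hne
    have hb2 : inclusion I (e * a₁ * b * a) • s₂ = s₂ := by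
      rw [map_mul, map_mul _ _ b, mul_smul, mul_smul, hs₂, ← mul_smul _ _ s₁, ← map_mul, hb]
    obtain ⟨c, hc⟩ := hloc (e - e * a₁ * b * a * e)
      (by rw [sub_mul, mul_assoc _ e e, he.mul_self])
      (by rw [map_sub, map_mul, map_mul _ _ a, ha, mul_zero, zero_mul, sub_zero,
            he.augmentation_eq]; exact one_ne_zero)
    refine ha₁ ?_
    rw [← hes₂, ← hc, map_mul, mul_smul, map_sub, sub_smul, map_mul _ _ e, mul_smul, hes₂,
      hb2, sub_self, smul_zero]
  let Z : Submodule F S :=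
    { carrier := {s | ∀ a : I.toLieSubalgebra, ι F p L a • s = 0}
      add_mem' := fun hs ht a => by rw [smul_add, hs a, ht a, add_zero]
      zero_mem' := fun a => smul_zero _
      smul_mem' := fun c s hs a => by rw [smul_comm, hs a, smul_zero] }
  have hZ : ∀ x, ∀ s ∈ Z, ι F p L x • s ∈ Z := by
    intro x s hs a
    have h1 : ι F p L a * ι F p L x = ι F p L x * ι F p L a + ι F p L ⁅(a : L), x⁆ := by
      rw [LieHom.map_lie, Ring.lie_def]; abel
    rw [← mul_smul, h1, add_smul, mul_smul, hs a, smul_zero, zero_add]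
    exact hs ⟨_, hI _ _⟩
  have hZtop : Z = ⊤ := (eq_bot_or_eq_top_of_ι_smul_mem Z hZ).resolve_left fun hbot => by
    have h1 : s₂ ∈ Z := fun a => by
      rw [← inclusion_ι]
      exact hs₂I _ (augmentation_ι a)
    rw [hbot] at h1
    exact ha₁ h1
  have : s ∈ Z := hZtop ▸ Submodule.mem_top
  exact this a

/-- The step for `L = I + F x` with `x^[p] ∈ I`: on a simple module annihilated by `I` the element
`x` acts nilpotently, hence trivially. -/
theorem IsLocalIdempotent.inclusion_of_pMap_mem [CharP F p] [FiniteDimensional F L]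
    (I : PSubalgebra F p L) (hI : ∀ x y : L, ⁅x, y⁆ ∈ I.toLieSubalgebra)
    {T : PSubalgebra F p I.toLieSubalgebra} (hT : T.IsTorus)
    {e : RestrictedEnvelopingAlgebra F p I.toLieSubalgebra} (he : IsTrivialIdempotent T e)
    (hloc : IsLocalIdempotent e) {x : L} (hx : pMap F p x ∈ I.toLieSubalgebra)
    (hspan : ∀ y : L, ∃ c : F, y - c • x ∈ I.toLieSubalgebra) :
    IsLocalIdempotent (inclusion I e) := by
  refine isLocalIdempotent_of_simple (he.inclusion I).mul_self ?_
  intro S _ _ _ _ _ _ s₀ hs₀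
  have hzero := ι_smul_eq_zero_of_isSimpleModule I hI hT he hloc hs₀
  have hy : ∀ y, ∃ c : F, ∀ s : S, ι F p L y • s = c • ι F p L x • s := by
    intro y
    obtain ⟨c, hc⟩ := hspan y
    refine ⟨c, fun s => ?_⟩
    have := hzero ⟨_, hc⟩ s
    rw [map_sub, map_smul, sub_smul, sub_eq_zero, smul_assoc] at this
    exact this
  let Z : Submodule F S :=
    { carrier := {s | ι F p L x • s = 0}
      add_mem' := fun {s t} hs ht => by
        change ι F p L x • (s + t) = 0
        rw [smul_add, hs, ht, add_zero]
      zero_mem' := smul_zero _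
      smul_mem' := fun c s hs => by
        change ι F p L x • (c • s) = 0
        rw [smul_comm, hs, smul_zero] }
  have hZ : ∀ y, ∀ s ∈ Z, ι F p L y • s ∈ Z := by
    intro y s hs
    obtain ⟨c, hc⟩ := hy y
    rw [hc, show ι F p L x • s = 0 from hs, smul_zero]
    exact Z.zero_mem
  have hZtop : Z = ⊤ := (eq_bot_or_eq_top_of_ι_smul_mem Z hZ).resolve_left fun hbot => by
    have hinj : ∀ s : S, ι F p L x • s = 0 → s = 0 := fun s hs => by
      have h1 : s ∈ Z := hs
      rwa [hbot] at h1
    have hinj' : ∀ (n : ℕ) (s : S), ι F p L x ^ n • s = 0 → s = 0 := by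
      intro n
      induction n with
      | zero => intro s hs; simpa using hs
      | succ n ih =>
        intro s hs
        rw [pow_succ, mul_smul] at hs
        exact hinj _ (ih _ hs)
    refine hs₀ ?_
    rw [hinj' p s₀ (by rw [ι_pow]; exact hzero ⟨_, hx⟩ s₀), smul_zero]
  intro y s
  obtain ⟨c, hc⟩ := hy y
  have : s ∈ Z := hZtop ▸ Submodule.mem_top
  rw [hc, show ι F p L x • s = 0 from this, smul_zero]

/-- The step for `L = T' + I` with a torus `T'`: the `T'`-invariants of a simple module annihilated
by `I` form a submodule. -/
theorem IsLocalIdempotent.of_sup_eq_top [CharP F p] [FiniteDimensional F L]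
    (I : PSubalgebra F p L) (hI : ∀ x y : L, ⁅x, y⁆ ∈ I.toLieSubalgebra)
    {T : PSubalgebra F p I.toLieSubalgebra} (hT : T.IsTorus)
    {e : RestrictedEnvelopingAlgebra F p I.toLieSubalgebra} (he : IsTrivialIdempotent T e)
    (hloc : IsLocalIdempotent e) {T' : PSubalgebra F p L}
    (hTT' : (PSubalgebra.map I T).toLieSubalgebra ≤ T'.toLieSubalgebra)
    (hsup : ∀ y : L, ∃ t ∈ T'.toLieSubalgebra, y - t ∈ I.toLieSubalgebra)
    {e' : RestrictedEnvelopingAlgebra F p L} (he' : IsTrivialIdempotent T' e') :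
    IsLocalIdempotent e' := by
  refine isLocalIdempotent_of_simple he'.mul_self ?_
  intro S _ _ _ _ _ _ s₀ hs₀
  have hee' : inclusion I e * e' = e' := by
    rw [he'.mul_eq_of_mem_adjoin (Algebra.adjoin_mono (Set.image_mono hTT')
      (he.inclusion I).mem_adjoin), (he.inclusion I).augmentation_eq, one_smul]
  have hzero := ι_smul_eq_zero_of_isSimpleModule I hI hT he hloc (s₀ := e' • s₀)
    (by rwa [← mul_smul, hee'])
  have hy : ∀ y, ∃ t ∈ T'.toLieSubalgebra, ∀ s : S, ι F p L y • s = ι F p L t • s := by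
    intro y
    obtain ⟨t, ht, hyt⟩ := hsup y
    refine ⟨t, ht, fun s => ?_⟩
    have := hzero ⟨_, hyt⟩ s
    rwa [map_sub, sub_smul, sub_eq_zero] at this
  let Z : Submodule F S :=
    { carrier := {s | ∀ t ∈ T'.toLieSubalgebra, ι F p L t • s = 0}
      add_mem' := fun hs ht a ha => by rw [smul_add, hs a ha, ht a ha, add_zero]
      zero_mem' := fun a _ => smul_zero _
      smul_mem' := fun c s hs a ha => by rw [smul_comm, hs a ha, smul_zero] }
  have hZ : ∀ y, ∀ s ∈ Z, ι F p L y • s ∈ Z := by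
    intro y s hs
    obtain ⟨t, ht, hyt⟩ := hy y
    rw [hyt, hs t ht]
    exact Z.zero_mem
  have hZtop : Z = ⊤ := (eq_bot_or_eq_top_of_ι_smul_mem Z hZ).resolve_left fun hbot => by
    have h1 : e' • s₀ ∈ Z := fun t ht => by rw [← mul_smul, he'.ι_mul t ht, zero_smul]
    rw [hbot] at h1
    exact hs₀ h1
  intro y s
  obtain ⟨t, ht, hyt⟩ := hy y
  have : s ∈ Z := hZtop ▸ Submodule.mem_top
  rw [hyt, this t ht]

end Locality

end RestrictedEnvelopingAlgebra

namespace RestrictedEnvelopingAlgebra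

/-! ### Lower bounds for the dimension of `u(L) e` -/

section LowerBound

variable {F : Type u} {p : ℕ} {L : Type v} [Field F] [hp : Fact p.Prime] [CharP F p] [LieRing L]
  [LieAlgebra F L] [RestrictedLieAlgebra F p L]

omit [CharP F p] in
/-- A linear map that is invariant under right multiplication by `e` is determined on `u(L) e`. -/
theorem finrank_range_le_of_map_mul [FiniteDimensional F L]
    {e : RestrictedEnvelopingAlgebra F p L}
    {W : Type*} [AddCommGroup W] [Module F W] (g : RestrictedEnvelopingAlgebra F p L →ₗ[F] W)
    (hg : ∀ a, g (a * e) = g a) :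
    Module.finrank F (LinearMap.range g) ≤
      Module.finrank F (LinearMap.range (LinearMap.mulRight F e)) := by
  have h : LinearMap.range g ≤ (LinearMap.range (LinearMap.mulRight F e)).map g := by
    rintro _ ⟨a, rfl⟩
    exact ⟨a * e, ⟨a, rfl⟩, hg a⟩
  exact (Submodule.finrank_mono h).trans (Submodule.finrank_map_le _ _)

/-- The torus step. With `A = u(I)` and `L = T' + I`, the space `A e` is an `L`-module on which `I`
acts by left multiplication and `t ∈ T'` through the derivation extending `ad t`: the two actions
agree on `T' ∩ I = T`. It is a quotient of `u(L) e'`. Below, `L` acts on all of `A`, through the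
projection `q ↦ q e`. -/
theorem finrank_le_of_torus [FiniteDimensional F L]
    (I : PSubalgebra F p L) (hI : ∀ x y : L, ⁅x, y⁆ ∈ I.toLieSubalgebra)
    {T : PSubalgebra F p I.toLieSubalgebra}
    {e : RestrictedEnvelopingAlgebra F p I.toLieSubalgebra} (he : IsTrivialIdempotent T e)
    {T' : PSubalgebra F p L} (hT' : T'.IsTorus)
    (hTT' : ∀ t : I.toLieSubalgebra, t ∈ T.toLieSubalgebra ↔ (t : L) ∈ T'.toLieSubalgebra)
    (hsup : ∀ y : L, ∃ t ∈ T'.toLieSubalgebra, y - t ∈ I.toLieSubalgebra)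
    {e' : RestrictedEnvelopingAlgebra F p L} (he' : IsTrivialIdempotent T' e') :
    Module.finrank F (LinearMap.range (LinearMap.mulRight F e)) ≤
      Module.finrank F (LinearMap.range (LinearMap.mulRight F e')) := by
  -- a linear choice `s y ∈ T'` with `y - s y ∈ I`
  obtain ⟨s, hsT, hsI⟩ : ∃ s : L →ₗ[F] L, (∀ y, s y ∈ T'.toLieSubalgebra) ∧
      ∀ y, y - s y ∈ I.toLieSubalgebra := by
    let q := I.toLieSubalgebra.toSubmodule.mkQ
    let g : T'.toLieSubalgebra →ₗ[F] (L ⧸ I.toLieSubalgebra.toSubmodule) :=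
      q ∘ₗ T'.toLieSubalgebra.toSubmodule.subtype
    have hg : LinearMap.range g = ⊤ := by
      rw [LinearMap.range_eq_top]
      intro z
      obtain ⟨y, rfl⟩ := Submodule.mkQ_surjective _ z
      obtain ⟨t, ht, hyt⟩ := hsup y
      refine ⟨⟨t, ht⟩, ?_⟩
      have : q y - q t = 0 := by
        rw [← map_sub]
        exact (Submodule.Quotient.mk_eq_zero _).2 hyt
      exact (sub_eq_zero.1 this).symm
    obtain ⟨r, hr⟩ := LinearMap.exists_rightInverse_of_surjective g hg
    refine ⟨T'.toLieSubalgebra.toSubmodule.subtype ∘ₗ r ∘ₗ q, fun y => (r (q y)).2, fun y => ?_⟩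
    have h1 : q (r (q y) : L) = q y := LinearMap.congr_fun hr (q y)
    have h2 : q (y - (r (q y) : L)) = 0 := by rw [map_sub, h1, sub_self]
    exact (Submodule.Quotient.mk_eq_zero _).1 h2
  let A := RestrictedEnvelopingAlgebra F p I.toLieSubalgebra
  let R : Module.End F A := LinearMap.mulRight F e
  have hRR : R * R = R := by
    ext q
    simp only [R, Module.End.mul_apply, LinearMap.mulRight_apply, mul_assoc, he.mul_self]
  have hDe : ∀ t ∈ T'.toLieSubalgebra, adDer I hI t e = 0 := fun t ht =>
    he.map_isLeibniz (isLeibniz_adDer I hI t) fun t₀ ht₀ => by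
      rw [adDer_ι]
      have : (⟨⁅t, (t₀ : L)⁆, hI t t₀⟩ : I.toLieSubalgebra) = 0 :=
        Subtype.ext (hT'.1 t ht _ ((hTT' t₀).1 ht₀))
      rw [this, map_zero]
  let pr : L →ₗ[F] I.toLieSubalgebra :=
    { toFun := fun y => ⟨y - s y, hsI y⟩
      map_add' := fun y z => Subtype.ext (by simp; abel)
      map_smul' := fun c y => Subtype.ext (by simp [smul_sub]) }
  let lm : I.toLieSubalgebra →ₗ[F] Module.End F A :=
    LinearMap.mul F A ∘ₗ (ι F p I.toLieSubalgebra : I.toLieSubalgebra →ₗ[F] A)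
  have hlm : ∀ a, lm a = LinearMap.mulLeft F (ι F p _ a) := fun a => rfl
  let ρ₀ : L →ₗ[F] Module.End F A := lm ∘ₗ pr + adDer I hI ∘ₗ s
  have hρ₀ : ∀ y, ρ₀ y = lm (pr y) + adDer I hI (s y) := fun y => rfl
  -- on `A e` the action does not depend on the decomposition
  have hindep : ∀ t ∈ T'.toLieSubalgebra, ∀ a : I.toLieSubalgebra,
      ρ₀ (t + a) * R = (adDer I hI t + lm a) * R := by
    intro t ht a
    have hd : s (t + a) - t ∈ I.toLieSubalgebra := by
      have h := sub_mem a.2 (hsI (t + a))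
      rwa [add_comm t, add_sub_assoc, sub_add_eq_sub_sub, sub_self, zero_sub, neg_sub,
        add_comm (a : L)] at h
    have hdT : (⟨_, hd⟩ : I.toLieSubalgebra) ∈ T.toLieSubalgebra :=
      (hTT' _).2 (sub_mem (hsT _) ht)
    have h1 : (lm ⟨_, hd⟩ - adDer I hI (s (t + a) - t)) * R = 0 := by
      have h2 : adDer I hI (s (t + a) - t) = _ := adDer_coe I hI ⟨_, hd⟩
      rw [h2, hlm, sub_sub_cancel]
      ext q
      simp only [Module.End.mul_apply, LinearMap.mulRight_apply, R, mul_assoc]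
      have h3 : e * ι F p I.toLieSubalgebra ⟨_, hd⟩ = 0 := by
        rw [← (he.commute_of_lie_eq_zero fun t' ht' => ?_).eq, he.ι_mul _ hdT]
        exact Subtype.ext (hT'.1 _ (sub_mem (hsT _) ht) _ ((hTT' t').1 ht'))
      rw [h3, mul_zero, LinearMap.zero_apply]
    have h2 : a = pr (t + a) + ⟨_, hd⟩ := Subtype.ext (by simp [pr])
    have h3 : adDer I hI (s (t + a)) = adDer I hI t + adDer I hI (s (t + a) - t) := by
      rw [← map_add, add_sub_cancel]
    rw [hρ₀, h3]
    conv_rhs => rw [h2, map_add]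
    rw [sub_mul, sub_eq_zero] at h1
    rw [add_mul, add_mul, add_mul, add_mul, h1]
    abel
  have hdecomp : ∀ y, ∃ t ∈ T'.toLieSubalgebra, ∃ a : I.toLieSubalgebra, y = t + a := fun y =>
    ⟨s y, hsT y, pr y, by simp [pr]⟩
  have hcommR : ∀ t ∈ T'.toLieSubalgebra, ∀ a, R * (adDer I hI t + lm a) =
      (adDer I hI t + lm a) * R := by
    intro t ht a
    ext q
    simp only [Module.End.mul_apply, LinearMap.add_apply, hlm, LinearMap.mulLeft_apply, R,
      LinearMap.mulRight_apply, isLeibniz_adDer I hI t q e, hDe t ht, mul_zero, add_zero, add_mul,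
      mul_assoc]
  have hcomm_lm : ∀ t ∈ T'.toLieSubalgebra, ∀ a, adDer I hI t * lm a - lm a * adDer I hI t =
      lm ⟨⁅t, (a : L)⁆, hI _ _⟩ := by
    intro t ht a
    rw [hlm, (isLeibniz_adDer I hI t).commutator_mulLeft, adDer_ι, hlm]
  have hlm_lie : ∀ a b, lm a * lm b - lm b * lm a = lm ⁅a, b⁆ := by
    intro a b
    rw [hlm, hlm, hlm, LieHom.map_lie, Ring.lie_def]
    ext q
    simp [sub_mul, mul_assoc]
  let ρ : L →ₗ⁅F⁆ Module.End F A :=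
    { toLinearMap := LinearMap.mulRight F R ∘ₗ ρ₀
      map_lie' := by
        intro y z
        change ρ₀ ⁅y, z⁆ * R = ⁅ρ₀ y * R, ρ₀ z * R⁆
        obtain ⟨t, ht, a, rfl⟩ := hdecomp y
        obtain ⟨t', ht', a', rfl⟩ := hdecomp z
        have h1 : ∃ b : I.toLieSubalgebra, ⁅t + (a : L), t' + (a' : L)⁆ = 0 + (b : L) ∧
            b = ⟨⁅t, (a' : L)⁆, hI _ _⟩ - ⟨⁅t', (a : L)⁆, hI _ _⟩ + ⁅a, a'⁆ := by
          refine ⟨_, ?_, rfl⟩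
          rw [add_lie, lie_add, lie_add, hT'.1 t ht t' ht', ← lie_skew (a : L) t']
          change _ = 0 + (⁅t, (a' : L)⁆ - ⁅t', (a : L)⁆ + ⁅(a : L), (a' : L)⁆)
          abel
        obtain ⟨b, hb, hb'⟩ := h1
        rw [hb, hindep 0 (zero_mem _), hindep t ht, hindep t' ht', Ring.lie_def]
        have h2 : ∀ X Y : Module.End F A, R * Y = Y * R → X * R * (Y * R) = X * Y * R := by
          intro X Y hXY
          rw [mul_assoc, ← mul_assoc R, hXY, mul_assoc, hRR, mul_assoc]
        rw [h2 _ _ (hcommR t' ht' a'), h2 _ _ (hcommR t ht a), ← sub_mul, hb', map_zero, zero_add,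
          map_add, map_sub, ← hcomm_lm t ht, ← hcomm_lm t' ht', ← hlm_lie]
        have h3 : adDer I hI t * adDer I hI t' - adDer I hI t' * adDer I hI t = 0 := by
          rw [← adDer_lie, hT'.1 t ht t' ht', map_zero]
        congr 1
        rw [← sub_eq_zero, ← neg_zero, ← h3]
        noncomm_ring }
  have hρ : ∀ t ∈ T'.toLieSubalgebra, ∀ a : I.toLieSubalgebra,
      ρ (t + a) = (adDer I hI t + lm a) * R := hindep
  have hρT : ∀ t ∈ T'.toLieSubalgebra, ρ t = adDer I hI t * R := fun t ht => by
    simpa using hρ t ht 0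
  have hρI : ∀ a : I.toLieSubalgebra, ρ a = lm a * R := fun a => by
    simpa using hρ 0 (zero_mem _) a
  have hpow : ∀ X : Module.End F A, R * X = X * R → (X * R) ^ p = X ^ p * R := by
    intro X hX
    rw [(show Commute X R from hX.symm).mul_pow, (show IsIdempotentElem R from hRR).pow_eq
      hp.out.ne_zero]
  have hρp : ∀ y, ρ y ^ p = ρ (pMap F p y) := by
    refine pow_eq_map_pMap_of_span ρ
      (s := (T'.toLieSubalgebra : Set L) ∪ I.toLieSubalgebra) ?_ ?_
    · rw [eq_top_iff]
      intro y _
      obtain ⟨t, ht, a, rfl⟩ := hdecomp y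
      exact add_mem (Submodule.subset_span (Or.inl ht)) (Submodule.subset_span (Or.inr a.2))
    · rintro y (hy | hy)
      · rw [hρT y hy, hρT _ (T'.pMap_mem y hy), hpow _ (by simpa using hcommR y hy 0), adDer_pow]
      · have h1 := hρI ⟨y, hy⟩
        have h2 := hρI ⟨pMap F p y, I.pMap_mem y hy⟩
        simp only at h1 h2
        rw [h1, h2, hpow _ (by simpa using hcommR 0 (zero_mem _) ⟨y, hy⟩), hlm, hlm,
          LinearMap.pow_mulLeft]
        congr 2
        exact ι_pow F p I.toLieSubalgebra ⟨y, hy⟩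
  let φ : RestrictedEnvelopingAlgebra F p L →ₐ[F] Module.End F A := lift ρ hρp
  have hφI : ∀ a q, q * e = q → φ (inclusion I a) q = a * q := by
    intro a
    induction a using induction_on with
    | hι a =>
      intro q hq
      rw [inclusion_ι]
      simp only [φ, lift_ι, hρI, Module.End.mul_apply, R, LinearMap.mulRight_apply, hq, hlm,
        LinearMap.mulLeft_apply]
    | hF c =>
      intro q _
      rw [AlgHom.commutes, AlgHom.commutes, Module.algebraMap_end_apply, Algebra.smul_def]
    | hadd a b ha hb =>
      intro q hq
      rw [map_add, map_add, LinearMap.add_apply, ha q hq, hb q hq, add_mul]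
    | hmul a b ha hb =>
      intro q hq
      rw [map_mul, map_mul, Module.End.mul_apply, hb q hq, ha _ (by rw [mul_assoc, hq]), mul_assoc]
  have hφe : φ e' e = e := by
    have key : ∀ c ∈ Algebra.adjoin F (ι F p L '' T'.toLieSubalgebra),
        φ c e = augmentation F p L c • e := by
      intro c hc
      induction hc using Algebra.adjoin_induction with
      | mem c hc =>
        obtain ⟨t, ht, rfl⟩ := hc
        simp only [φ, lift_ι, hρT t ht, Module.End.mul_apply, R, LinearMap.mulRight_apply,
          he.mul_self, hDe t ht, augmentation_ι, zero_smul]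
      | algebraMap r =>
        rw [AlgHom.commutes, AlgHom.commutes, Module.algebraMap_end_apply]; rfl
      | add a b _ _ ha hb => rw [map_add, LinearMap.add_apply, ha, hb, map_add, add_smul]
      | mul a b _ _ ha hb =>
        rw [map_mul, Module.End.mul_apply, hb, map_smul, ha, smul_smul, map_mul, mul_comm]
    rw [key e' he'.mem_adjoin, he'.augmentation_eq, one_smul]
  let g : RestrictedEnvelopingAlgebra F p L →ₗ[F] A :=
    LinearMap.applyₗ e ∘ₗ φ.toLinearMap
  have hg : ∀ a, g a = φ a e := fun a => rfl
  refine le_trans (Submodule.finrank_mono ?_) (finrank_range_le_of_map_mul (e := e') g fun a => ?_)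
  · rintro _ ⟨a, rfl⟩
    exact ⟨inclusion I a, by rw [hg, hφI a e he.mul_self]; rfl⟩
  · rw [hg, hg, map_mul, Module.End.mul_apply, hφe]

end LowerBound

end RestrictedEnvelopingAlgebra

namespace RestrictedEnvelopingAlgebra

section CodimensionOne

variable {F : Type u} {p : ℕ} {L : Type v} [Field F] [hp : Fact p.Prime] [CharP F p] [LieRing L]
  [LieAlgebra F L] [RestrictedLieAlgebra F p L]

/-- If `L = I ⊕ F x`, a representation of `u(I)` extends to `u(L)` as soon as an operator `X` is
given that satisfies the relations imposed on `x`. -/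
theorem exists_algHom_of_codim_one (I : PSubalgebra F p L)
    (hI : ∀ x y : L, ⁅x, y⁆ ∈ I.toLieSubalgebra) {x : L} (hx : x ∉ I.toLieSubalgebra)
    (hxp : pMap F p x ∈ I.toLieSubalgebra)
    (hspan : ∀ y : L, ∃ c : F, y - c • x ∈ I.toLieSubalgebra) {B : Type*} [Ring B] [Algebra F B]
    (φ : RestrictedEnvelopingAlgebra F p I.toLieSubalgebra →ₐ[F] B) (X : B)
    (hX : ∀ a : I.toLieSubalgebra, X * φ (ι F p _ a) - φ (ι F p _ a) * X =
      φ (ι F p _ ⟨⁅x, (a : L)⁆, hI _ _⟩))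
    (hXp : X ^ p = φ (ι F p _ ⟨pMap F p x, hxp⟩)) :
    ∃ ψ : RestrictedEnvelopingAlgebra F p L →ₐ[F] B, ψ (ι F p L x) = X ∧
      ∀ a, ψ (inclusion I a) = φ a := by
  obtain ⟨f, hfx, hfI⟩ := Submodule.exists_le_ker_of_notMem (p := I.toLieSubalgebra.toSubmodule) hx
  obtain ⟨c, hcx, hcI⟩ : ∃ c : L →ₗ[F] F, c x = 1 ∧ ∀ a ∈ I.toLieSubalgebra, c a = 0 :=
    ⟨(f x)⁻¹ • f, by simp [hfx], fun a ha => by simp [show f a = 0 from hfI ha]⟩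
  have hmem : ∀ y, y - c y • x ∈ I.toLieSubalgebra := by
    intro y
    obtain ⟨d, hd⟩ := hspan y
    have := hcI _ hd
    rw [map_sub, map_smul, hcx, smul_eq_mul, mul_one, sub_eq_zero] at this
    rwa [this]
  let pr : L →ₗ[F] I.toLieSubalgebra :=
    { toFun := fun y => ⟨y - c y • x, hmem y⟩
      map_add' := fun y z => Subtype.ext (by
        change y + z - c (y + z) • x = (y - c y • x) + (z - c z • x)
        rw [map_add, add_smul]; abel)
      map_smul' := fun d y => Subtype.ext (by
        change d • y - c (d • y) • x = d • (y - c y • x)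
        rw [map_smul, smul_sub, smul_assoc]) }
  let g : I.toLieSubalgebra →ₗ[F] B :=
    φ.toLinearMap ∘ₗ (ι F p I.toLieSubalgebra : I.toLieSubalgebra →ₗ[F] _)
  have hg : ∀ a, g a = φ (ι F p _ a) := fun _ => rfl
  have hglie : ∀ a b, g ⁅a, b⁆ = g a * g b - g b * g a := fun a b => by
    rw [hg, LieHom.map_lie, Ring.lie_def, map_sub, map_mul, map_mul, hg, hg]
  let ρ₀ : L →ₗ[F] B := g ∘ₗ pr + c.smulRight X
  have hρ₀ : ∀ y, ρ₀ y = g (pr y) + c y • X := fun _ => rfl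
  have hdecomp : ∀ y, ∃ (a : I.toLieSubalgebra) (d : F), y = a + d • x := fun y =>
    ⟨pr y, c y, by simp [pr]⟩
  have hρ : ∀ (a : I.toLieSubalgebra) (d : F), ρ₀ (a + d • x) = g a + d • X := by
    intro a d
    have h1 : c (a + d • x) = d := by rw [map_add, hcI a a.2, map_smul, hcx]; simp
    have h2 : pr (a + d • x) = a := Subtype.ext (by
      change (a : L) + d • x - c (a + d • x) • x = a
      rw [h1, add_sub_cancel_right])
    rw [hρ₀, h1, h2]
  have hρI : ∀ a : I.toLieSubalgebra, ρ₀ a = g a := fun a => by simpa using hρ a 0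
  have hρx : ρ₀ x = X := by simpa using hρ 0 1
  let ρ : L →ₗ⁅F⁆ B :=
    { toLinearMap := ρ₀
      map_lie' := by
        intro y z
        change ρ₀ ⁅y, z⁆ = ⁅ρ₀ y, ρ₀ z⁆
        obtain ⟨a, d, rfl⟩ := hdecomp y
        obtain ⟨b, d', rfl⟩ := hdecomp z
        have h1 : ⁅(a : L) + d • x, (b : L) + d' • x⁆ = ((⁅a, b⁆ + d • ⟨⁅x, (b : L)⁆, hI _ _⟩ -
            d' • ⟨⁅x, (a : L)⁆, hI _ _⟩ : I.toLieSubalgebra) : L) := by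
          change _ = ⁅(a : L), (b : L)⁆ + d • ⁅x, (b : L)⁆ - d' • ⁅x, (a : L)⁆
          rw [add_lie, lie_add, lie_add, lie_smul, smul_lie, smul_lie, lie_smul, lie_self,
            ← lie_skew (a : L) x, smul_zero, smul_zero, add_zero, smul_neg]
          abel
        rw [h1, hρI, hρ, hρ, map_sub, map_add, map_smul, map_smul, hglie,
          hg ⟨⁅x, (a : L)⁆, _⟩, hg ⟨⁅x, (b : L)⁆, _⟩, ← hX, ← hX, Ring.lie_def, ← hg, ← hg]
        simp only [mul_add, add_mul, smul_mul_assoc, mul_smul_comm, smul_add, smul_sub, smul_smul,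
          mul_comm d' d]
        abel }
  have hρp : ∀ y, ρ y ^ p = ρ (pMap F p y) := by
    refine pow_eq_map_pMap_of_span ρ (s := insert x (I.toLieSubalgebra : Set L)) ?_ ?_
    · rw [eq_top_iff]
      intro y _
      obtain ⟨a, d, rfl⟩ := hdecomp y
      exact add_mem (Submodule.subset_span (Or.inr a.2))
        (Submodule.smul_mem _ _ (Submodule.subset_span (Or.inl rfl)))
    · rintro y (rfl | hy)
      · change ρ₀ y ^ p = ρ₀ ((⟨pMap F p y, hxp⟩ : I.toLieSubalgebra) : L)
        rw [hρx, hρI, hXp, hg]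
      · change ρ₀ ((⟨y, hy⟩ : I.toLieSubalgebra) : L) ^ p =
          ρ₀ ((pMap F p (⟨y, hy⟩ : I.toLieSubalgebra) : I.toLieSubalgebra) : L)
        rw [hρI, hρI, hg, hg, ← map_pow, ι_pow]
  refine ⟨lift ρ hρp, by rw [lift_ι]; exact hρx, fun a => ?_⟩
  have : (lift ρ hρp).comp (inclusion I) = φ := algHom_ext fun a => by
    rw [AlgHom.comp_apply, inclusion_ι, lift_ι]
    exact hρI a
  exact DFunLike.congr_fun this a

/-- The step for `L = I ⊕ F x` with `x^[p] = b ∈ I` and `x` centralising the torus `T` of `I`. With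
`A = u(I)`, let `L` act on the sequences in `A` with `f (n + p) = f n * b`: elements of `I` by left
multiplication, and `x` as the sum of the derivation extending `ad x` and the shift. The `p`-th
power of this operator is `(q ↦ b q - q b) + (q ↦ q b)`, the left multiplication by `b`. -/
theorem mul_finrank_le_of_codim_one [FiniteDimensional F L] (I : PSubalgebra F p L)
    (hI : ∀ x y : L, ⁅x, y⁆ ∈ I.toLieSubalgebra) {T : PSubalgebra F p I.toLieSubalgebra}
    {e : RestrictedEnvelopingAlgebra F p I.toLieSubalgebra} (he : IsTrivialIdempotent T e)
    {x : L} (hx : x ∉ I.toLieSubalgebra) (hxp : pMap F p x ∈ I.toLieSubalgebra)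
    (hspan : ∀ y : L, ∃ c : F, y - c • x ∈ I.toLieSubalgebra)
    (hxT : ∀ t : I.toLieSubalgebra, t ∈ T.toLieSubalgebra → ⁅x, (t : L)⁆ = 0) :
    p * Module.finrank F (LinearMap.range (LinearMap.mulRight F e)) ≤
      Module.finrank F (LinearMap.range (LinearMap.mulRight F (inclusion I e))) := by
  let A := RestrictedEnvelopingAlgebra F p I.toLieSubalgebra
  let β : A := ι F p _ ⟨pMap F p x, hxp⟩
  let D : Module.End F A := adDer I hI x
  have hD : IsLeibniz D := isLeibniz_adDer I hI x
  have hDβ : D β = 0 := by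
    change adDer I hI x (ι F p _ _) = 0
    rw [adDer_ι]
    have : (⟨⁅x, pMap F p x⁆, hI _ _⟩ : I.toLieSubalgebra) = 0 := Subtype.ext (by
      change ⁅x, pMap F p x⁆ = 0
      rw [← lie_skew, neg_eq_zero]
      exact lie_pMap_iterate_eq_zero (lie_self x) 1)
    rw [this, map_zero]
  have hDe : D e = 0 := he.map_isLeibniz hD fun t ht => by
    change adDer I hI x (ι F p _ _) = 0
    rw [adDer_ι]
    have : (⟨⁅x, (t : L)⁆, hI _ _⟩ : I.toLieSubalgebra) = 0 := Subtype.ext (hxT t ht)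
    rw [this, map_zero]
  have hDp : ∀ q, (D ^ p) q = β * q - q * β := by
    intro q
    change (adDer I hI x ^ p) q = _
    rw [adDer_pow]
    have := adDer_coe I hI ⟨pMap F p x, hxp⟩
    change adDer I hI (pMap F p x) = _ at this
    rw [this]
    rfl
  let V : Submodule A (ℕ → A) :=
    { carrier := {f | ∀ n, f (n + p) = f n * β}
      add_mem' := fun hf hg n => by simp [hf n, hg n, add_mul]
      zero_mem' := fun n => by simp
      smul_mem' := fun a f hf n => by simp [hf n, mul_assoc] }
  let φ : A →ₐ[F] Module.End F V := Algebra.lsmul F F V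
  have hφ : ∀ a (f : V) n, (φ a f : ℕ → A) n = a * (f : ℕ → A) n := fun _ _ _ => rfl
  let D' : Module.End F V :=
    { toFun := fun f => ⟨fun n => D ((f : ℕ → A) n), fun n => by
        change D ((f : ℕ → A) (n + p)) = D ((f : ℕ → A) n) * β
        rw [f.2 n, hD, hDβ, mul_zero, add_zero]⟩
      map_add' := fun f g => Subtype.ext (funext fun n => by simp)
      map_smul' := fun c f => Subtype.ext (funext fun n => map_smul D c _) }
  have hD' : ∀ (f : V) n, (D' f : ℕ → A) n = D ((f : ℕ → A) n) := fun _ _ => rfl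
  let σ : Module.End F V :=
    { toFun := fun f => ⟨fun n => (f : ℕ → A) (n + 1), fun n => by
        change (f : ℕ → A) (n + p + 1) = (f : ℕ → A) (n + 1) * β
        rw [add_right_comm, f.2]⟩
      map_add' := fun f g => rfl
      map_smul' := fun c f => rfl }
  have hσ : ∀ (f : V) n, (σ f : ℕ → A) n = (f : ℕ → A) (n + 1) := fun _ _ => rfl
  have hσk : ∀ k (f : V) n, ((σ ^ k) f : ℕ → A) n = (f : ℕ → A) (n + k) := by
    intro k
    induction k with
    | zero => exact fun _ _ => rfl
    | succ k ih => intro f n; rw [pow_succ, Module.End.mul_apply, ih, hσ, add_assoc]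
  have hD'k : ∀ k (f : V) n, ((D' ^ k) f : ℕ → A) n = (D ^ k) ((f : ℕ → A) n) := by
    intro k
    induction k with
    | zero => exact fun _ _ => rfl
    | succ k ih =>
      intro f n
      rw [pow_succ, Module.End.mul_apply, ih, hD', pow_succ, Module.End.mul_apply]
  have hcomm : Commute D' σ := rfl
  -- the generator: a copy of `e` in the last of the first `p` places
  let v : V := ⟨fun n => if p ∣ n + 1 then e * β ^ ((n + 1) / p - 1) else 0, fun n => by
    have h1 : p ∣ n + p + 1 ↔ p ∣ n + 1 := by
      rw [add_right_comm]; exact Nat.dvd_add_self_right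
    simp only [h1]
    split_ifs with h
    · have h2 : 1 ≤ (n + 1) / p := (Nat.one_le_div_iff hp.out.pos).2 (Nat.le_of_dvd (by omega) h)
      rw [add_right_comm, Nat.add_div_right _ hp.out.pos, mul_assoc, ← pow_succ]
      congr 2
      omega
    · simp⟩
  have hv : ∀ n, (v : ℕ → A) n = if p ∣ n + 1 then e * β ^ ((n + 1) / p - 1) else 0 :=
    fun _ => rfl
  have hDβk : ∀ k, D (β ^ k) = 0 := by
    intro k
    induction k with
    | zero => rw [pow_zero, hD.map_one]
    | succ k ih => rw [pow_succ, hD, ih, hDβ, zero_mul, mul_zero, add_zero]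
  have hD'v : D' v = 0 := by
    refine Subtype.ext (funext fun n => ?_)
    rw [hD', hv]
    split_ifs
    · rw [hD, hDe, hDβk, zero_mul, mul_zero, add_zero]; rfl
    · rw [map_zero]; rfl
  obtain ⟨ψ, hψx, hψI⟩ := exists_algHom_of_codim_one I hI hx hxp hspan φ (D' + σ)
    (fun a => by
      refine LinearMap.ext fun f => Subtype.ext (funext fun n => ?_)
      change D (ι F p _ a * (f : ℕ → A) n) + ι F p _ a * (f : ℕ → A) (n + 1) -
        ι F p _ a * (D ((f : ℕ → A) n) + (f : ℕ → A) (n + 1)) = ι F p _ _ * (f : ℕ → A) n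
      rw [hD, show D (ι F p _ a) = _ from adDer_ι I hI x a, mul_add]
      abel)
    (by
      have h1 : (D' + σ) ^ p = D' ^ p + σ ^ p := by
        rcases subsingleton_or_nontrivial (Module.End F V) with hs | hs
        · exact Subsingleton.elim _ _
        · have : CharP (Module.End F V) p :=
            charP_of_injective_algebraMap (algebraMap F _).injective p
          exact add_pow_char_of_commute p hcomm
      rw [h1]
      refine LinearMap.ext fun f => Subtype.ext (funext fun n => ?_)
      change ((D' ^ p) f : ℕ → A) n + ((σ ^ p) f : ℕ → A) n = β * (f : ℕ → A) n
      rw [hD'k, hσk, hDp, f.2 n, sub_add_cancel])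
  have hψxk : ∀ k, ψ (ι F p L x ^ k) v = (σ ^ k) v := by
    intro k
    induction k with
    | zero => rw [pow_zero, map_one, pow_zero]
    | succ k ih =>
      rw [pow_succ', map_mul, Module.End.mul_apply, ih, hψx, LinearMap.add_apply,
        ← Module.End.mul_apply D', (hcomm.pow_right k).eq, Module.End.mul_apply, hD'v, map_zero,
        zero_add, pow_succ', Module.End.mul_apply]
  have hψe : ψ (inclusion I e) v = v := by
    rw [hψI]
    refine Subtype.ext (funext fun n => ?_)
    rw [hφ, hv]
    split_ifs
    · rw [← mul_assoc, he.mul_self]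
    · rw [mul_zero]
  let g : RestrictedEnvelopingAlgebra F p L →ₗ[F] (Fin p → A) :=
    { toFun := fun a i => (ψ a v : ℕ → A) i
      map_add' := fun a b => by ext i; simp
      map_smul' := fun c a => by ext i; simp }
  have hg : ∀ a i, g a i = (ψ a v : ℕ → A) i := fun _ _ => rfl
  have hle := finrank_range_le_of_map_mul (e := inclusion I e) g fun a => by
    ext i
    rw [hg, hg, map_mul, Module.End.mul_apply, hψe]
  let W := LinearMap.range (LinearMap.mulRight F e)
  let h : (Fin p → W) →ₗ[F] (Fin p → A) := W.subtype.compLeft (Fin p)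
  have hinj : Function.Injective h := fun f f' hff' => by
    ext i
    exact congrFun hff' i
  have hdim : Module.finrank F (LinearMap.range h) = p * Module.finrank F W := by
    rw [LinearMap.finrank_range_of_inj hinj, Module.finrank_pi_fintype]
    simp
  rw [← hdim]
  refine (Submodule.finrank_mono ?_).trans hle
  rintro _ ⟨f, rfl⟩
  have hf : ∀ i, ∃ a, a * e = (f i : A) := fun i => (f i).2
  choose a ha using hf
  refine ⟨∑ j, inclusion I (a j) * ι F p L x ^ (p - 1 - (j : ℕ)), ?_⟩
  ext i
  have hterm : ∀ j : Fin p, g (inclusion I (a j) * ι F p L x ^ (p - 1 - (j : ℕ))) i =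
      if i = j then (f j : A) else 0 := by
    intro j
    rw [hg, map_mul, Module.End.mul_apply, hψxk, hψI, hφ, hσk, hv]
    have hi := i.2
    have hj := j.2
    split_ifs with h1 h2 h2
    · subst h2
      have h3 : ((i : ℕ) + (p - 1 - i) + 1) = p := by omega
      rw [h3, Nat.div_self hp.out.pos, Nat.sub_self, pow_zero, mul_one, ha]
    · exfalso
      obtain ⟨k, hk⟩ := h1
      have h3 : k ≠ 0 := by rintro rfl; omega
      have h4 : k < 2 := by
        by_contra! h5
        have := Nat.mul_le_mul_left p h5
        omega
      have h5 : k = 1 := by omega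
      subst h5
      exact h2 (Fin.ext (by omega))
    · subst h2
      exact absurd ⟨1, by omega⟩ h1
    · rw [mul_zero]
  rw [map_sum, Finset.sum_apply]
  simp only [hterm]
  simp [h, W]

end CodimensionOne

end RestrictedEnvelopingAlgebra

/-! ### Induction along `p`-subalgebras containing the derived algebra -/

section Induction

variable {F : Type u} {p : ℕ} {L : Type v} [Field F] [hp : Fact p.Prime] [LieRing L]
  [LieAlgebra F L] [RestrictedLieAlgebra F p L]

theorem lie_pMap_iterate_mem {N : LieIdeal F L} {w y : L} (h : ⁅w, y⁆ ∈ N) (n : ℕ) :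
    ⁅(pMap F p)^[n] w, y⁆ ∈ N := by
  induction n with
  | zero => exact h
  | succ n ih =>
    have h1 : ∀ k, ∀ z ∈ N, (LieAlgebra.ad F L ((pMap F p)^[n] w) ^ k) z ∈ N := by
      intro k
      induction k with
      | zero => exact fun z hz => hz
      | succ k ihk =>
        intro z hz
        rw [pow_succ, Module.End.mul_apply]
        exact ihk _ (lie_mem_right F L N _ _ hz)
    rw [Function.iterate_succ_apply', ← LieAlgebra.ad_apply F, ad_pMap,
      ← pow_sub_one_mul hp.out.ne_zero, Module.End.mul_apply]
    exact h1 _ _ ih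

/-- The `p`-subalgebra with a given underlying subspace containing the derived algebra. -/
def PSubalgebra.ofSubmodule (N : Submodule F L) (hbr : ∀ x y : L, ⁅x, y⁆ ∈ N)
    (hN : ∀ x ∈ N, pMap F p x ∈ N) : PSubalgebra F p L :=
  { N with
    lie_mem' := fun _ _ => hbr _ _
    pMap_mem := hN }

/-- A nonzero solvable restricted Lie algebra has a proper `p`-subalgebra containing the derived
algebra, namely the `p`-closure of the derived algebra: if that were all of `L`, the derived
algebra would be perfect. -/
theorem exists_pSubalgebra_lt_top [Nontrivial L] [LieAlgebra.IsSolvable L] :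
    ∃ I : PSubalgebra F p L, (∀ x y : L, ⁅x, y⁆ ∈ I.toLieSubalgebra) ∧
      I.toLieSubalgebra.toSubmodule ≠ ⊤ := by
  let D := LieAlgebra.derivedSeries F L
  have hDsucc : ∀ k, D (k + 1) = ⁅D k, D k⁆ := fun k =>
    LieAlgebra.derivedSeriesOfIdeal_succ F L ⊤ k
  have hD1 : ∀ x y : L, ⁅x, y⁆ ∈ D 1 := fun x y => by
    rw [hDsucc 0]
    exact LieSubmodule.lie_mem_lie (LieSubmodule.mem_top x) (LieSubmodule.mem_top y)
  set s : Set L := {z | ∃ n : ℕ, ∃ y ∈ D 1, z = (pMap F p)^[n] y} with hs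
  have hD1s : ∀ x ∈ D 1, x ∈ Submodule.span F s := fun x hx =>
    Submodule.subset_span ⟨0, x, hx, rfl⟩
  have hpm : ∀ x ∈ Submodule.span F s, pMap F p x ∈ Submodule.span F s := by
    intro x hx
    refine pMap_mem_of_mem_span (fun a _ b _ => ⟨hD1s _ (hD1 a b), hD1s _ (hD1 a b)⟩) ?_ hx
    rintro _ ⟨n, y, hy, rfl⟩
    exact Submodule.subset_span ⟨n + 1, y, hy, (Function.iterate_succ_apply' _ _ _).symm⟩
  refine ⟨PSubalgebra.ofSubmodule (Submodule.span F s) (fun x y => hD1s _ (hD1 x y)) hpm,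
    fun x y => hD1s _ (hD1 x y), fun htop => ?_⟩
  replace htop : Submodule.span F s = ⊤ := htop
  have hD2 : ∀ x y : L, ⁅x, y⁆ ∈ D 2 := by
    intro x y
    have hx : x ∈ Submodule.span F s := htop ▸ Submodule.mem_top
    have hy : y ∈ Submodule.span F s := htop ▸ Submodule.mem_top
    induction hx, hy using Submodule.span_induction₂ with
    | mem_mem x y hx hy =>
      obtain ⟨n, x, hx, rfl⟩ := hx
      obtain ⟨m, y, hy, rfl⟩ := hy
      have h1 : ⁅x, y⁆ ∈ D 2 := by rw [hDsucc 1]; exact LieSubmodule.lie_mem_lie hx hy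
      have h2 : ⁅y, (pMap F p)^[n] x⁆ ∈ D 2 := by
        rw [← lie_skew]
        exact neg_mem (lie_pMap_iterate_mem h1 n)
      rw [← lie_skew]
      exact neg_mem (lie_pMap_iterate_mem h2 m)
    | zero_left => simp
    | zero_right => simp
    | add_left x y z _ _ _ h h' => rw [add_lie]; exact add_mem h h'
    | add_right x y z _ _ _ h h' => rw [lie_add]; exact add_mem h h'
    | smul_left c x y _ _ h => rw [smul_lie]; exact (D 2).smul_mem c h
    | smul_right c x y _ _ h => rw [lie_smul]; exact (D 2).smul_mem c h
  have h12 : D 1 = D 2 := by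
    refine le_antisymm ?_ (LieAlgebra.derivedSeriesOfIdeal_succ_le ⊤ 1)
    rw [hDsucc 0, LieSubmodule.lie_le_iff]
    exact fun x _ y _ => hD2 x y
  have hstab : ∀ k, D 1 = D (k + 1) := by
    intro k
    induction k with
    | zero => rfl
    | succ k ih =>
      rw [hDsucc (k + 1), ← ih]
      exact h12.trans (hDsucc 1)
  obtain ⟨k, hk⟩ := LieAlgebra.IsSolvable.solvable (R := F) (L := L)
  have hD1bot : D 1 = ⊥ := by
    rw [hstab k, eq_bot_iff, ← hk]
    exact LieAlgebra.derivedSeriesOfIdeal_succ_le ⊤ k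
  have hs0 : Submodule.span F s = ⊥ := by
    rw [Submodule.span_eq_bot]
    rintro _ ⟨n, y, hy, rfl⟩
    rw [hD1bot, LieSubmodule.mem_bot] at hy
    rw [hy]
    exact Function.iterate_fixed (pMap_zero F p L) n
  rw [hs0] at htop
  exact bot_ne_top htop

/-- For a maximal proper `p`-subalgebra `I` containing the derived algebra, the algebra `L / I` is
either one-dimensional with zero `[p]`-map or a torus. -/
theorem exists_maximal_pSubalgebra [FiniteDimensional F L] [Nontrivial L]
    [LieAlgebra.IsSolvable L] :
    ∃ I : PSubalgebra F p L, (∀ x y : L, ⁅x, y⁆ ∈ I.toLieSubalgebra) ∧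
      Module.finrank F I.toLieSubalgebra < Module.finrank F L ∧
      ((∃ x ∉ I.toLieSubalgebra, pMap F p x ∈ I.toLieSubalgebra ∧
        ∀ y : L, ∃ c : F, y - c • x ∈ I.toLieSubalgebra) ∨
      ∀ y : L, y ∈ I.toLieSubalgebra.toSubmodule ⊔
        Submodule.span F {z | ∃ n : ℕ, 1 ≤ n ∧ z = (pMap F p)^[n] y}) := by
  let P : Set (Submodule F L) := {N | (∀ x y : L, ⁅x, y⁆ ∈ N) ∧ (∀ x ∈ N, pMap F p x ∈ N) ∧ N ≠ ⊤}
  obtain ⟨I₀, hI₀, hI₀top⟩ := exists_pSubalgebra_lt_top (F := F) (p := p) (L := L)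
  obtain ⟨N, ⟨hbr, hpm, htop⟩, hmax⟩ := (wellFounded_gt (α := Submodule F L)).has_min P
    ⟨_, hI₀, I₀.pMap_mem, hI₀top⟩
  have hmax' : ∀ N', N < N' → (∀ x ∈ N', pMap F p x ∈ N') → N' = ⊤ := by
    intro N' hlt hN'
    by_contra hne
    exact hmax N' ⟨fun x y => hlt.le (hbr x y), hN', hne⟩ hlt
  have hclosed : ∀ s : Set L, (∀ x ∈ s, pMap F p x ∈ N ⊔ Submodule.span F s) →
      ∀ x ∈ N ⊔ Submodule.span F s, pMap F p x ∈ N ⊔ Submodule.span F s := by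
    intro s hs x hx
    have hNs : N ⊔ Submodule.span F s = Submodule.span F ((N : Set L) ∪ s) := by
      rw [Submodule.span_union, Submodule.span_eq]
    rw [hNs] at hx
    refine pMap_mem_of_mem_span (fun a _ b _ => ⟨Submodule.mem_sup_left (hbr a b), ?_⟩) ?_ hx
    · rw [← hNs]; exact Submodule.mem_sup_left (hbr a b)
    · rintro y (hy | hy)
      · exact Submodule.mem_sup_left (hpm y hy)
      · exact hs y hy
  refine ⟨PSubalgebra.ofSubmodule N hbr hpm, hbr, Submodule.finrank_lt htop, ?_⟩
  change (∃ x ∉ N, pMap F p x ∈ N ∧ ∀ y : L, ∃ c : F, y - c • x ∈ N) ∨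
    ∀ y : L, y ∈ N ⊔ Submodule.span F {z | ∃ n : ℕ, 1 ≤ n ∧ z = (pMap F p)^[n] y}
  by_cases hcase : ∃ x ∉ N, pMap F p x ∈ N
  · left
    obtain ⟨x, hx, hxp⟩ := hcase
    refine ⟨x, hx, hxp, fun y => ?_⟩
    have h1 : N ⊔ Submodule.span F {x} = ⊤ := by
      refine hmax' _ ?_ (hclosed _ ?_)
      · refine lt_of_le_of_ne le_sup_left fun h => hx ?_
        rw [h]
        exact Submodule.mem_sup_right (Submodule.mem_span_singleton_self x)
      · rintro _ rfl
        exact Submodule.mem_sup_left hxp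
    have h2 : y ∈ N ⊔ Submodule.span F {x} := h1 ▸ Submodule.mem_top
    obtain ⟨a, ha, b, hb, rfl⟩ := Submodule.mem_sup.1 h2
    obtain ⟨c, rfl⟩ := Submodule.mem_span_singleton.1 hb
    exact ⟨c, by rwa [add_sub_cancel_right]⟩
  · right
    push Not at hcase
    intro y
    by_cases hy : y ∈ N
    · exact Submodule.mem_sup_left hy
    · have h1 : N ⊔ Submodule.span F {z | ∃ n : ℕ, 1 ≤ n ∧ z = (pMap F p)^[n] y} = ⊤ := by
        refine hmax' _ ?_ (hclosed _ ?_)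
        · refine lt_of_le_of_ne le_sup_left fun h => hcase y hy ?_
          rw [h]
          exact Submodule.mem_sup_right (Submodule.subset_span ⟨1, le_rfl, rfl⟩)
        · rintro _ ⟨n, hn, rfl⟩
          refine Submodule.mem_sup_right (Submodule.subset_span ⟨n + 1, by omega, ?_⟩)
          rw [Function.iterate_succ_apply']
      exact h1 ▸ Submodule.mem_top

end Induction

namespace RestrictedEnvelopingAlgebra

section Induction

variable {F : Type u} {p : ℕ} [Field F] [hp : Fact p.Prime] {L : Type v} [LieRing L]
  [LieAlgebra F L] [RestrictedLieAlgebra F p L] [FiniteDimensional F L]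

omit [FiniteDimensional F L] in
theorem IsLocalIdempotent.exists_mul_mul_mul_eq {e e' : RestrictedEnvelopingAlgebra F p L}
    (hloc : IsLocalIdempotent e) (he : e * e = e) (he1 : augmentation F p L e = 1)
    (he'1 : augmentation F p L e' = 1) : ∃ c, c * (e * e' * e) = e :=
  hloc _ (by rw [mul_assoc, he]) (by rw [map_mul, map_mul, he1, he'1]; simp)

theorem IsLocalIdempotent.finrank_le {e e' : RestrictedEnvelopingAlgebra F p L}
    (hloc : IsLocalIdempotent e) (he : e * e = e) (he1 : augmentation F p L e = 1)
    (he'1 : augmentation F p L e' = 1) :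
    Module.finrank F (LinearMap.range (LinearMap.mulRight F e)) ≤
      Module.finrank F (LinearMap.range (LinearMap.mulRight F e')) := by
  obtain ⟨c, hc⟩ := hloc.exists_mul_mul_mul_eq he he1 he'1
  have h : LinearMap.range (LinearMap.mulRight F e) ≤
      (LinearMap.range (LinearMap.mulRight F e')).map (LinearMap.mulRight F e) := by
    rintro _ ⟨a, rfl⟩
    refine ⟨a * c * e * e', ⟨a * c * e, rfl⟩, ?_⟩
    rw [LinearMap.mulRight_apply, LinearMap.mulRight_apply]
    conv_rhs => rw [← hc]
    simp only [mul_assoc]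
  exact (Submodule.finrank_mono h).trans (Submodule.finrank_map_le _ _)

/-- A torus whose idempotent is local, with `dim u(L) e` as large as possible, has maximal
dimension. -/
theorem IsLocalIdempotent.finrank_torus_le {T T' : PSubalgebra F p L}
    {e : RestrictedEnvelopingAlgebra F p L} (he : IsTrivialIdempotent T e)
    (hloc : IsLocalIdempotent e)
    (hdim : p ^ (Module.finrank F L - Module.finrank F T.toLieSubalgebra) ≤
      Module.finrank F (LinearMap.range (LinearMap.mulRight F e)))
    (hT' : T'.IsTorus) :
    Module.finrank F T'.toLieSubalgebra ≤ Module.finrank F T.toLieSubalgebra := by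
  obtain ⟨e', he'⟩ := exists_isTrivialIdempotent hT'
  have h1 := hloc.finrank_le he.mul_self he.augmentation_eq he'.augmentation_eq
  have h2 := (finite_and_finrank_range_mulRight_le T'.toLieSubalgebra.toSubmodule e' he'.ι_mul).2
  have h3 := (Nat.pow_le_pow_iff_right hp.out.one_lt).1 (hdim.trans (h1.trans h2))
  have h4 : Module.finrank F T'.toLieSubalgebra ≤ Module.finrank F L :=
    Submodule.finrank_le T'.toLieSubalgebra.toSubmodule
  have h5 : Module.finrank F T'.toLieSubalgebra.toSubmodule =
    Module.finrank F T'.toLieSubalgebra := rfl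
  omega

/-- A torus that is maximal among the tori containing a given one. -/
theorem exists_maximal_torus {T : PSubalgebra F p L} (hT : T.IsTorus) :
    ∃ T' : PSubalgebra F p L, T'.IsTorus ∧ T.toLieSubalgebra ≤ T'.toLieSubalgebra ∧
      ∀ z, IsPSemisimple F p z → (∀ t ∈ T'.toLieSubalgebra, ⁅z, t⁆ = 0) →
        z ∈ T'.toLieSubalgebra := by
  let P : Set (Submodule F L) := {N | ∃ T' : PSubalgebra F p L, T'.IsTorus ∧
    T.toLieSubalgebra ≤ T'.toLieSubalgebra ∧ T'.toLieSubalgebra.toSubmodule = N}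
  obtain ⟨_, ⟨T', hT', hle, rfl⟩, hmax⟩ := (wellFounded_gt (α := Submodule F L)).has_min P
    ⟨_, T, hT, le_rfl, rfl⟩
  refine ⟨T', hT', hle, fun z hz hzT => ?_⟩
  obtain ⟨T'', hT'', hle', hzT''⟩ := hT'.exists_le_mem hz hzT
  by_contra hz'
  refine hmax _ ⟨T'', hT'', hle.trans hle', rfl⟩ ?_
  exact lt_of_le_of_ne hle' fun h => hz' (h.ge hzT'')

end Induction

/-- A solvable restricted Lie algebra has a torus `T` such that, for the idempotent `e` of `T`, the
module `u(L) e` is local and of dimension `p ^ (dim L - dim T)` (the upper bound for the dimension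
holds for every torus). -/
theorem exists_torus_isLocalIdempotent {F : Type u} {p : ℕ} [Field F] [hp : Fact p.Prime]
    [CharP F p] (n : ℕ) : ∀ (L : Type v) [LieRing L]
    [LieAlgebra F L] [RestrictedLieAlgebra F p L] [FiniteDimensional F L]
    [LieAlgebra.IsSolvable L], Module.finrank F L = n →
    ∃ (T : PSubalgebra F p L) (e : RestrictedEnvelopingAlgebra F p L), T.IsTorus ∧
      IsTrivialIdempotent T e ∧ IsLocalIdempotent e ∧
      p ^ (Module.finrank F L - Module.finrank F T.toLieSubalgebra) ≤
        Module.finrank F (LinearMap.range (LinearMap.mulRight F e)) := by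
  induction n using Nat.strong_induction_on with
  | _ n ih =>
    intro L _ _ _ _ _ hn
    rcases subsingleton_or_nontrivial L with hL | hL
    · obtain ⟨⟨T, hT, -⟩, -⟩ := isGreatest_maxTorusDim F p L
      obtain ⟨e, he⟩ := exists_isTrivialIdempotent hT
      refine ⟨T, e, hT, he, isLocalIdempotent_of_simple he.mul_self ?_, ?_⟩
      · intro S _ _ _ _ _ _ s _ x s'
        rw [Subsingleton.elim x 0, map_zero, zero_smul]
      · rw [Module.finrank_zero_of_subsingleton, Nat.zero_sub, pow_zero, Nat.one_le_iff_ne_zero,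
          ← Nat.pos_iff_ne_zero, Module.finrank_pos_iff_exists_ne_zero]
        refine ⟨⟨e, 1, by simp⟩, fun h => ?_⟩
        have h1 : e = 0 := congrArg Subtype.val h
        have h2 := he.augmentation_eq
        rw [h1, map_zero] at h2
        exact zero_ne_one h2
    obtain ⟨I, hI, hlt, hcase⟩ := exists_maximal_pSubalgebra (F := F) (p := p) (L := L)
    have hsolv : LieAlgebra.IsSolvable I.toLieSubalgebra :=
      Function.Injective.lieAlgebra_isSolvable (f := I.toLieSubalgebra.incl)
        Subtype.val_injective
    obtain ⟨T, e, hT, he, hloc, hdim⟩ := ih _ (hn ▸ hlt) I.toLieSubalgebra rfl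
    have hTI : Module.finrank F T.toLieSubalgebra ≤ Module.finrank F I.toLieSubalgebra :=
      Submodule.finrank_le T.toLieSubalgebra.toSubmodule
    have hmapT := PSubalgebra.IsTorus.map I hT
    rcases hcase with ⟨x, hx, hxp, hspan⟩ | htorus
    · obtain ⟨z, hz, hzT⟩ := exists_centralizing_sub_mem hmapT
        (N := I.toLieSubalgebra.toSubmodule) hI x
      replace hz : x - z ∈ I.toLieSubalgebra := hz
      have hzI : z ∉ I.toLieSubalgebra := fun h => hx (by simpa using add_mem hz h)
      have hzspan : ∀ y : L, ∃ c : F, y - c • z ∈ I.toLieSubalgebra := by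
        intro y
        obtain ⟨c, hc⟩ := hspan y
        refine ⟨c, ?_⟩
        have := add_mem hc (I.toLieSubalgebra.smul_mem c hz)
        rwa [smul_sub, sub_add_sub_cancel] at this
      have hzp : pMap F p z ∈ I.toLieSubalgebra := by
        have hz' : z ∈ Submodule.span F (insert x (I.toLieSubalgebra : Set L)) := by
          have := sub_mem (Submodule.subset_span (R := F) (Set.mem_insert x _))
            (Submodule.subset_span (R := F) (s := insert x (I.toLieSubalgebra : Set L))
              (Or.inr hz))
          rwa [sub_sub_cancel] at this
        refine pMap_mem_of_mem_span (N := I.toLieSubalgebra.toSubmodule)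
          (fun a _ b _ => ⟨hI a b, Submodule.subset_span (Or.inr (hI a b))⟩) ?_ hz'
        rintro y (rfl | hy)
        · exact hxp
        · exact I.pMap_mem y hy
      refine ⟨PSubalgebra.map I T, inclusion I e, hmapT, he.inclusion I,
        hloc.inclusion_of_pMap_mem I hI hT he hzp hzspan, ?_⟩
      have h1 := mul_finrank_le_of_codim_one I hI he hzI hzp hzspan
        fun t ht => hzT t ⟨t, ht, rfl⟩
      refine le_trans ?_ ((Nat.mul_le_mul_left p hdim).trans h1)
      rw [← pow_succ', PSubalgebra.finrank_map]
      refine Nat.pow_le_pow_right hp.out.pos ?_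
      have h2 : I.toLieSubalgebra.toSubmodule ⊔ Submodule.span F {z} = ⊤ := by
        rw [eq_top_iff]
        intro y _
        obtain ⟨c, hc⟩ := hzspan y
        rw [← sub_add_cancel y (c • z)]
        exact add_mem (Submodule.mem_sup_left hc) (Submodule.mem_sup_right
          (Submodule.smul_mem _ _ (Submodule.mem_span_singleton_self z)))
      have h3 := Submodule.finrank_add_le_finrank_add_finrank I.toLieSubalgebra.toSubmodule
        (Submodule.span F {z})
      rw [h2, finrank_top] at h3
      have h4 := finrank_span_singleton (K := F) (v := z) fun h => hzI (h ▸ zero_mem _)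
      have h5 : Module.finrank F I.toLieSubalgebra.toSubmodule =
        Module.finrank F I.toLieSubalgebra := rfl
      omega
    · obtain ⟨T', hT', hle, hmax⟩ := exists_maximal_torus hmapT
      obtain ⟨e', he'⟩ := exists_isTrivialIdempotent hT'
      -- modulo `I`, every element is a combination of high `p`-th powers, which lie in `T'`
      have hsup' : I.toLieSubalgebra.toSubmodule ⊔ T'.toLieSubalgebra.toSubmodule = ⊤ := by
        rw [eq_top_iff]
        intro y _
        obtain ⟨z, hz, hzT⟩ := exists_centralizing_sub_mem hT'
          (N := I.toLieSubalgebra.toSubmodule) hI y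
        obtain ⟨k, hk⟩ := exists_isPSemisimple_iterate (F := F) (p := p) z
        have hkT : ∀ m, (pMap F p)^[m + k] z ∈ T'.toLieSubalgebra := by
          intro m
          induction m with
          | zero =>
            rw [zero_add]
            exact hmax _ hk fun t ht => lie_pMap_iterate_eq_zero (hzT t ht) k
          | succ m ihm =>
            rw [add_right_comm, Function.iterate_succ_apply']
            exact T'.pMap_mem _ ihm
        have h1 := mem_sup_span_iterate hI I.pMap_mem (htorus z) k
        rw [← sub_add_cancel y z]
        refine add_mem (Submodule.mem_sup_left hz) ?_
        have h2 : Submodule.span F {w | ∃ m : ℕ, k ≤ m ∧ w = (pMap F p)^[m] z} ≤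
            T'.toLieSubalgebra.toSubmodule := ?_
        · exact sup_le_sup_left h2 _ h1
        refine Submodule.span_le.2 ?_
        rintro _ ⟨m, hm, rfl⟩
        have := hkT (m - k)
        rwa [Nat.sub_add_cancel hm] at this
      have hsup : ∀ y : L, ∃ t ∈ T'.toLieSubalgebra, y - t ∈ I.toLieSubalgebra := by
        intro y
        have hy : y ∈ I.toLieSubalgebra.toSubmodule ⊔ T'.toLieSubalgebra.toSubmodule :=
          hsup' ▸ Submodule.mem_top
        obtain ⟨a, ha, t, ht, rfl⟩ := Submodule.mem_sup.1 hy
        exact ⟨t, ht, by rwa [add_sub_cancel_right]⟩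
      -- `T' ∩ I` is a torus of `I` containing `T`, and `T` has maximal dimension
      have hcomap : T.toLieSubalgebra.toSubmodule =
          (PSubalgebra.comap I T').toLieSubalgebra.toSubmodule :=
        Submodule.eq_of_le_of_finrank_le (fun t ht => hle ⟨t, ht, rfl⟩)
          (hloc.finrank_torus_le he hdim (PSubalgebra.IsTorus.comap I hT'))
      have hTT' : ∀ t : I.toLieSubalgebra, t ∈ T.toLieSubalgebra ↔
          (t : L) ∈ T'.toLieSubalgebra := fun t => SetLike.ext_iff.1 hcomap t
      refine ⟨T', e', hT', he', hloc.of_sup_eq_top I hI hT he hle hsup he', ?_⟩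
      refine le_trans ?_ (hdim.trans (finrank_le_of_torus I hI he hT' hTT' hsup he'))
      refine Nat.pow_le_pow_right hp.out.pos ?_
      have h1 := Submodule.finrank_sup_add_finrank_inf_eq I.toLieSubalgebra.toSubmodule
        T'.toLieSubalgebra.toSubmodule
      have h2 : I.toLieSubalgebra.toSubmodule ⊓ T'.toLieSubalgebra.toSubmodule =
          (PSubalgebra.map I T).toLieSubalgebra.toSubmodule := by
        ext y
        constructor
        · rintro ⟨hy, hy'⟩
          exact ⟨⟨y, hy⟩, (hTT' ⟨y, hy⟩).2 hy', rfl⟩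
        · rintro ⟨t, ht, rfl⟩
          exact ⟨t.2, (hTT' t).1 ht⟩
      have h3 : Module.finrank F (PSubalgebra.map I T).toLieSubalgebra.toSubmodule =
        Module.finrank F T.toLieSubalgebra := PSubalgebra.finrank_map I T
      rw [hsup', finrank_top, h2, h3] at h1
      have h5 : Module.finrank F I.toLieSubalgebra.toSubmodule =
        Module.finrank F I.toLieSubalgebra := rfl
      have h6 : Module.finrank F T'.toLieSubalgebra.toSubmodule =
        Module.finrank F T'.toLieSubalgebra := rfl
      omega

end RestrictedEnvelopingAlgebra

/-! ### Projective covers -/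

/-- Over a ring with nilpotent radical, an idempotent endomorphism of a projective module whose
image lies in the radical vanishes. -/
theorem LinearMap.eq_zero_of_range_le_jacobson {A P : Type*} [Ring A] [AddCommGroup P] [Module A P]
    [Module.Projective A P] (hA : IsNilpotent (Ring.jacobson A)) (θ : P →ₗ[A] P)
    (hθ : ∀ x, θ (θ x) = θ x) (hJ : ∀ x, θ x ∈ Module.jacobson A P) : θ = 0 := by
  obtain ⟨s, hs⟩ := Module.projective_def'.1 (inferInstance : Module.Projective A P)
  have hsum : ∀ x, (s x).sum (fun j a => a • j) = x := fun x => LinearMap.congr_fun hs x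
  -- coordinates of `θ x = ∑ (s (θ x))_j • θ j` lie in every power of the radical
  have hcoord : ∀ n, ∀ x i, s (θ x) i ∈ Ring.jacobson A ^ n := by
    intro n
    induction n with
    | zero => intro x i; rw [Submodule.pow_zero, Ideal.one_eq_top]; exact Submodule.mem_top
    | succ n ih =>
      intro x i
      have h1 : θ x = (s (θ x)).sum fun j a => a • θ j := by
        conv_lhs => rw [← hθ, ← hsum (θ x), map_finsuppSum]
        simp only [map_smul]
      rw [h1, map_finsuppSum, Finsupp.sum_apply, Ideal.IsTwoSided.pow_succ]
      refine sum_mem fun j _ => ?_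
      dsimp only
      rw [map_smul, Finsupp.smul_apply, smul_eq_mul]
      refine Ideal.mul_mem_mul ?_ (ih j i)
      exact Module.le_comap_jacobson (Finsupp.lapply j ∘ₗ s) (hJ x)
  obtain ⟨n, hn⟩ := hA
  ext x
  have h0 : s (θ x) = 0 := by
    ext i
    have := hcoord n x i
    rw [hn] at this
    exact this
  rw [← hsum (θ x), h0]
  simp

namespace RestrictedEnvelopingAlgebra

section ProjectiveCover

variable {F : Type u} {p : ℕ} {L : Type v} [Field F] [hp : Fact p.Prime] [LieRing L]
  [LieAlgebra F L] [RestrictedLieAlgebra F p L]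

/-- The left ideal `u(L) e`. -/
abbrev leftIdeal (e : RestrictedEnvelopingAlgebra F p L) :
    Submodule (RestrictedEnvelopingAlgebra F p L) (RestrictedEnvelopingAlgebra F p L) :=
  Ideal.span {e}

omit hp in
theorem mem_leftIdeal {e q : RestrictedEnvelopingAlgebra F p L} :
    q ∈ leftIdeal e ↔ ∃ a, a * e = q := Ideal.mem_span_singleton'

omit hp in
theorem mul_eq_of_mem_leftIdeal {e q : RestrictedEnvelopingAlgebra F p L} (he : e * e = e)
    (hq : q ∈ leftIdeal e) : q * e = q := by
  obtain ⟨a, rfl⟩ := mem_leftIdeal.1 hq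
  rw [mul_assoc, he]

omit hp in
theorem finrank_leftIdeal (e : RestrictedEnvelopingAlgebra F p L) :
    Module.finrank F (leftIdeal e) =
      Module.finrank F (LinearMap.range (LinearMap.mulRight F e)) := by
  have h : (leftIdeal e).restrictScalars F = LinearMap.range (LinearMap.mulRight F e) := by
    ext q
    exact mem_leftIdeal
  rw [← h]
  rfl

/-- The augmentation as a homomorphism from `u(L) e` to the trivial module. -/
noncomputable def leftIdealAugmentation (e : RestrictedEnvelopingAlgebra F p L) :
    leftIdeal e →ₗ[RestrictedEnvelopingAlgebra F p L] TrivialLModule F p L where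
  toFun q := augmentation F p L (q : RestrictedEnvelopingAlgebra F p L)
  map_add' _ _ := map_add (augmentation F p L) _ _
  map_smul' _ _ := map_mul (augmentation F p L) _ _

theorem leftIdealAugmentation_apply (e : RestrictedEnvelopingAlgebra F p L) (q : leftIdeal e) :
    leftIdealAugmentation e q = augmentation F p L (q : RestrictedEnvelopingAlgebra F p L) := rfl

theorem leftIdealAugmentation_surjective {e : RestrictedEnvelopingAlgebra F p L}
    (he1 : augmentation F p L e = 1) : Function.Surjective (leftIdealAugmentation e) := fun (c : F) =>
  ⟨⟨algebraMap F _ c * e, mem_leftIdeal.2 ⟨_, rfl⟩⟩, by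
    rw [leftIdealAugmentation_apply, map_mul, he1, mul_one]
    exact (augmentation F p L).commutes c⟩

theorem isProjectiveCover_leftIdealAugmentation {e : RestrictedEnvelopingAlgebra F p L}
    (he : e * e = e) (he1 : augmentation F p L e = 1) (hloc : IsLocalIdempotent e) :
    IsProjectiveCover (leftIdealAugmentation e) where
  projective := by
    let r : RestrictedEnvelopingAlgebra F p L →ₗ[RestrictedEnvelopingAlgebra F p L] leftIdeal e :=
      LinearMap.toSpanSingleton _ _ ⟨e, mem_leftIdeal.2 ⟨1, one_mul e⟩⟩
    refine Module.Projective.of_split (leftIdeal e).subtype r (LinearMap.ext fun q => ?_)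
    exact Subtype.ext (mul_eq_of_mem_leftIdeal he q.2)
  surjective := leftIdealAugmentation_surjective he1
  ker_le := by
    intro q hq
    refine Submodule.mem_sInf.2 fun N hN => ?_
    by_contra hqN
    have htop : N ⊔ Submodule.span _ {q} = ⊤ :=
      hN.2 _ (lt_of_le_of_ne le_sup_left fun h => hqN (by
        rw [h]; exact Submodule.mem_sup_right (Submodule.mem_span_singleton_self q)))
    have he' : (⟨e, mem_leftIdeal.2 ⟨1, one_mul e⟩⟩ : leftIdeal e) ∈
        N ⊔ Submodule.span _ {q} := htop ▸ Submodule.mem_top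
    obtain ⟨n, hn, r, hr, hnr⟩ := Submodule.mem_sup.1 he'
    obtain ⟨a, rfl⟩ := Submodule.mem_span_singleton.1 hr
    have h1 : leftIdealAugmentation e n = (1 : F) := by
      have h2 := congrArg (leftIdealAugmentation e) hnr
      rw [map_add, map_smul, LinearMap.mem_ker.1 hq, smul_zero, add_zero] at h2
      rw [h2, leftIdealAugmentation_apply, he1]
    obtain ⟨b, hb⟩ := hloc n (mul_eq_of_mem_leftIdeal he n.2) (by
      rw [← leftIdealAugmentation_apply, h1]; exact one_ne_zero)
    refine hN.1 (eq_top_iff.2 fun x _ => ?_)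
    have h3 : x = ((x : RestrictedEnvelopingAlgebra F p L) * b) • n := Subtype.ext (by
      change (x : RestrictedEnvelopingAlgebra F p L) = x * b * n
      rw [mul_assoc, hb, mul_eq_of_mem_leftIdeal he x.2])
    rw [h3]
    exact N.smul_mem _ hn

/-- Every projective cover of the trivial module is isomorphic to `u(L) e` for a local idempotent
`e`. No finiteness of the cover is presupposed; a complement of `u(L) e` in it is projective and
coincides with its own radical, hence vanishes. -/
theorem nonempty_linearEquiv_leftIdeal [FiniteDimensional F L]
    {e : RestrictedEnvelopingAlgebra F p L}
    (he : e * e = e) (he1 : augmentation F p L e = 1) (hloc : IsLocalIdempotent e)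
    {P : Type*} [AddCommGroup P] [Module (RestrictedEnvelopingAlgebra F p L) P]
    {π : P →ₗ[RestrictedEnvelopingAlgebra F p L] TrivialLModule F p L}
    (hπ : IsProjectiveCover π) :
    Nonempty (P ≃ₗ[RestrictedEnvelopingAlgebra F p L] leftIdeal e) := by
  have hproj := hπ.projective
  let e₁ : leftIdeal e := ⟨e, mem_leftIdeal.2 ⟨1, one_mul e⟩⟩
  obtain ⟨k, hk⟩ := Module.projective_lifting_property (leftIdealAugmentation e) π
    (leftIdealAugmentation_surjective he1)
  obtain ⟨p₀, hp₀⟩ := hπ.surjective (1 : F)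
  let h : leftIdeal e →ₗ[RestrictedEnvelopingAlgebra F p L] P :=
    LinearMap.toSpanSingleton _ _ p₀ ∘ₗ (leftIdeal e).subtype
  have hh : ∀ q, h q = (q : RestrictedEnvelopingAlgebra F p L) • p₀ := fun _ => rfl
  have hkh : Function.Surjective (k ∘ₗ h) := by
    have h1 : augmentation F p L (k (h e₁) : RestrictedEnvelopingAlgebra F p L) = (1 : F) := by
      have h2 : π (h e₁) = (1 : F) := by
        rw [hh, map_smul, hp₀]
        exact (congrArg (· * (1 : F)) he1).trans (mul_one 1)
      exact (LinearMap.congr_fun hk (h e₁)).trans h2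
    obtain ⟨a, ha⟩ := hloc _ (mul_eq_of_mem_leftIdeal he (k (h e₁)).2) (by
      rw [h1]; exact one_ne_zero)
    intro r
    refine ⟨((r : RestrictedEnvelopingAlgebra F p L) * a) • e₁, ?_⟩
    rw [map_smul]
    refine Subtype.ext ?_
    change (r : RestrictedEnvelopingAlgebra F p L) * a * (k (h e₁) : _) = r
    rw [mul_assoc, ha, mul_eq_of_mem_leftIdeal he r.2]
  have hart : IsArtinianRing (RestrictedEnvelopingAlgebra F p L) :=
    isArtinian_of_tower F inferInstance
  have hnoeth : IsNoetherian (RestrictedEnvelopingAlgebra F p L)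
      (RestrictedEnvelopingAlgebra F p L) := isNoetherian_of_tower F inferInstance
  have hinj : Function.Injective (k ∘ₗ h) :=
    IsNoetherian.injective_of_surjective_endomorphism _ hkh
  let ψ := LinearEquiv.ofBijective (k ∘ₗ h) ⟨hinj, hkh⟩
  have hψ : ∀ q, ψ q = k (h q) := fun _ => rfl
  let θ : P →ₗ[RestrictedEnvelopingAlgebra F p L] P :=
    LinearMap.id - h ∘ₗ ψ.symm.toLinearMap ∘ₗ k
  have hθ : ∀ x, θ x = x - h (ψ.symm (k x)) := fun _ => rfl
  have hkθ : ∀ x, k (θ x) = 0 := fun x => by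
    rw [hθ, map_sub, ← hψ, LinearEquiv.apply_symm_apply, sub_self]
  have hθ0 : θ = 0 := by
    refine LinearMap.eq_zero_of_range_le_jacobson ?_ θ (fun x => ?_) fun x => hπ.ker_le ?_
    · have := IsArtinianRing.isNilpotent_jacobson_bot
        (R := RestrictedEnvelopingAlgebra F p L)
      rwa [Ideal.jacobson_bot] at this
    · rw [hθ (θ x), hkθ, map_zero, map_zero, sub_zero]
    · rw [LinearMap.mem_ker, ← hk, LinearMap.comp_apply, hkθ, map_zero]
  have hhψ : ∀ x, h (ψ.symm (k x)) = x := fun x => by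
    have := LinearMap.congr_fun hθ0 x
    rw [hθ, LinearMap.zero_apply, sub_eq_zero] at this
    exact this.symm
  refine ⟨LinearEquiv.ofBijective k ⟨fun x y hxy => ?_, fun r => ?_⟩⟩
  · rw [← hhψ x, hxy, hhψ]
  · exact ⟨h (ψ.symm r), by rw [← hψ, LinearEquiv.apply_symm_apply]⟩

/-- The module induced from the trivial `u(T)`-module is `u(L) e`. -/
theorem nonempty_ind_linearEquiv_leftIdeal {T : PSubalgebra F p L}
    {e : RestrictedEnvelopingAlgebra F p L} (he : IsTrivialIdempotent T e) :
    Nonempty (Ind T (TrivialLModule F p T.toLieSubalgebra) ≃ₗ[RestrictedEnvelopingAlgebra F p L]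
      leftIdeal e) := by
  let V := TrivialLModule F p T.toLieSubalgebra
  let one : V := (1 : F)
  let toV : F → V := id
  let e₁ : leftIdeal e := ⟨e, mem_leftIdeal.2 ⟨1, one_mul e⟩⟩
  have hincl : ∀ b, inclusion T b ∈ Algebra.adjoin F (ι F p L '' T.toLieSubalgebra) := by
    intro b
    induction b using induction_on with
    | hι x => rw [inclusion_ι]; exact Algebra.subset_adjoin ⟨x, x.2, rfl⟩
    | hF c => rw [AlgHom.commutes]; exact Subalgebra.algebraMap_mem _ c
    | hadd a b ha hb => rw [map_add]; exact add_mem ha hb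
    | hmul a b ha hb => rw [map_mul]; exact mul_mem ha hb
  have hmul : ∀ b, inclusion T b * e = augmentation F p _ b • e := fun b => by
    rw [he.mul_eq_of_mem_adjoin (hincl b), augmentation_inclusion]
  obtain ⟨e₀, he₀⟩ : ∃ e₀, inclusion T e₀ = e := by
    have h1 : Algebra.adjoin F (ι F p L '' T.toLieSubalgebra) ≤ (inclusion T).range := by
      rw [Algebra.adjoin_le_iff]
      rintro _ ⟨t, ht, rfl⟩
      exact ⟨ι F p _ ⟨t, ht⟩, inclusion_ι T ⟨t, ht⟩⟩
    exact h1 he.mem_adjoin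
  let Φ₀ : RestrictedEnvelopingAlgebra F p L ⊗[F] V →ₗ[RestrictedEnvelopingAlgebra F p L]
      leftIdeal e :=
    TensorProduct.AlgebraTensorModule.lift
      (LinearMap.toSpanSingleton _ (V →ₗ[F] leftIdeal e)
        (LinearMap.toSpanSingleton F (leftIdeal e) e₁ : F →ₗ[F] leftIdeal e))
  have hΦ₀ : ∀ (a : RestrictedEnvelopingAlgebra F p L) (c : F),
      Φ₀ (a ⊗ₜ toV c) = a • c • e₁ := fun _ _ => rfl
  let Φ : Ind T V →ₗ[RestrictedEnvelopingAlgebra F p L] leftIdeal e :=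
    Submodule.liftQ _ Φ₀ (by
      rw [Submodule.span_le]
      rintro _ ⟨a, b, (c : F), rfl⟩
      rw [SetLike.mem_coe, LinearMap.mem_ker, map_sub, sub_eq_zero]
      refine (hΦ₀ _ c).trans (Eq.trans ?_ (hΦ₀ a (augmentation F p _ b * c)).symm)
      refine Subtype.ext ?_
      change a * inclusion T b * (c • e) = a * ((augmentation F p _ b * c) • e)
      rw [mul_assoc, mul_smul_comm, hmul, smul_smul, mul_comm c])
  let Ψ : leftIdeal e →ₗ[RestrictedEnvelopingAlgebra F p L] Ind T V :=
    LinearMap.toSpanSingleton _ _ (Submodule.Quotient.mk (1 ⊗ₜ[F] one)) ∘ₗ (leftIdeal e).subtype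
  have hrel : (Submodule.Quotient.mk (e ⊗ₜ[F] one) : Ind T V) =
      Submodule.Quotient.mk (1 ⊗ₜ[F] one) := by
    rw [Submodule.Quotient.eq]
    refine Submodule.subset_span ⟨1, e₀, one, ?_⟩
    have h1 : e₀ • one = one := by
      rw [TrivialLModule.smul_def, ← augmentation_inclusion, he₀, he.augmentation_eq, one_smul]
    rw [h1, he₀, one_mul]
  have hΨ : ∀ a : RestrictedEnvelopingAlgebra F p L,
      Ψ (a • e₁) = a • Submodule.Quotient.mk (1 ⊗ₜ[F] one) := by
    intro a
    rw [map_smul]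
    congr 1
    change e • (Submodule.Quotient.mk (1 ⊗ₜ[F] one) : Ind T V) = _
    rw [← Submodule.Quotient.mk_smul, TensorProduct.smul_tmul', smul_eq_mul, mul_one, hrel]
  refine ⟨LinearEquiv.ofLinearMap Φ Ψ ?_ ?_⟩
  · refine LinearMap.ext fun q => ?_
    change Φ ((q : RestrictedEnvelopingAlgebra F p L) • Submodule.Quotient.mk (1 ⊗ₜ[F] one)) = q
    rw [map_smul]
    change (q : RestrictedEnvelopingAlgebra F p L) • Φ₀ (1 ⊗ₜ toV 1) = q
    have h1 : (1 : RestrictedEnvelopingAlgebra F p L) • (1 : F) • e₁ = e₁ := by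
      rw [one_smul]
      exact one_smul F e₁
    rw [hΦ₀, h1]
    exact Subtype.ext (mul_eq_of_mem_leftIdeal he.mul_self q.2)
  · refine LinearMap.ext fun z => ?_
    obtain ⟨z, rfl⟩ := Submodule.Quotient.mk_surjective _ z
    induction z using TensorProduct.induction_on with
    | zero => simp
    | add x y hx hy => rw [Submodule.Quotient.mk_add, map_add, hx, hy, map_add]
    | tmul a c =>
      obtain ⟨c, rfl⟩ : ∃ d : F, toV d = c := ⟨c, rfl⟩
      have h1 : a • c • e₁ = (c • a) • e₁ := by
        rw [smul_comm, smul_assoc]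
      have h2 : c • one = toV c := mul_one c
      change Ψ (Φ₀ (a ⊗ₜ toV c)) = Submodule.Quotient.mk (a ⊗ₜ toV c)
      rw [hΦ₀, h1, hΨ, ← Submodule.Quotient.mk_smul, TensorProduct.smul_tmul', smul_eq_mul,
        mul_one, TensorProduct.smul_tmul, h2]

/-- For a solvable restricted Lie algebra the idempotent of every torus of maximal dimension is
local, and `dim u(L) e = p ^ (dim L - MT(L))`. -/
theorem isLocalIdempotent_of_finrank_eq_maxTorusDim [CharP F p] [FiniteDimensional F L]
    [LieAlgebra.IsSolvable L] {T : PSubalgebra F p L} (hT : T.IsTorus)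
    (hdim : Module.finrank F T.toLieSubalgebra = maxTorusDim F p L)
    {e : RestrictedEnvelopingAlgebra F p L} (he : IsTrivialIdempotent T e) :
    IsLocalIdempotent e ∧ Module.finrank F (LinearMap.range (LinearMap.mulRight F e)) =
      p ^ (Module.finrank F L - maxTorusDim F p L) := by
  obtain ⟨T', e', hT', he', hloc, hdim'⟩ :=
    exists_torus_isLocalIdempotent (F := F) (p := p) _ L rfl
  have h1 := hloc.finrank_torus_le he' hdim' hT
  have h2 := (isGreatest_maxTorusDim F p L).2 ⟨T', hT', rfl⟩
  have h3 : Module.finrank F T'.toLieSubalgebra = maxTorusDim F p L := by omega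
  have h4 := (finite_and_finrank_range_mulRight_le T.toLieSubalgebra.toSubmodule e he.ι_mul).2
  have h5 := hloc.finrank_le he'.mul_self he'.augmentation_eq he.augmentation_eq
  rw [h3] at hdim'
  have h6 : Module.finrank F T.toLieSubalgebra.toSubmodule = maxTorusDim F p L := hdim
  rw [h6] at h4
  refine ⟨?_, le_antisymm h4 (hdim'.trans h5)⟩
  -- right multiplication by `e'` maps `u(L) e` onto `u(L) e'`, injectively as dimensions agree
  let g : LinearMap.range (LinearMap.mulRight F e) →ₗ[F]
      LinearMap.range (LinearMap.mulRight F e') :=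
    LinearMap.codRestrict _ (LinearMap.mulRight F e' ∘ₗ Submodule.subtype _) fun q => ⟨q, rfl⟩
  have hg : Function.Surjective g := by
    rintro ⟨_, a, rfl⟩
    obtain ⟨c, hc⟩ := hloc.exists_mul_mul_mul_eq he'.mul_self he'.augmentation_eq
      he.augmentation_eq
    refine ⟨⟨a * c * e' * e, a * c * e', rfl⟩, Subtype.ext ?_⟩
    change a * c * e' * e * e' = a * e'
    conv_rhs => rw [← hc]
    simp only [mul_assoc]
  have hg' : Function.Injective g :=
    (LinearMap.injective_iff_surjective_of_finrank_eq_finrank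
      (le_antisymm (h4.trans hdim') h5)).2 hg
  intro q hq hq0
  obtain ⟨a, ha⟩ := hloc (q * e') (by rw [mul_assoc, he'.mul_self])
    (by rw [map_mul, he'.augmentation_eq, mul_one]; exact hq0)
  refine ⟨e * a, ?_⟩
  have h7 : g ⟨e * a * q, e * a * q, by rw [LinearMap.mulRight_apply, mul_assoc, hq]⟩ =
      g ⟨e, 1, by simp⟩ := Subtype.ext (by
    change e * a * q * e' = e * e'
    rw [mul_assoc, mul_assoc, ha])
  exact congrArg Subtype.val (hg' h7)

end ProjectiveCover

end RestrictedEnvelopingAlgebra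

open RestrictedEnvelopingAlgebra in
theorem mainTheorem2 (F : Type u) (p : ℕ) (L : Type v) [Field F] [Fact p.Prime] [CharP F p]
    [LieRing L] [LieAlgebra F L] [FiniteDimensional F L] [RestrictedLieAlgebra F p L]
    [LieAlgebra.IsSolvable L] :
    HasMaximalZeroPIM F p L ∧
      ∀ (P : Type w) [AddCommGroup P] [Module (RestrictedEnvelopingAlgebra F p L) P]
        (π : P →ₗ[RestrictedEnvelopingAlgebra F p L] TrivialLModule F p L),
        IsProjectiveCover π →
        ∀ T : PSubalgebra F p L, T.IsTorus →
          Module.finrank F T.toLieSubalgebra = maxTorusDim F p L →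
          Nonempty (P ≃ₗ[RestrictedEnvelopingAlgebra F p L]
            Ind T (TrivialLModule F p T.toLieSubalgebra)) := by
  constructor
  · obtain ⟨T, hT, hdim⟩ := (isGreatest_maxTorusDim F p L).1
    obtain ⟨e, he⟩ := exists_isTrivialIdempotent hT
    obtain ⟨hloc, hfin⟩ := isLocalIdempotent_of_finrank_eq_maxTorusDim hT hdim he
    exact ⟨leftIdeal e, inferInstance, inferInstance, inferInstance, inferInstance,
      leftIdealAugmentation e,
      isProjectiveCover_leftIdealAugmentation he.mul_self he.augmentation_eq hloc,
      (finrank_leftIdeal e).trans hfin⟩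
  · intro P _ _ π hπ T hT hdim
    obtain ⟨e, he⟩ := exists_isTrivialIdempotent hT
    obtain ⟨hloc, -⟩ := isLocalIdempotent_of_finrank_eq_maxTorusDim hT hdim he
    obtain ⟨f⟩ := nonempty_linearEquiv_leftIdeal he.mul_self he.augmentation_eq hloc hπ
    obtain ⟨g⟩ := nonempty_ind_linearEquiv_leftIdeal he
    exact ⟨f.trans g.symm⟩
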